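/- Let $(\mathbb X,\mathcal X)$ be a measurable space, $\Lambda$ a $\sigma$-finite measure on $\mathbb X$, and let $\mathbf N$ be the space of all $\sigma$-finite measures on $\mathbb X$ with values in $\{0,1,2,\dots,\infty\}$, with the smallest $\sigma$-field making all maps $\mu\mapsto\mu(B)$, $B\in\mathcal X$, measurable. Let $\eta$ be a Poisson process on $\mathbb X$ with intensity measure $\Lambda$, defined on a probability space $(\Omega,\mathcal A,\mathbb P)$, and proper: almost surely $\eta=\sum_{n=1}^{\kappa}\delta_{X_n}$ with random elements $X_1,X_2,\dots$ of $\mathbb X$ and a $\{0,1,\dots,\infty\}$-valued random variable $\kappa$. For $0\le t\le 1$ let $\eta_t$ be a $t$-thinning of $\eta$, that is, almost surely $\eta_t=\sum_{n=1}^{\kappa}Y_n^{(t)}\delta_{X_n}$, where $Y^{(t)}_1,Y^{(t)}_2,\dots$ are independent with distribution $(1-t)\delta_0+t\delta_1$ and $(Y^{(t)}_n)_{n\ge1}$ is independent of $(\kappa,X_1,X_2,\dots)$; the thinnings are chosen such that $(t,\omega)\mapsto\eta_t(\omega)$ is measurable. Let $\Pi_{c\Lambda}$ denote the distribution of a Poisson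 process with intensity measure $c\Lambda$. Let $f\colon\mathbf N\to\mathbb R$ be measurable, let $F=f(\eta)$ almost surely, and assume $F\in L^2(\mathbb P)$. Write $D_xg(\mu)=g(\mu+\delta_x)-g(\mu)$ for $g\colon\mathbf N\to\mathbb R$, $D_xF=D_xf(\eta)$, $D_xe^{sF}=D_x(e^{sf})(\eta)$, and define $$s_F=\sup\{s\ge0: e^{sF}\in L^2(\mathbb P),\ De^{sF}\in L^2(\mathbb P\otimes\Lambda)\}\in[0,\infty],$$ $$V_F(u)=\int_{\mathbb X}\big(e^{uD_xF}-1\big)\int_0^1\int_{\mathbf N}D_xf(\eta_t+\mu)\,\Pi_{(1-t)\Lambda}(d\mu)\,dt\,\Lambda(dx).$$ Let $s\in(0,s_F)$ be such that $De^{uF}\in L^2(\mathbb P\otimes\Lambda)$ for all $u\in(0,s)$. Then $$\log\mathbb E\big[e^{s(F-\mathbb E[F])}\big]\le\inf_{0<\theta<1}\frac{\theta}{1-\theta}\Big(\int_0^s\Big(\frac1s\log\mathbb E\big[e^{sV_F(u)/\theta}\big]-\frac1u\log\mathbb E\big[e^{uF}\big]\Big)du+s\,\mathbb E[F]\Big)\le\inf_{0<\theta<1}\frac{\theta}{s(1-\theta)}\int_0^s\log\mathbb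 E\big[e^{sV_F(u)/\theta}\big]\,du.$$ Here $\log\mathbb E[e^{sV_F(u)/\theta}]=\infty$ if $e^{sV_F(u)/\theta}$ is not integrable, and integrals and infima are taken in the extended reals. -/

import Mathlib

open MeasureTheory ProbabilityTheory Set
open scoped ENNReal NNReal

noncomputable section

/-- The space `𝐍(𝕏)` of all `σ`-finite measures on `𝕏` with values in `{0, 1, 2, …, ∞}`.
As a subtype of `Measure 𝕏` it carries the smallest `σ`-field for which all evaluations
`μ ↦ μ B`, `B` measurable, are measurable. -/
abbrev PointMeasure (𝕏 : Type*) [MeasurableSpace 𝕏] : Type _ :=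
  {μ : Measure 𝕏 // SigmaFinite μ ∧ ∀ B, MeasurableSet B → ∃ n : ℕ∞, μ B = (n : ℝ≥0∞)}

namespace PointMeasure

variable {𝕏 : Type*} [MeasurableSpace 𝕏]

/-- The sum of two point measures. -/
def add (μ ν : PointMeasure 𝕏) : PointMeasure 𝕏 :=
  ⟨μ.1 + ν.1, by
    have := μ.2.1
    have := ν.2.1
    infer_instance, fun B hB => by
    obtain ⟨m, hm⟩ := μ.2.2 B hB
    obtain ⟨n, hn⟩ := ν.2.2 B hB
    exact ⟨m + n, by rw [Measure.add_apply, hm, hn, ENat.toENNReal_add]⟩⟩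

/-- The Dirac measure `δ_x` as a point measure. -/
def dirac (x : 𝕏) : PointMeasure 𝕏 :=
  ⟨Measure.dirac x, inferInstance, fun B hB => by
    by_cases h : x ∈ B
    · exact ⟨1, by rw [Measure.dirac_apply' x hB]; simp [h]⟩
    · exact ⟨0, by rw [Measure.dirac_apply' x hB]; simp [h]⟩⟩

/-- The difference operator `D_x f(μ) = f(μ + δ_x) - f(μ)`. -/
def diff (f : PointMeasure 𝕏 → ℝ) (x : 𝕏) (μ : PointMeasure 𝕏) : ℝ :=
  f (μ.add (dirac x)) - f μ

end PointMeasure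

/-- The Poisson distribution on `{0, 1, 2, …, ∞} ⊆ [0, ∞]` with parameter `r ∈ [0, ∞]`;
for `r = ∞` it is the point mass at `∞`. -/
def extPoisson (r : ℝ≥0∞) : Measure ℝ≥0∞ :=
  if r = ∞ then Measure.dirac ∞
  else (poissonMeasure r.toNNReal).map (fun n : ℕ => (n : ℝ≥0∞))

/-- `η` is a Poisson process on `𝕏` with intensity measure `Λ`, defined on `(Ω, P)`. -/
structure IsPoissonProcess {Ω 𝕏 : Type*} [MeasurableSpace Ω] [MeasurableSpace 𝕏]
    (P : Measure Ω) (η : Ω → PointMeasure 𝕏) (Λ : Measure 𝕏) : Prop where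
  measurable : Measurable η
  law : ∀ B, MeasurableSet B → P.map (fun ω => (η ω).1 B) = extPoisson (Λ B)
  indep : ∀ (m : ℕ) (B : Fin m → Set 𝕏), (∀ i, MeasurableSet (B i)) →
    Pairwise (fun i j => Disjoint (B i) (B j)) →
    iIndepFun (fun i ω => (η ω).1 (B i)) P

open Classical in
/-- `Π_Λ`: the distribution of a Poisson process with intensity measure `Λ`, that is, the
(unique) measure on `𝐍(𝕏)` under which the identity is such a process. -/
def poissonProcessLaw {𝕏 : Type*} [MeasurableSpace 𝕏] (Λ : Measure 𝕏) :
    Measure (PointMeasure 𝕏) :=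
  if h : ∃ Q : Measure (PointMeasure 𝕏), IsPoissonProcess Q (fun μ => μ) Λ then h.choose else 0

/-- `η = ∑_{n < κ} δ_{X n}` almost surely, with random elements `X n` of `𝕏` and a random
variable `κ` with values in `{0, 1, 2, …, ∞}`. -/
structure IsProperRep {Ω 𝕏 : Type*} [MeasurableSpace Ω] [MeasurableSpace 𝕏]
    (P : Measure Ω) (η : Ω → PointMeasure 𝕏) (κ : Ω → ℕ∞) (X : ℕ → Ω → 𝕏) : Prop where
  measurable_card : Measurable κ
  measurable_point : ∀ n, Measurable (X n)
  eq_sum : ∀ᵐ ω ∂P, (η ω).1 =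
    Measure.sum (fun n : ℕ => if (n : ℕ∞) < κ ω then Measure.dirac (X n ω) else 0)

/-- `ξ` is a `t`-thinning of `∑_{n < κ} δ_{X n}`: almost surely `ξ = ∑_{n < κ} Y n • δ_{X n}`,
where the `Y n` are independent with distribution `(1 - t) δ_0 + t δ_1`, and the sequence `Y`
is independent of `(κ, X)`. -/
def IsThinning {Ω 𝕏 : Type*} [MeasurableSpace Ω] [MeasurableSpace 𝕏]
    (P : Measure Ω) (κ : Ω → ℕ∞) (X : ℕ → Ω → 𝕏) (t : ℝ) (ξ : Ω → PointMeasure 𝕏) : Prop :=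
  ∃ Y : ℕ → Ω → ℕ,
    (∀ n, Measurable (Y n)) ∧
    (∀ n, P.map (Y n) =
      ENNReal.ofReal (1 - t) • Measure.dirac 0 + ENNReal.ofReal t • Measure.dirac 1) ∧
    iIndepFun Y P ∧
    IndepFun (fun ω n => Y n ω) (fun ω => (κ ω, fun n => X n ω)) P ∧
    ∀ᵐ ω ∂P, (ξ ω).1 =
      Measure.sum (fun n : ℕ =>
        if (n : ℕ∞) < κ ω then (Y n ω : ℝ≥0∞) • Measure.dirac (X n ω) else 0)

/-- `D e^{sF} : Ω × 𝕏 → ℝ` for the Poisson functional `F = f(η)`. -/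
def diffExp {Ω 𝕏 : Type*} [MeasurableSpace 𝕏]
    (η : Ω → PointMeasure 𝕏) (f : PointMeasure 𝕏 → ℝ) (s : ℝ) (p : Ω × 𝕏) : ℝ :=
  PointMeasure.diff (fun μ => Real.exp (s * f μ)) p.2 (η p.1)

/-- `s_F = sup {s ≥ 0 : e^{sF} ∈ L²(P), D e^{sF} ∈ L²(P ⊗ Λ)} ∈ [0, ∞]`. -/
def criticalExponent {Ω 𝕏 : Type*} [MeasurableSpace Ω] [MeasurableSpace 𝕏]
    (P : Measure Ω) (Λ : Measure 𝕏) (η : Ω → PointMeasure 𝕏) (f : PointMeasure 𝕏 → ℝ)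
    (F : Ω → ℝ) : EReal :=
  sSup ((fun s : ℝ => (s : EReal)) '' {s : ℝ | 0 ≤ s ∧
    MemLp (fun ω => Real.exp (s * F ω)) 2 P ∧ MemLp (diffExp η f s) 2 (P.prod Λ)})

/-- `V_F(s) = ∫ (e^{s D_x F} - 1) ∫_0^1 ∫ D_x f(η_t + μ) Π_{(1-t)Λ}(dμ) dt Λ(dx)`,
where `ηt t` is the `t`-thinning of `η`. -/
def varV {Ω 𝕏 : Type*} [MeasurableSpace 𝕏]
    (Λ : Measure 𝕏) (η : Ω → PointMeasure 𝕏) (ηt : ℝ → Ω → PointMeasure 𝕏)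
    (f : PointMeasure 𝕏 → ℝ) (s : ℝ) (ω : Ω) : ℝ :=
  ∫ x, (Real.exp (s * PointMeasure.diff f x (η ω)) - 1) *
    (∫ t in (0 : ℝ)..1, ∫ μ, PointMeasure.diff f x ((ηt t ω).add μ)
      ∂(poissonProcessLaw (ENNReal.ofReal (1 - t) • Λ))) ∂Λ

/-- `log E[e^{cZ}] ∈ [-∞, ∞]`, equal to `∞` if `e^{cZ}` is not integrable. -/
def logMGF {Ω : Type*} [MeasurableSpace Ω] (P : Measure Ω) (Z : Ω → ℝ) (c : ℝ) : EReal :=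
  ENNReal.log (∫⁻ ω, ENNReal.ofReal (Real.exp (c * Z ω)) ∂P)

/-- `∫_0^s g(u) du` for an extended real valued integrand: the integral of the positive part
minus the integral of the negative part. (Should both be infinite, the value is `-∞`, which
makes an upper bound by this quantity false, so it never helps.) -/
def extIntegral (s : ℝ) (g : ℝ → EReal) : EReal :=
  ((∫⁻ u in Ioc 0 s, (g u).toENNReal : ℝ≥0∞) : EReal) -
    ((∫⁻ u in Ioc 0 s, (-g u).toENNReal : ℝ≥0∞) : EReal)

end

/-! Write h(u) = log E e^{uF} and m = E F. The heart of the proof is a covariance representation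
(`IsThinningFamily.integral_condDiff_mul_diff`): Cov(f(η), g(η)) is the integral over Ω × 𝕏 × (0,1]
of T f · D_x g(η). Here T f = `condDiff` averages D_x f over the superposition of η_t and an
independent Poisson process of intensity (1-t)Λ. For g = e^{uf} it says Cov(F, e^{uF}) = E[e^{uF}
V_F(u)], so V_F(u) has mean h'(u) - m under the tilted law with density e^{uF} / E e^{uF}.

Entropy duality (`entropy_le`) compares that mean with log E e^{sV_F(u)/θ} and the entropy u h'(u) -
h(u) of the tilted law. The result is ((1-θ)h'(u) - m)/θ ≤ (1/s) log E e^{sV_F(u)/θ} - h(u)/u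
(`slope_le`). Integrating over (0,s) with h(0) = 0 gives the first bound, and Jensen's inequality
h(u) ≥ um then removes h and gives the second.

The representation is first checked on exponential functionals μ ↦ e^{-∫h dμ}. There D_x acts as
multiplication by e^{-h(x)} - 1, everything is explicit, and the claim Cov(f, g) = ∫ T f · T g
reduces to e^q - 1 = ∫_0^1 q e^{tq} dt. These functionals span a dense subspace of L², because
Laplace functionals determine finite measures (`topologicalClosure_span_expLpSet`). On the diagonal
the identity reads ‖T f‖² = Var f ≤ ‖f‖², so T extends continuously to L². The extension is still
given by the pointwise formula, thanks to a local L¹ bound from the Mecke equation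
(`IsThinningFamily.coeFn_condDiffCLM`). Finally T g can be replaced by D_x g(η): given η_t, the
process η is η_t plus an independent Poisson process (`IsThinning.map_withDensity_expNeg`), so T g
is the conditional mean of D_x g(η).

The facts about Poisson processes, thinnings and the Mecke equation are obtained by comparing
Laplace functionals. -/

/-! ### Laplace transforms of finite measures on powers of [0, ∞]. -/

/-- The function `x ↦ e^{-x}` on `[0, ∞]`. -/
noncomputable def expNeg (x : ℝ≥0∞) : ℝ≥0∞ := EReal.exp (-(x : EReal))

@[simp] lemma expNeg_zero : expNeg 0 = 1 := by simp [expNeg]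

@[simp] lemma expNeg_top : expNeg ∞ = 0 := by simp [expNeg]

lemma expNeg_add (x y : ℝ≥0∞) : expNeg (x + y) = expNeg x * expNeg y := by
  rw [expNeg, expNeg, expNeg, ← EReal.exp_add, EReal.coe_ennreal_add, EReal.neg_add, sub_eq_add_neg]
  · left; simp
  · right; simp

lemma expNeg_le_one (x : ℝ≥0∞) : expNeg x ≤ 1 := by
  rw [expNeg, EReal.exp_le_one_iff, EReal.neg_le_zero]
  exact EReal.coe_ennreal_nonneg x

lemma expNeg_ne_top (x : ℝ≥0∞) : expNeg x ≠ ∞ := ((expNeg_le_one x).trans_lt (by simp)).ne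

lemma expNeg_coe (r : ℝ≥0) : expNeg r = ENNReal.ofReal (Real.exp (-r)) := by
  rw [expNeg, EReal.coe_nnreal_eq_coe_real, ← EReal.coe_neg, EReal.exp_coe]

lemma expNeg_ofReal {r : ℝ} (hr : 0 ≤ r) :
    expNeg (ENNReal.ofReal r) = ENNReal.ofReal (Real.exp (-r)) := by
  rw [ENNReal.ofReal, expNeg_coe, Real.coe_toNNReal r hr]

lemma expNeg_eq_ofReal {x : ℝ≥0∞} (hx : x ≠ ∞) :
    expNeg x = ENNReal.ofReal (Real.exp (-x.toReal)) := by
  rw [← expNeg_ofReal ENNReal.toReal_nonneg, ENNReal.ofReal_toReal hx]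

lemma continuous_expNeg : Continuous expNeg :=
  ENNReal.continuous_exp.comp (continuous_neg.comp continuous_coe_ennreal_ereal)

@[fun_prop] lemma measurable_expNeg : Measurable expNeg := continuous_expNeg.measurable

lemma expNeg_strictAnti : StrictAnti expNeg := by
  intro x y h
  rw [expNeg, expNeg, EReal.exp_lt_exp_iff, EReal.neg_lt_neg_iff]
  exact_mod_cast h

lemma expNeg_sum {ι : Type*} (s : Finset ι) (x : ι → ℝ≥0∞) :
    expNeg (∑ i ∈ s, x i) = ∏ i ∈ s, expNeg (x i) := by
  classical
  induction s using Finset.induction_on with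
  | empty => simp
  | insert a s ha ih => rw [Finset.sum_insert ha, Finset.prod_insert ha, expNeg_add, ih]

lemma expNeg_nat_mul (n : ℕ) (x : ℝ≥0∞) : expNeg (n * x) = expNeg x ^ n := by
  induction n with
  | zero => simp
  | succ n ih => rw [Nat.cast_succ, add_mul, one_mul, expNeg_add, ih, pow_succ]

/-- Finite measures on `[0, ∞]^ι` with the same Laplace transform are equal. -/
theorem ext_of_lintegral_expNeg {ι : Type*} [Fintype ι] {M N : Measure (ι → ℝ≥0∞)}
    [IsFiniteMeasure M] [IsFiniteMeasure N]
    (h : ∀ a : ι → ℕ, ∫⁻ x, expNeg (∑ i, a i * x i) ∂M = ∫⁻ x, expNeg (∑ i, a i * x i) ∂N) :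
    M = N := by
  -- The separation theorem applied below concerns complete separable metric spaces, so a compatible
  -- metric is fixed.
  let _ := TopologicalSpace.upgradeIsCompletelyMetrizable (ι → ℝ≥0∞)
  have hcont (a : ι → ℕ) : Continuous fun x : ι → ℝ≥0∞ => (expNeg (∑ i, a i * x i)).toReal := by
    refine ENNReal.continuousOn_toReal.comp_continuous (continuous_expNeg.comp ?_)
      (fun x => expNeg_ne_top _)
    exact continuous_finsetSum _ fun i _ => 
      (ENNReal.continuous_const_mul (by simp)).comp (continuous_apply i)
  -- The functions e^{-a·x} with a ∈ ℕ^ι contain 1 and are closed under products, so their linear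
  -- span is already an algebra. It separates points, and a measure is determined by its integrals
  -- over such an algebra.
  let φ : (ι → ℕ) → BoundedContinuousFunction (ι → ℝ≥0∞) ℝ := fun a =>
    BoundedContinuousFunction.mkOfCompact ⟨_, hcont a⟩
  have hφ (a) (x) : φ a x = (expNeg (∑ i, a i * x i)).toReal := rfl
  have hmul (a b) : φ a * φ b = φ (a + b) := by
    ext x
    simp [hφ, ← ENNReal.toReal_mul, ← expNeg_add, ← Finset.sum_add_distrib, add_mul]
  have hone : φ 0 = 1 := by ext x; simp [hφ]
  let S : Submonoid (BoundedContinuousFunction (ι → ℝ≥0∞) ℝ) :=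
    { carrier := range φ
      one_mem' := ⟨0, hone⟩
      mul_mem' := by rintro _ _ ⟨a, rfl⟩ ⟨b, rfl⟩; exact ⟨a + b, (hmul a b).symm⟩ }
  let A : StarSubalgebra ℝ (BoundedContinuousFunction (ι → ℝ≥0∞) ℝ) :=
    { Algebra.adjoin ℝ (S : Set _) with
      star_mem' := fun {a} ha => by
        have : star a = a := by ext; simp
        rwa [this] }
  have hA (g) : g ∈ A ↔ g ∈ Submodule.span ℝ (S : Set (BoundedContinuousFunction _ ℝ)) := by
    have := Algebra.adjoin_eq_span_of_subset (R := ℝ) (s := (S : Set (BoundedContinuousFunction (ι → ℝ≥0∞) ℝ))) (by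
      rw [Submonoid.closure_eq]; exact Submodule.subset_span)
    rw [← this]; rfl
  refine ext_of_forall_mem_subalgebra_integral_eq_of_pseudoEMetric_complete_countable
    (𝕜 := ℝ) (A := A) ?_ ?_
  · intro x y hxy
    obtain ⟨i, hi⟩ := Function.ne_iff.1 hxy
    classical
    refine ⟨_, ⟨_, ⟨φ (Pi.single i 1), (hA _).2 (Submodule.subset_span ⟨_, rfl⟩), rfl⟩, rfl⟩, ?_⟩
    have key (z : ι → ℝ≥0∞) : φ (Pi.single i 1) z = (expNeg (z i)).toReal := by
      rw [hφ, Finset.sum_eq_single i] <;> simp +contextual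
    change φ _ x ≠ φ _ y
    rw [key, key]
    intro h
    exact hi (expNeg_strictAnti.injective
      ((ENNReal.toReal_eq_toReal_iff' (expNeg_ne_top _) (expNeg_ne_top _)).1 h))
  · intro g hg
    rw [hA] at hg
    induction hg using Submodule.span_induction with
    | mem g hg =>
      obtain ⟨a, rfl⟩ := hg
      simp only [hφ]
      have hm : Measurable fun x : ι → ℝ≥0∞ => expNeg (∑ i, a i * x i) := by fun_prop
      rw [integral_toReal hm.aemeasurable (.of_forall fun x => (expNeg_ne_top _).lt_top),
        integral_toReal hm.aemeasurable (.of_forall fun x => (expNeg_ne_top _).lt_top), h]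
    | zero => simp
    | add f g _ _ hf hg =>
      simp only [BoundedContinuousFunction.coe_add, Pi.add_apply]
      rw [integral_add (f.integrable M) (g.integrable M),
        integral_add (f.integrable N) (g.integrable N), hf, hg]
    | smul c f _ hf =>
      simp only [BoundedContinuousFunction.coe_smul, integral_smul, hf]

/-! ### Laplace functionals on the space of point measures. -/

namespace PointMeasure

variable {𝕏 : Type*} [MeasurableSpace 𝕏]

@[fun_prop]
lemma measurable_val : Measurable (Subtype.val : PointMeasure 𝕏 → Measure 𝕏) :=
  measurable_subtype_coe

lemma measurable_apply {B : Set 𝕏} (hB : MeasurableSet B) :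
    Measurable fun μ : PointMeasure 𝕏 => μ.1 B :=
  (Measure.measurable_coe hB).comp measurable_val

lemma measurable_lintegral {h : 𝕏 → ℝ≥0∞} (hh : Measurable h) :
    Measurable fun μ : PointMeasure 𝕏 => ∫⁻ x, h x ∂μ.1 :=
  (Measure.measurable_lintegral hh).comp measurable_val

lemma lintegral_add (μ ν : PointMeasure 𝕏) (h : 𝕏 → ℝ≥0∞) :
    ∫⁻ x, h x ∂(μ.add ν).1 = ∫⁻ x, h x ∂μ.1 + ∫⁻ x, h x ∂ν.1 :=
  lintegral_add_measure h μ.1 ν.1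

lemma lintegral_dirac (y : 𝕏) {h : 𝕏 → ℝ≥0∞} (hh : Measurable h) :
    ∫⁻ x, h x ∂(dirac y).1 = h y := lintegral_dirac' y hh

lemma measurable_of_measurable_coe {α : Type*} [MeasurableSpace α] {g : α → PointMeasure 𝕏}
    (hg : ∀ B, MeasurableSet B → Measurable fun a => (g a).1 B) : Measurable g :=
  (Measure.measurable_of_measurable_coe _ hg).subtype_mk

lemma measurable_add :
    Measurable fun p : PointMeasure 𝕏 × PointMeasure 𝕏 => p.1.add p.2 :=
  measurable_of_measurable_coe fun B hB => by
    change Measurable fun p : PointMeasure 𝕏 × PointMeasure 𝕏 => (p.1.1 + p.2.1) B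
    simp only [Measure.add_apply]
    exact ((measurable_apply hB).comp measurable_fst).add
      ((measurable_apply hB).comp measurable_snd)

lemma measurable_dirac : Measurable (dirac : 𝕏 → PointMeasure 𝕏) :=
  Measure.measurable_dirac.subtype_mk

@[fun_prop]
lemma _root_.Measurable.pointMeasure_add {α : Type*} [MeasurableSpace α]
    {g k : α → PointMeasure 𝕏} (hg : Measurable g) (hk : Measurable k) :
    Measurable fun a => (g a).add (k a) := measurable_add.comp (hg.prodMk hk)

@[fun_prop]
lemma _root_.Measurable.pointMeasure_dirac {α : Type*} [MeasurableSpace α]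
    {g : α → 𝕏} (hg : Measurable g) :
    Measurable fun a => dirac (g a) := measurable_dirac.comp hg

/-- Finite measures on the space of point measures with the same Laplace functional are equal. -/
theorem ext_of_lintegral_expNeg {M N : Measure (PointMeasure 𝕏)}
    [IsFiniteMeasure M] [IsFiniteMeasure N]
    (H : ∀ h : 𝕏 → ℝ≥0∞, Measurable h →
      ∫⁻ μ, expNeg (∫⁻ x, h x ∂μ.1) ∂M = ∫⁻ μ, expNeg (∫⁻ x, h x ∂μ.1) ∂N) : M = N := by
  let I := {B : Set 𝕏 // MeasurableSet B}
  let ev : PointMeasure 𝕏 → I → ℝ≥0∞ := fun μ B => μ.1 B.1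
  have hev : Measurable ev := measurable_pi_lambda _ fun B => measurable_apply B.2
  -- Finite-dimensional marginals suffice. The linear combination ∑ a_i μ(B_i) is the integral of ∑
  -- a_i 1_{B_i}, so the B_i need not be disjoint.
  have hmap : M.map ev = N.map ev := by
    refine IsProjectiveLimit.unique (P := fun J : Finset I => (M.map ev).map J.restrict)
      (fun J => rfl) (fun J => ?_)
    have hJ : Measurable (J.restrict (π := fun _ : I => ℝ≥0∞)) := Finset.measurable_restrict J
    refine (_root_.ext_of_lintegral_expNeg fun a => ?_).symm
    have hm : Measurable fun x : J → ℝ≥0∞ => expNeg (∑ i, a i * x i) := by fun_prop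
    beta_reduce
    rw [Measure.map_map hJ hev, Measure.map_map hJ hev, lintegral_map hm (hJ.comp hev),
      lintegral_map hm (hJ.comp hev)]
    simp only [Function.comp_apply]
    have key (μ : PointMeasure 𝕏) : ∑ i : J, (a i : ℝ≥0∞) * J.restrict (ev μ) i =
        ∫⁻ x, ∑ i : J, i.1.1.indicator (fun _ => (a i : ℝ≥0∞)) x ∂μ.1 := by
      rw [lintegral_finsetSum _ fun i _ => measurable_const.indicator i.1.2]
      refine Finset.sum_congr rfl fun i _ => ?_
      rw [lintegral_indicator_const i.1.2]; rfl
    simp only [key]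
    exact H _ (Finset.measurable_sum _ fun i _ => measurable_const.indicator i.1.2)
  ext S hS
  -- The σ-field is generated by the evaluations, so every measurable set is a preimage under `ev`.
  have : ∃ T, MeasurableSet T ∧ ev ⁻¹' T = S := by
    have hle : (inferInstance : MeasurableSpace (PointMeasure 𝕏)) ≤
        MeasurableSpace.comap ev inferInstance := by
      have : Measurable[MeasurableSpace.comap ev inferInstance] (id : PointMeasure 𝕏 → PointMeasure 𝕏) :=
        @measurable_of_measurable_coe 𝕏 _ (PointMeasure 𝕏) (MeasurableSpace.comap ev inferInstance) id
        fun B hB => (measurable_pi_apply (⟨B, hB⟩ : I)).comp (comap_measurable ev)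
      exact fun s hs => this hs
    exact hle S hS
  obtain ⟨T, hT, rfl⟩ := this
  rw [← Measure.map_apply hev hT, hmap, Measure.map_apply hev hT]

end PointMeasure

/-! ### The Laplace functional characterises the Poisson process. -/

open Filter Topology

lemma expNeg_mul_nat (x : ℝ≥0∞) (n : ℕ) : expNeg (x * n) = expNeg x ^ n := by
  rw [mul_comm, expNeg_nat_mul]

/-- The Poisson generating function. Keeping r = ∞ allows sets of infinite intensity; at y = 0 the
convention ∞ · 0 = 0 makes both sides 1. -/
lemma lintegral_expNeg_extPoisson (r y : ℝ≥0∞) :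
    ∫⁻ x, expNeg (y * x) ∂(extPoisson r) = expNeg (r * (1 - expNeg y)) := by
  have hm : Measurable fun x => expNeg (y * x) := by fun_prop
  rw [extPoisson]
  split_ifs with hr
  · subst hr
    rw [lintegral_dirac' _ hm]
    rcases eq_or_ne y 0 with rfl | hy
    · simp
    · have : 1 - expNeg y ≠ 0 := by
        rw [← pos_iff_ne_zero, tsub_pos_iff_lt]
        simpa using expNeg_strictAnti (pos_iff_ne_zero.2 hy)
      rw [ENNReal.mul_top hy, ENNReal.top_mul this]
  · lift r to ℝ≥0 using hr
    rw [lintegral_map hm measurable_from_top, ENNReal.toNNReal_coe, poissonMeasure,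
      lintegral_sum_measure]
    simp only [lintegral_smul_measure, lintegral_dirac, smul_eq_mul, expNeg_mul_nat]
    set q := (expNeg y).toReal with hq
    have hq0 : 0 ≤ q := ENNReal.toReal_nonneg
    have hEq : expNeg y = ENNReal.ofReal q := (ENNReal.ofReal_toReal (expNeg_ne_top y)).symm
    have hq1 : q ≤ 1 := by
      rw [hq]; exact ENNReal.toReal_le_of_le_ofReal (by simp) (by simpa using expNeg_le_one y)
    have hs : HasSum (fun n : ℕ => Real.exp (-r) * ((r * q) ^ n / n.factorial))
        (Real.exp (-r) * Real.exp (r * q)) := by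
      refine HasSum.mul_left _ ?_
      rw [Real.exp_eq_exp_ℝ]
      exact NormedSpace.expSeries_div_hasSum_exp (r * q : ℝ)
    rw [hEq, show (1 : ℝ≥0∞) - ENNReal.ofReal q = ENNReal.ofReal (1 - q) by
      rw [ENNReal.ofReal_sub _ hq0, ENNReal.ofReal_one]]
    rw [← ENNReal.ofReal_coe_nnreal, ← ENNReal.ofReal_mul r.coe_nonneg,
      expNeg_ofReal (mul_nonneg r.coe_nonneg (by linarith))]
    rw [show -((r : ℝ) * (1 - q)) = -r + r * q by ring, Real.exp_add, ← hs.tsum_eq,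
      ENNReal.ofReal_tsum_of_nonneg (fun n => by positivity) hs.summable]
    refine tsum_congr fun n => ?_
    rw [← ENNReal.ofReal_pow hq0, ← ENNReal.ofReal_mul (by positivity)]
    congr 1
    rw [mul_pow]; ring

lemma lintegral_id_extPoisson {r : ℝ≥0∞} (hr : r ≠ ∞) : ∫⁻ x, x ∂(extPoisson r) = r := by
  rw [extPoisson, if_neg hr]
  lift r to ℝ≥0 using hr
  rw [lintegral_map (f := fun x => x) measurable_id measurable_from_top, ENNReal.toNNReal_coe, poissonMeasure,
      lintegral_sum_measure]
  simp only [lintegral_smul_measure, lintegral_dirac, smul_eq_mul]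
  have hs : HasSum (fun n : ℕ => Real.exp (-r) * ((r : ℝ) ^ n / n.factorial))
        (Real.exp (-r) * Real.exp r) := by
      refine HasSum.mul_left _ ?_
      rw [Real.exp_eq_exp_ℝ]
      exact NormedSpace.expSeries_div_hasSum_exp (r : ℝ)
  rw [tsum_eq_zero_add' ENNReal.summable]
  simp only [Nat.cast_zero, mul_zero, zero_add]
  rw [← Real.exp_add, neg_add_cancel, Real.exp_zero] at hs
  have h2 := hs.mul_left (r : ℝ)
  rw [mul_one] at h2
  refine Eq.trans ?_ (ENNReal.ofReal_coe_nnreal (p := r))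
  rw [show ENNReal.ofReal r = ∑' n : ℕ, ENNReal.ofReal _ from (congrArg _ h2.tsum_eq.symm).trans
    (ENNReal.ofReal_tsum_of_nonneg (fun n => by positivity) h2.summable)]
  refine tsum_congr fun n => ?_
  rw [← ENNReal.ofReal_natCast, ← ENNReal.ofReal_mul (by positivity)]
  congr 1
  rw [Nat.factorial_succ]
  push_cast
  field_simp
  ring

/-- The exponent `∫ (1 - e^{-h}) dΛ` of the Laplace functional of a Poisson process. -/
noncomputable def laplaceExponent {𝕏 : Type*} [MeasurableSpace 𝕏] (Λ : Measure 𝕏)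
    (h : 𝕏 → ℝ≥0∞) : ℝ≥0∞ := ∫⁻ x, (1 - expNeg (h x)) ∂Λ

lemma Measurable.lintegral_expNeg_tendsto_of_monotone {α 𝕏 : Type*} [MeasurableSpace α]
    [MeasurableSpace 𝕏] (m : α → Measure 𝕏) {h : ℕ → 𝕏 → ℝ≥0∞} {g : 𝕏 → ℝ≥0∞}
    (hh : ∀ n, Measurable (h n)) (hmono : Monotone h) (hsup : ∀ x, ⨆ n, h n x = g x) (a : α) :
    Tendsto (fun n => expNeg (∫⁻ x, h n x ∂(m a))) atTop (𝓝 (expNeg (∫⁻ x, g x ∂(m a)))) := by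
  refine (continuous_expNeg.tendsto _).comp ?_
  have : ∫⁻ x, g x ∂(m a) = ⨆ n, ∫⁻ x, h n x ∂(m a) := by
    rw [← lintegral_iSup hh hmono]; simp [hsup]
  rw [this]
  exact tendsto_atTop_iSup fun i j hij => lintegral_mono (hmono hij)

lemma tendsto_lintegral_expNeg {Ω 𝕏 : Type*} [MeasurableSpace Ω] [MeasurableSpace 𝕏]
    (P : Measure Ω) [IsFiniteMeasure P] {ξ : Ω → PointMeasure 𝕏} (hξ : Measurable ξ)
    {h : ℕ → 𝕏 → ℝ≥0∞} {g : 𝕏 → ℝ≥0∞}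
    (hh : ∀ n, Measurable (h n)) (hmono : Monotone h) (hsup : ∀ x, ⨆ n, h n x = g x) :
    Tendsto (fun n => ∫⁻ ω, expNeg (∫⁻ x, h n x ∂(ξ ω).1) ∂P) atTop
      (𝓝 (∫⁻ ω, expNeg (∫⁻ x, g x ∂(ξ ω).1) ∂P)) := by
  refine tendsto_lintegral_of_dominated_convergence (fun _ => 1)
    (fun n => measurable_expNeg.comp ((PointMeasure.measurable_lintegral (hh n)).comp hξ))
    (fun n => .of_forall fun ω => expNeg_le_one _) (by simp) (.of_forall fun ω => ?_)
  exact Measurable.lintegral_expNeg_tendsto_of_monotone (fun ω => (ξ ω).1) hh hmono hsup ω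

lemma tendsto_expNeg_laplaceExponent {𝕏 : Type*} [MeasurableSpace 𝕏]
    (Λ : Measure 𝕏) {h : ℕ → 𝕏 → ℝ≥0∞} {g : 𝕏 → ℝ≥0∞}
    (hh : ∀ n, Measurable (h n)) (hmono : Monotone h) (hsup : ∀ x, ⨆ n, h n x = g x) :
    Tendsto (fun n => expNeg (laplaceExponent Λ (h n))) atTop
      (𝓝 (expNeg (laplaceExponent Λ g))) := by
  have hanti : Antitone expNeg := expNeg_strictAnti.antitone
  refine Measurable.lintegral_expNeg_tendsto_of_monotone (fun _ : Unit => Λ)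
    (h := fun n x => 1 - expNeg (h n x)) (fun n => by have := hh n; fun_prop)
    (fun i j hij x => tsub_le_tsub_left (hanti (hmono hij x)) 1) (fun x => ?_) ()
  have hmx : Monotone fun n => h n x := fun i j hij => hmono hij x
  refine iSup_eq_of_tendsto (fun i j hij => tsub_le_tsub_left (hanti (hmx hij)) 1) ?_
  refine ENNReal.Tendsto.sub tendsto_const_nhds ((continuous_expNeg.tendsto _).comp ?_) (by simp)
  rw [← hsup]
  exact tendsto_atTop_iSup hmx

/-- Finite measures on `[0, ∞]` with the same Laplace transform are equal. -/
theorem ext_of_lintegral_expNeg_mul {M N : Measure ℝ≥0∞} [IsFiniteMeasure M] [IsFiniteMeasure N]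
    (h : ∀ a : ℕ, ∫⁻ x, expNeg (a * x) ∂M = ∫⁻ x, expNeg (a * x) ∂N) : M = N := by
  have hc : Measurable fun (x : ℝ≥0∞) (_ : Unit) => x := measurable_pi_lambda _ fun _ => measurable_id
  have he : Measurable fun x : Unit → ℝ≥0∞ => x () := measurable_pi_apply _
  have key : M.map (fun x (_ : Unit) => x) = N.map fun x (_ : Unit) => x := by
    refine ext_of_lintegral_expNeg fun a => ?_
    rw [lintegral_map (by fun_prop) hc, lintegral_map (by fun_prop) hc]
    simpa using h (a ())
  have := congrArg (Measure.map fun x : Unit → ℝ≥0∞ => x ()) key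
  rw [Measure.map_map he hc, Measure.map_map he hc] at this
  simpa [Function.comp_def] using this

namespace IsPoissonProcess

variable {Ω 𝕏 : Type*} [MeasurableSpace Ω] [MeasurableSpace 𝕏] {P : Measure Ω}
  {η : Ω → PointMeasure 𝕏} {Λ : Measure 𝕏}

lemma isProbabilityMeasure (hη : IsPoissonProcess P η Λ) : IsProbabilityMeasure P := by
  have h := hη.law ∅ .empty
  have hone := lintegral_expNeg_extPoisson 0 0
  rw [measure_empty] at h
  rw [← h, lintegral_map (by fun_prop) (show Measurable fun ω => (η ω).1 ∅ from
    (PointMeasure.measurable_apply .empty).comp hη.measurable)] at hone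
  exact ⟨by simpa using hone⟩

/-- The Laplace functional of a Poisson process. -/
theorem lintegral_expNeg (hη : IsPoissonProcess P η Λ) {h : 𝕏 → ℝ≥0∞} (hh : Measurable h) :
    ∫⁻ ω, expNeg (∫⁻ x, h x ∂(η ω).1) ∂P = expNeg (laplaceExponent Λ h) := by
  have := hη.isProbabilityMeasure
  -- The level sets of a simple function are disjoint, so its integral is a combination of
  -- independent Poisson counts and the Laplace transform factorises. Monotone approximation does
  -- the rest.
  have hsimple (g : SimpleFunc 𝕏 ℝ≥0∞) :
      ∫⁻ ω, expNeg (∫⁻ x, g x ∂(η ω).1) ∂P = expNeg (laplaceExponent Λ g) := by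
    let e := g.range.equivFin.symm
    have hsum (m : Measure 𝕏) (k : ℝ≥0∞ → ℝ≥0∞) : ∫⁻ x, k (g x) ∂m =
        ∑ i, k (e i).1 * m (g ⁻¹' {(e i).1}) := by
      change ∫⁻ x, (g.map k) x ∂m = _
      rw [SimpleFunc.lintegral_eq_lintegral, SimpleFunc.map_lintegral, 
        ← Finset.sum_coe_sort, ← e.sum_comp]
    have hdis : Pairwise fun i j => Disjoint (g ⁻¹' {(e i).1}) (g ⁻¹' {(e j).1}) := by
      intro i j hij
      refine Disjoint.preimage _ (disjoint_singleton.2 fun h => hij ?_)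
      exact e.injective (Subtype.ext h)
    have hmB (i) : MeasurableSet (g ⁻¹' {(e i).1}) := g.measurableSet_preimage _
    have hind := hη.indep _ (fun i => g ⁻¹' {(e i).1}) hmB hdis
    have hmeas (i) : Measurable fun ω => (η ω).1 (g ⁻¹' {(e i).1}) :=
      (PointMeasure.measurable_apply (hmB i)).comp hη.measurable
    have h1 (ω) : expNeg (∫⁻ x, g x ∂(η ω).1) =
        ∏ i, expNeg ((e i).1 * (η ω).1 (g ⁻¹' {(e i).1})) := by
      rw [← expNeg_sum]; exact congrArg _ (hsum (η ω).1 id)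
    have h2 (i) : Measurable fun y : ℝ≥0∞ => expNeg ((e i).1 * y) := by fun_prop
    simp only [h1]
    rw [lintegral_prod_eq_prod_lintegral_of_indepFun Finset.univ
      (fun i ω => expNeg ((e i).1 * (η ω).1 (g ⁻¹' {(e i).1})))
      (hind.comp (fun i y => expNeg ((e i).1 * y)) h2) fun i => (h2 i).comp (hmeas i),
      laplaceExponent, hsum Λ (fun y => 1 - expNeg y), expNeg_sum]
    refine Finset.prod_congr rfl fun i _ => ?_
    rw [← lintegral_map (h2 i) (hmeas i), hη.law _ (hmB i), lintegral_expNeg_extPoisson, mul_comm]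
  have hmono : Monotone fun n => (SimpleFunc.eapprox h n : 𝕏 → ℝ≥0∞) :=
    fun i j hij => SimpleFunc.monotone_eapprox h hij
  refine tendsto_nhds_unique (tendsto_lintegral_expNeg P hη.measurable
    (fun n => (SimpleFunc.eapprox h n).measurable) hmono (SimpleFunc.iSup_eapprox_apply hh)) ?_
  simp only [hsimple]
  exact tendsto_expNeg_laplaceExponent Λ (fun n => (SimpleFunc.eapprox h n).measurable) hmono
    (SimpleFunc.iSup_eapprox_apply hh)

lemma lintegral_apply (hη : IsPoissonProcess P η Λ) {B : Set 𝕏} (hB : MeasurableSet B)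
    (hΛB : Λ B ≠ ∞) : ∫⁻ ω, (η ω).1 B ∂P = Λ B := by
  have hm : Measurable fun ω => (η ω).1 B :=
    (PointMeasure.measurable_apply hB).comp hη.measurable
  rw [← lintegral_map (f := fun x => x) measurable_id hm, hη.law B hB,
    lintegral_id_extPoisson hΛB]

lemma map (hη : IsPoissonProcess P η Λ) : IsPoissonProcess (P.map η) (fun μ => μ) Λ where
  measurable := measurable_id
  law B hB := by
    rw [Measure.map_map (PointMeasure.measurable_apply hB) hη.measurable]
    exact hη.law B hB
  indep m B hB hd := by
    have := hη.isProbabilityMeasure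
    have := Measure.isProbabilityMeasure_map (μ := P) hη.measurable.aemeasurable
    have hm (i) : Measurable fun μ : PointMeasure 𝕏 => μ.1 (B i) :=
      PointMeasure.measurable_apply (hB i)
    have h := hη.indep m B hB hd
    rw [iIndepFun_iff_map_fun_eq_pi_map (f := fun i ω => (η ω).1 (B i))
      fun i => ((hm i).comp hη.measurable).aemeasurable] at h
    rw [iIndepFun_iff_map_fun_eq_pi_map fun i => (hm i).aemeasurable,
      Measure.map_map (measurable_pi_lambda _ hm) hη.measurable]
    refine h.trans (congrArg _ (funext fun i => ?_))
    rw [Measure.map_map (hm i) hη.measurable]; rfl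

/-- A random point measure with the Laplace functional of a Poisson process is one. -/
theorem of_lintegral_expNeg [IsProbabilityMeasure P] (hη : Measurable η)
    (H : ∀ h : 𝕏 → ℝ≥0∞, Measurable h →
      ∫⁻ ω, expNeg (∫⁻ x, h x ∂(η ω).1) ∂P = expNeg (laplaceExponent Λ h)) :
    IsPoissonProcess P η Λ := by
  have hm {B} (hB : MeasurableSet B) : Measurable fun ω => (η ω).1 B :=
    (PointMeasure.measurable_apply hB).comp hη
  have hone {B} (hB : MeasurableSet B) (a : ℝ≥0∞) :
      ∫⁻ ω, expNeg (a * (η ω).1 B) ∂P = expNeg (Λ B * (1 - expNeg a)) := by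
    have h1 := H (B.indicator fun _ => a) (measurable_const.indicator hB)
    simp only [lintegral_indicator_const hB] at h1
    rw [h1, laplaceExponent]
    have : (fun x => 1 - expNeg (B.indicator (fun _ => a) x)) =
        B.indicator fun _ => 1 - expNeg a := by
      ext x; by_cases hx : x ∈ B <;> simp [hx]
    rw [this, lintegral_indicator_const hB, mul_comm]
  have hprob (r : ℝ≥0∞) : IsProbabilityMeasure (extPoisson r) :=
    ⟨by simpa using lintegral_expNeg_extPoisson r 0⟩
  refine ⟨hη, fun B hB => ?_, fun m B hB hd => ?_⟩
  · have := Measure.isProbabilityMeasure_map (μ := P) (hm hB).aemeasurable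
    have := hprob (Λ B)
    refine ext_of_lintegral_expNeg_mul fun a => ?_
    rw [lintegral_map (by fun_prop) (hm hB), lintegral_expNeg_extPoisson, hone hB]
  · rw [iIndepFun_iff_map_fun_eq_pi_map fun i => (hm (hB i)).aemeasurable]
    have (i : Fin m) : IsProbabilityMeasure (P.map fun ω => (η ω).1 (B i)) :=
      Measure.isProbabilityMeasure_map (hm (hB i)).aemeasurable
    have hM : Measurable fun ω i => (η ω).1 (B i) := measurable_pi_lambda _ fun i => hm (hB i)
    have := Measure.isProbabilityMeasure_map (μ := P) hM.aemeasurable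
    refine ext_of_lintegral_expNeg fun a => ?_
    have hE : Measurable fun x : Fin m → ℝ≥0∞ => expNeg (∑ i, a i * x i) := by fun_prop
    have hi (i) : Measurable fun x : ℝ≥0∞ => expNeg (a i * x) := by fun_prop
    rw [lintegral_map hE hM]
    have h1 : ∫⁻ x : Fin m → ℝ≥0∞, expNeg (∑ i, a i * x i)
        ∂(Measure.pi fun i => P.map fun ω => (η ω).1 (B i)) =
        ∏ i, expNeg (Λ (B i) * (1 - expNeg (a i))) := by
      simp only [expNeg_sum]
      rw [lintegral_prod_eq_prod_lintegral_of_indepFun Finset.univ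
        (fun i (x : Fin m → ℝ≥0∞) => expNeg (a i * x i))
        (iIndepFun_pi (X := fun i x => expNeg (a i * x)) fun i => (hi i).aemeasurable)
        fun i => by fun_prop]
      refine Finset.prod_congr rfl fun i _ => ?_
      rw [← hone (hB i), ← lintegral_map (hi i) (hm (hB i))]
      exact (measurePreserving_eval (fun i => P.map fun ω => (η ω).1 (B i)) i).lintegral_comp (hi i)
    rw [h1, ← expNeg_sum]
    have h2 := H (fun x => ∑ i, (B i).indicator (fun _ => (a i : ℝ≥0∞)) x)
      (Finset.measurable_sum _ fun i _ => measurable_const.indicator (hB i))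
    have h3 (ω) : ∫⁻ x, ∑ i, (B i).indicator (fun _ => (a i : ℝ≥0∞)) x ∂(η ω).1 =
        ∑ i, a i * (η ω).1 (B i) := by
      rw [lintegral_finsetSum _ fun i _ => measurable_const.indicator (hB i)]
      simp only [lintegral_indicator_const (hB _)]
    simp only [h3] at h2
    rw [h2, laplaceExponent]
    congr 1
    -- Disjointness leaves at most one nonzero indicator at x. This makes the exponent additive over
    -- the sets, and hence gives independence.
    have h4 (x) : 1 - expNeg (∑ i, (B i).indicator (fun _ => (a i : ℝ≥0∞)) x) =
        ∑ i, (B i).indicator (fun _ => 1 - expNeg (a i)) x := by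
      by_cases hx : ∃ i, x ∈ B i
      · obtain ⟨i, hi⟩ := hx
        have hj (j) (hji : j ≠ i) : x ∉ B j := fun h => (hd hji).le_bot ⟨h, hi⟩
        rw [Finset.sum_eq_single i (fun j _ h => by simp [hj j h]) (by simp),
          Finset.sum_eq_single i (fun j _ h => by simp [hj j h]) (by simp)]
        simp [hi]
      · push Not at hx
        simp [hx]
    simp only [h4]
    rw [lintegral_finsetSum _ fun i _ => measurable_const.indicator (hB i)]
    simp only [lintegral_indicator_const (hB _), mul_comm]

end IsPoissonProcess

/-- `Π_Λ` is the law of every Poisson process with intensity measure `Λ`. -/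
theorem poissonProcessLaw_eq_map {Ω 𝕏 : Type*} [MeasurableSpace Ω] [MeasurableSpace 𝕏]
    {P : Measure Ω} {η : Ω → PointMeasure 𝕏} {Λ : Measure 𝕏} (hη : IsPoissonProcess P η Λ) :
    poissonProcessLaw Λ = P.map η := by
  have hex : ∃ Q : Measure (PointMeasure 𝕏), IsPoissonProcess Q (fun μ => μ) Λ := ⟨_, hη.map⟩
  rw [poissonProcessLaw, dif_pos hex]
  have h1 := hex.choose_spec
  have := h1.isProbabilityMeasure
  have := hη.map.isProbabilityMeasure
  refine PointMeasure.ext_of_lintegral_expNeg fun h hh => ?_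
  rw [h1.lintegral_expNeg hh, hη.map.lintegral_expNeg hh]

/-! ### Thinnings and superpositions. -/

/-- The function `y ↦ -log y`, an inverse of `expNeg` on `[0, 1]`. -/
noncomputable def negLog (y : ℝ≥0∞) : ℝ≥0∞ := (-ENNReal.log y).toENNReal

lemma expNeg_negLog {y : ℝ≥0∞} (hy : y ≤ 1) : expNeg (negLog y) = y := by
  have : 0 ≤ -ENNReal.log y := by
    rw [EReal.neg_nonneg]; exact ENNReal.log_one ▸ ENNReal.log_monotone hy
  rw [expNeg, negLog, EReal.coe_toENNReal this, neg_neg, ENNReal.exp_log]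

@[fun_prop] lemma measurable_negLog : Measurable negLog :=
  measurable_ereal_toENNReal.comp (ENNReal.measurable_log.neg)

lemma ofReal_one_sub_add {t : ℝ} (ht : t ∈ Icc (0 : ℝ) 1) :
    ENNReal.ofReal (1 - t) + ENNReal.ofReal t = 1 := by
  rw [← ENNReal.ofReal_add (by linarith [ht.2]) ht.1]; simp

lemma ofReal_mul_add_mul_le_one {t : ℝ} (ht : t ∈ Icc (0 : ℝ) 1) {e d : ℝ≥0∞}
    (he : e ≤ 1) (hd : d ≤ 1) :
    d * (ENNReal.ofReal (1 - t) + ENNReal.ofReal t * e) ≤ 1 := by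
  refine mul_le_one' hd ((add_le_add_right (mul_le_of_le_one_right' he) _).trans ?_)
  rw [ofReal_one_sub_add ht]

/-- The algebra behind superposition: the joint exponent of thinning and process splits into a part
of weight t, seen by points that are kept, and a part of weight 1 - t, seen by points that are
deleted. -/
lemma one_sub_thinning_eq {t : ℝ} (ht : t ∈ Icc (0 : ℝ) 1) {e d : ℝ≥0∞}
    (he : e ≤ 1) (hd : d ≤ 1) :
    1 - d * (ENNReal.ofReal (1 - t) + ENNReal.ofReal t * e) =
      ENNReal.ofReal t * (1 - e * d) + ENNReal.ofReal (1 - t) * (1 - d) := by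
  have h1 : d * (ENNReal.ofReal (1 - t) + ENNReal.ofReal t * e) ≠ ∞ :=
    ((ofReal_mul_add_mul_le_one ht he hd).trans_lt (by simp)).ne
  refine (ENNReal.eq_sub_of_add_eq h1 ?_).symm
  calc _ = ENNReal.ofReal t * ((1 - e * d) + e * d) + ENNReal.ofReal (1 - t) * ((1 - d) + d) := by
        ring
    _ = 1 := by
      rw [tsub_add_cancel_of_le (mul_le_one' he hd), tsub_add_cancel_of_le hd, mul_one, mul_one,
        add_comm, ofReal_one_sub_add ht]

lemma lintegral_sum_ite_dirac {𝕏 : Type*} [MeasurableSpace 𝕏] (k : ℕ∞) (x : ℕ → 𝕏) (y : ℕ → ℝ≥0∞)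
    {h : 𝕏 → ℝ≥0∞} (hh : Measurable h) :
    ∫⁻ z, h z ∂(Measure.sum fun n : ℕ => if (n : ℕ∞) < k then y n • Measure.dirac (x n) else 0) =
      ∑' n : ℕ, y n * (if (n : ℕ∞) < k then h (x n) else 0) := by
  rw [lintegral_sum_measure]
  refine tsum_congr fun n => ?_
  split_ifs
  · rw [lintegral_smul_measure, lintegral_dirac' _ hh, smul_eq_mul]
  · simp

lemma tendsto_prod_expNeg (a : ℕ → ℝ≥0∞) :
    Tendsto (fun N => ∏ n ∈ Finset.range N, expNeg (a n)) atTop (𝓝 (expNeg (∑' n, a n))) := by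
  simp only [← expNeg_sum]
  exact (continuous_expNeg.tendsto _).comp ENNReal.summable.hasSum.tendsto_sum_nat

section Thinning

variable {Ω 𝕏 : Type*} [MeasurableSpace Ω] [MeasurableSpace 𝕏] {P : Measure Ω}
  [IsProbabilityMeasure P] {Λ : Measure 𝕏} {η ξ ξ' : Ω → PointMeasure 𝕏} {κ : Ω → ℕ∞}
  {X : ℕ → Ω → 𝕏} {t : ℝ}

/-- The joint Laplace functional of a Poisson process and a thinning of it. -/
theorem IsThinning.lintegral_expNeg_mul (hη : IsPoissonProcess P η Λ)
    (hproper : IsProperRep P η κ X) (ht : t ∈ Icc (0 : ℝ) 1) (hξ : IsThinning P κ X t ξ)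
    {h k : 𝕏 → ℝ≥0∞} (hh : Measurable h) (hk : Measurable k) :
    ∫⁻ ω, expNeg (∫⁻ x, h x ∂(ξ ω).1) * expNeg (∫⁻ x, k x ∂(η ω).1) ∂P =
      expNeg (∫⁻ x, (1 - expNeg (k x) *
        (ENNReal.ofReal (1 - t) + ENNReal.ofReal t * expNeg (h x))) ∂Λ) := by
  obtain ⟨Y, hY, hYlaw, hYind, hYW, hYeq⟩ := hξ
  let T := ℕ∞ × (ℕ → 𝕏)
  let c : (𝕏 → ℝ≥0∞) → ℕ → T → ℝ≥0∞ := fun g n w => if (n : ℕ∞) < w.1 then g (w.2 n) else 0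
  have hc {g} (hg : Measurable g) (n : ℕ) : Measurable (c g n) := by
    refine Measurable.ite
      ((MeasurableSet.of_discrete (s := Ioi (n : ℕ∞))).preimage measurable_fst) ?_ measurable_const
    exact hg.comp ((measurable_pi_apply n).comp measurable_snd)
  let W : Ω → T := fun ω => (κ ω, fun n => X n ω)
  have hW : Measurable W :=
    hproper.measurable_card.prodMk (measurable_pi_lambda _ hproper.measurable_point)
  have hYm : Measurable fun ω n => Y n ω := measurable_pi_lambda _ hY
  have hηc {g} (hg : Measurable g) : ∀ᵐ ω ∂P, ∫⁻ x, g x ∂(η ω).1 = ∑' n, c g n (W ω) := by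
    filter_upwards [hproper.eq_sum] with ω hω
    rw [hω]
    simpa using lintegral_sum_ite_dirac (κ ω) (fun n => X n ω) (fun _ => 1) hg
  have hξc {g} (hg : Measurable g) :
      ∀ᵐ ω ∂P, ∫⁻ x, g x ∂(ξ ω).1 = ∑' n, Y n ω * c g n (W ω) := by
    filter_upwards [hYeq] with ω hω
    rw [hω]
    exact lintegral_sum_ite_dirac (κ ω) (fun n => X n ω) (fun n => Y n ω) hg
  -- Averaging over the mark of a point at x turns its factor e^{-Yh(x)} e^{-k(x)} into e^{-l(x)}.
  -- The joint functional therefore becomes the Laplace functional of η at l.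
  let l : 𝕏 → ℝ≥0∞ := fun x => negLog (expNeg (k x) *
        (ENNReal.ofReal (1 - t) + ENNReal.ofReal t * expNeg (h x)))
  have hl : Measurable l := by fun_prop
  have hle (x) := ofReal_mul_add_mul_le_one ht (expNeg_le_one (h x)) (expNeg_le_one (k x))
  have hEl (x) : expNeg (l x) = expNeg (k x) *
      (ENNReal.ofReal (1 - t) + ENNReal.ofReal t * expNeg (h x)) := expNeg_negLog (hle x)
  -- Only the first N points are treated: independence of the marks gives finite products. Dominated
  -- convergence with bound 1 then removes the truncation.
  have hfin (N : ℕ) : ∫⁻ ω, ∏ n ∈ Finset.range N,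
        (expNeg (Y n ω * c h n (W ω)) * expNeg (c k n (W ω))) ∂P =
      ∫⁻ ω, ∏ n ∈ Finset.range N, expNeg (c l n (W ω)) ∂P := by
    let Φ : (ℕ → ℕ) × T → ℝ≥0∞ := fun p => ∏ n ∈ Finset.range N,
        (expNeg (p.1 n * c h n p.2) * expNeg (c k n p.2))
    have hΦ : Measurable Φ := by
      refine Finset.measurable_prod _ fun n _ => Measurable.mul ?_ ?_
      · refine measurable_expNeg.comp (Measurable.mul ?_ ((hc hh n).comp measurable_snd))
        exact (Measurable.of_discrete (f := fun m : ℕ => (m : ℝ≥0∞))).comp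
          ((measurable_pi_apply n).comp measurable_fst)
      · exact measurable_expNeg.comp ((hc hk n).comp measurable_snd)
    have hmap := (indepFun_iff_map_prod_eq_prod_map_map hYm.aemeasurable hW.aemeasurable).1 hYW
    have := Measure.isProbabilityMeasure_map (μ := P) hYm.aemeasurable
    have := Measure.isProbabilityMeasure_map (μ := P) hW.aemeasurable
    calc _ = ∫⁻ p, Φ p ∂(P.map fun ω => (fun n => Y n ω, W ω)) :=
          (lintegral_map hΦ (hYm.prodMk hW)).symm
      _ = ∫⁻ ω, ∫⁻ ω', Φ (fun n => Y n ω', W ω) ∂P ∂P := by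
          rw [hmap, lintegral_prod_symm' _ hΦ, lintegral_map hΦ.lintegral_prod_left' hW]
          refine lintegral_congr fun ω => ?_
          exact lintegral_map (hΦ.comp measurable_prodMk_right) hYm
      _ = _ := by
          refine lintegral_congr fun ω => ?_
          simp only [Φ, Finset.prod_mul_distrib]
          have hE (n : ℕ) : Measurable fun m : ℕ => expNeg (m * c h n (W ω)) := .of_discrete
          have hEY (n : ℕ) : Measurable fun ω' => expNeg (Y n ω' * c h n (W ω)) :=
            (hE n).comp (hY n)
          rw [lintegral_mul_const _
            (Finset.measurable_prod _ fun n _ => hEY n),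
            lintegral_prod_eq_prod_lintegral_of_indepFun (Finset.range N)
              (fun n ω' => expNeg (Y n ω' * c h n (W ω)))
              (hYind.comp (fun n m => expNeg (m * c h n (W ω))) hE) hEY,
            ← Finset.prod_mul_distrib]
          refine Finset.prod_congr rfl fun n _ => ?_
          rw [← lintegral_map (hE n) (hY n), hYlaw n, lintegral_add_measure,
            lintegral_smul_measure, lintegral_smul_measure, lintegral_dirac, lintegral_dirac]
          by_cases hn : (n : ℕ∞) < (W ω).1
          · simp [c, hn, hEl, mul_comm]
          · simp [c, hn, ofReal_one_sub_add ht]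
  have hlim : Tendsto (fun N : ℕ => ∫⁻ ω, ∏ n ∈ Finset.range N,
        (expNeg (Y n ω * c h n (W ω)) * expNeg (c k n (W ω))) ∂P) atTop
      (𝓝 (∫⁻ ω, expNeg (∫⁻ x, h x ∂(ξ ω).1) * expNeg (∫⁻ x, k x ∂(η ω).1) ∂P)) := by
    refine tendsto_lintegral_of_dominated_convergence (fun _ => 1) (fun N => ?_) (fun N => ?_)
      (by simp) ?_
    · refine Finset.measurable_prod _ fun n _ => Measurable.mul ?_ ?_
      · refine measurable_expNeg.comp (Measurable.mul ?_ ((hc hh n).comp hW))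
        exact (Measurable.of_discrete (f := fun m : ℕ => (m : ℝ≥0∞))).comp (hY n)
      · exact measurable_expNeg.comp ((hc hk n).comp hW)
    · exact .of_forall fun ω => Finset.prod_le_one' fun n _ =>
        mul_le_one' (expNeg_le_one _) (expNeg_le_one _)
    · filter_upwards [hξc hh, hηc hk] with ω h1 h2
      rw [h1, h2]
      simp only [Finset.prod_mul_distrib]
      exact ENNReal.Tendsto.mul (tendsto_prod_expNeg _) (.inr (expNeg_ne_top _))
        (tendsto_prod_expNeg _) (.inr (expNeg_ne_top _))
  have hlim' : Tendsto (fun N : ℕ => ∫⁻ ω, ∏ n ∈ Finset.range N, expNeg (c l n (W ω)) ∂P) atTop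
      (𝓝 (∫⁻ ω, expNeg (∫⁻ x, l x ∂(η ω).1) ∂P)) := by
    refine tendsto_lintegral_of_dominated_convergence (fun _ => 1) (fun N => ?_) (fun N => ?_)
      (by simp) ?_
    · exact Finset.measurable_prod _ fun n _ => measurable_expNeg.comp ((hc hl n).comp hW)
    · exact .of_forall fun ω => Finset.prod_le_one' fun n _ => expNeg_le_one _
    · filter_upwards [hηc hl] with ω h2
      rw [h2]
      exact tendsto_prod_expNeg _
  simp only [hfin] at hlim
  rw [tendsto_nhds_unique hlim hlim', hη.lintegral_expNeg hl, laplaceExponent]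
  simp only [hEl]

/-- A `t`-thinning of a Poisson process with intensity `Λ` is a Poisson process with
intensity `tΛ`. -/
theorem IsThinning.isPoissonProcess_smul (hη : IsPoissonProcess P η Λ)
    (hproper : IsProperRep P η κ X) (ht : t ∈ Icc (0 : ℝ) 1) (hξ : IsThinning P κ X t ξ)
    (hξm : Measurable ξ) : IsPoissonProcess P ξ (ENNReal.ofReal t • Λ) := by
  refine IsPoissonProcess.of_lintegral_expNeg hξm fun h hh => ?_
  have := hξ.lintegral_expNeg_mul hη hproper ht hh (k := 0) measurable_const
  simp only [Pi.zero_apply, lintegral_zero, expNeg_zero, mul_one] at this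
  rw [this, laplaceExponent, lintegral_smul_measure, smul_eq_mul,
    ← lintegral_const_mul _ (by fun_prop)]
  congr 1
  refine lintegral_congr fun x => ?_
  rw [one_sub_thinning_eq ht (expNeg_le_one _) le_rfl]
  simp

/-- Given a `t`-thinning `ξ`, the process `η` is distributed like `ξ` plus an independent Poisson
process with intensity `(1 - t)Λ`. -/
theorem IsThinning.map_withDensity_expNeg (hη : IsPoissonProcess P η Λ)
    (hproper : IsProperRep P η κ X) (ht : t ∈ Icc (0 : ℝ) 1) (hξ : IsThinning P κ X t ξ)
    (hξm : Measurable ξ) (hξ' : IsPoissonProcess P ξ' (ENNReal.ofReal (1 - t) • Λ))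
    {h : 𝕏 → ℝ≥0∞} (hh : Measurable h) :
    (P.withDensity fun ω => expNeg (∫⁻ x, h x ∂(ξ ω).1)).map η =
      ((P.withDensity fun ω => expNeg (∫⁻ x, h x ∂(ξ ω).1)).prod P).map
        fun p => (ξ p.1).add (ξ' p.2) := by
  have hd : Measurable fun ω => expNeg (∫⁻ x, h x ∂(ξ ω).1) :=
    measurable_expNeg.comp ((PointMeasure.measurable_lintegral hh).comp hξm)
  have hfin : IsFiniteMeasure (P.withDensity fun ω => expNeg (∫⁻ x, h x ∂(ξ ω).1)) := by
    refine isFiniteMeasure_withDensity ((lintegral_mono (g := fun _ => 1)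
      fun ω => expNeg_le_one _).trans_lt (by simp)).ne
  have hadd : Measurable fun p : Ω × Ω => (ξ p.1).add (ξ' p.2) :=
    (hξm.comp measurable_fst).pointMeasure_add (hξ'.measurable.comp measurable_snd)
  -- The weights e^{-∫h dξ}, for all h, encode the dependence on ξ, so a statement about the
  -- conditional law of η given ξ becomes an equality of finite measures on point measures.
  refine PointMeasure.ext_of_lintegral_expNeg fun k hk => ?_
  have hE : Measurable fun μ : PointMeasure 𝕏 => expNeg (∫⁻ x, k x ∂μ.1) :=
    measurable_expNeg.comp (PointMeasure.measurable_lintegral hk)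
  have hEη : Measurable fun ω => expNeg (∫⁻ x, k x ∂(η ω).1) := hE.comp hη.measurable
  have hEξ : Measurable fun ω => expNeg (∫⁻ x, k x ∂(ξ ω).1) := hE.comp hξm
  have hEξ' : Measurable fun ω => expNeg (∫⁻ x, k x ∂(ξ' ω).1) := hE.comp hξ'.measurable
  have hEa : Measurable fun p : Ω × Ω => expNeg (∫⁻ x, k x ∂((ξ p.1).add (ξ' p.2)).1) :=
    hE.comp hadd
  rw [lintegral_map hE hη.measurable, lintegral_map hE hadd,
    lintegral_withDensity_eq_lintegral_mul _ hd hEη,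
    lintegral_prod _ hEa.aemeasurable]
  simp only [PointMeasure.lintegral_add, expNeg_add, Pi.mul_apply]
  rw [hξ.lintegral_expNeg_mul hη hproper ht hh hk]
  have h1 (ω : Ω) : ∫⁻ ω', expNeg (∫⁻ x, k x ∂(ξ ω).1) * expNeg (∫⁻ x, k x ∂(ξ' ω').1) ∂P =
      expNeg (∫⁻ x, k x ∂(ξ ω).1) * expNeg (laplaceExponent (ENNReal.ofReal (1 - t) • Λ) k) := by
    rw [lintegral_const_mul _ hEξ', hξ'.lintegral_expNeg hk]
  simp only [h1]
  rw [lintegral_withDensity_eq_lintegral_mul _ hd (hEξ.mul_const _)]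
  simp only [Pi.mul_apply, ← mul_assoc]
  rw [lintegral_mul_const _ (by fun_prop)]
  simp only [← expNeg_add]
  have h2 (ω) : ∫⁻ x, h x ∂(ξ ω).1 + ∫⁻ x, k x ∂(ξ ω).1 = ∫⁻ x, (h x + k x) ∂(ξ ω).1 :=
    (lintegral_add_left hh _).symm
  simp only [h2]
  rw [(hξ.isPoissonProcess_smul hη hproper ht hξm).lintegral_expNeg (h := fun x => h x + k x) (hh.add hk),
    ← expNeg_add,
    laplaceExponent, laplaceExponent, lintegral_smul_measure, lintegral_smul_measure, smul_eq_mul,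
    smul_eq_mul, ← lintegral_const_mul _ (by fun_prop), ← lintegral_const_mul _ (by fun_prop),
    ← lintegral_add_left (by fun_prop)]
  congr 1
  refine lintegral_congr fun x => ?_
  rw [one_sub_thinning_eq ht (expNeg_le_one _) (expNeg_le_one _), expNeg_add]

/-- The superposition of a `t`-thinning and an independent Poisson process with intensity
`(1 - t)Λ` has the law of the original process. -/
theorem IsThinning.map_add (hη : IsPoissonProcess P η Λ)
    (hproper : IsProperRep P η κ X) (ht : t ∈ Icc (0 : ℝ) 1) (hξ : IsThinning P κ X t ξ)
    (hξm : Measurable ξ) (hξ' : IsPoissonProcess P ξ' (ENNReal.ofReal (1 - t) • Λ)) :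
    (P.prod P).map (fun p => (ξ p.1).add (ξ' p.2)) = P.map η := by
  have := hξ.map_withDensity_expNeg hη hproper ht hξm hξ' (h := 0) measurable_const
  simpa using this.symm

end Thinning

/-! ### The Mecke equation, by differentiating the Laplace functional. -/

lemma tendsto_succ_mul_of_hasDerivAt {g : ℝ → ℝ} {d : ℝ} (hg : HasDerivAt g d 0) (h0 : g 0 = 0) :
    Tendsto (fun n : ℕ => ((n : ℝ) + 1) * g (1 / ((n : ℝ) + 1))) atTop (𝓝 d) := by
  rw [hasDerivAt_iff_tendsto_slope_zero] at hg
  have hn : Tendsto (fun n : ℕ => 1 / ((n : ℝ) + 1)) atTop (𝓝[≠] 0) := by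
    rw [tendsto_nhdsWithin_iff]
    exact ⟨tendsto_one_div_add_atTop_nhds_zero_nat, .of_forall fun n => by
      simp only [mem_compl_iff, mem_singleton_iff]; positivity⟩
  simpa [h0, Function.comp_def] using hg.comp hn

lemma one_sub_expNeg_le (x : ℝ≥0∞) : 1 - expNeg x ≤ x := by
  rcases eq_or_ne x ∞ with rfl | hx
  · simp
  · rw [expNeg_eq_ofReal hx, ← ENNReal.ofReal_one, ← ENNReal.ofReal_sub _ (by positivity)]
    refine ENNReal.ofReal_le_of_le_toReal ?_
    linarith [Real.add_one_le_exp (-x.toReal)]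

lemma one_sub_expNeg_ofReal {r : ℝ} (hr : 0 ≤ r) :
    1 - expNeg (ENNReal.ofReal r) = ENNReal.ofReal (1 - Real.exp (-r)) := by
  rw [expNeg_ofReal hr, ← ENNReal.ofReal_one, ENNReal.ofReal_sub _ (by positivity)]

lemma natCast_add_one_eq_ofReal (n : ℕ) : (n : ℝ≥0∞) + 1 = ENNReal.ofReal ((n : ℝ) + 1) := by
  rw [ENNReal.ofReal_add (by positivity) (by positivity)]; simp

lemma tendsto_mul_one_sub_expNeg {x : ℝ≥0∞} (hx : x ≠ ∞) :
    Tendsto (fun n : ℕ => ((n : ℝ≥0∞) + 1) *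
      (1 - expNeg (ENNReal.ofReal (1 / ((n : ℝ) + 1)) * x))) atTop (𝓝 x) := by
  obtain ⟨r, hr, rfl⟩ : ∃ r : ℝ, 0 ≤ r ∧ x = ENNReal.ofReal r :=
    ⟨x.toReal, ENNReal.toReal_nonneg, (ENNReal.ofReal_toReal hx).symm⟩
  have hg : HasDerivAt (fun ε : ℝ => 1 - Real.exp (-(ε * r))) r 0 := by
    have := (((hasDerivAt_id (0 : ℝ)).mul_const r).neg.exp).const_sub 1
    simpa using this
  have := ENNReal.tendsto_ofReal (tendsto_succ_mul_of_hasDerivAt hg (by simp))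
  refine this.congr fun n => ?_
  rw [← ENNReal.ofReal_mul (by positivity), one_sub_expNeg_ofReal (by positivity),
    natCast_add_one_eq_ofReal, ← ENNReal.ofReal_mul (by positivity)]

lemma tendsto_mul_one_sub_expNeg_comp {x : ℝ≥0∞} (hx : x ≠ ∞) :
    Tendsto (fun n : ℕ => ((n : ℝ≥0∞) + 1) *
      (1 - expNeg ((1 - expNeg (ENNReal.ofReal (1 / ((n : ℝ) + 1)))) * x))) atTop (𝓝 x) := by
  obtain ⟨r, hr, rfl⟩ : ∃ r : ℝ, 0 ≤ r ∧ x = ENNReal.ofReal r :=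
    ⟨x.toReal, ENNReal.toReal_nonneg, (ENNReal.ofReal_toReal hx).symm⟩
  have hg : HasDerivAt (fun ε : ℝ => 1 - Real.exp (-((1 - Real.exp (-ε)) * r))) r 0 := by
    have := ((((hasDerivAt_id (0 : ℝ)).neg.exp.const_sub 1).mul_const r).neg.exp).const_sub 1
    simpa using this
  have := ENNReal.tendsto_ofReal (tendsto_succ_mul_of_hasDerivAt hg (by simp))
  refine this.congr fun n => ?_
  have h1 : 0 ≤ 1 - Real.exp (-(1 / ((n : ℝ) + 1))) := by
    rw [sub_nonneg, Real.exp_le_one_iff]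
    have : (0 : ℝ) ≤ 1 / ((n : ℝ) + 1) := by positivity
    linarith
  rw [one_sub_expNeg_ofReal (by positivity), ← ENNReal.ofReal_mul h1,
    one_sub_expNeg_ofReal (by positivity),
    natCast_add_one_eq_ofReal, ← ENNReal.ofReal_mul (by positivity)]

namespace IsPoissonProcess

variable {Ω 𝕏 : Type*} [MeasurableSpace Ω] [MeasurableSpace 𝕏] {P : Measure Ω}
  {η : Ω → PointMeasure 𝕏} {Λ : Measure 𝕏}

/-- Replace h by h + ε 1_A in the Laplace functional and differentiate at ε = 0 along ε = 1/(n+1).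
The difference quotients are dominated by η(A), which is integrable since Λ(A) < ∞. -/
lemma lintegral_mul_expNeg (hη : IsPoissonProcess P η Λ) {A : Set 𝕏} (hA : MeasurableSet A)
    (hΛA : Λ A ≠ ∞) {h : 𝕏 → ℝ≥0∞} (hh : Measurable h) :
    ∫⁻ ω, (η ω).1 A * expNeg (∫⁻ x, h x ∂(η ω).1) ∂P =
      (∫⁻ x in A, expNeg (h x) ∂Λ) * expNeg (laplaceExponent Λ h) := by
  have := hη.isProbabilityMeasure
  have hmA : Measurable fun ω => (η ω).1 A :=
    (PointMeasure.measurable_apply hA).comp hη.measurable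
  have hmh : Measurable fun ω => expNeg (∫⁻ x, h x ∂(η ω).1) :=
    measurable_expNeg.comp ((PointMeasure.measurable_lintegral hh).comp hη.measurable)
  have hint : ∫⁻ ω, (η ω).1 A ∂P ≠ ∞ := by rw [hη.lintegral_apply hA hΛA]; exact hΛA
  let ε : ℕ → ℝ≥0∞ := fun n => ENNReal.ofReal (1 / ((n : ℝ) + 1))
  let a := ∫⁻ x in A, expNeg (h x) ∂Λ
  have ha : a ≠ ∞ := ((lintegral_mono (g := fun _ => 1) fun x => expNeg_le_one _).trans_lt
    (by simpa using hΛA.lt_top)).ne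
  have hε1 (n : ℕ) : ((n : ℝ≥0∞) + 1) * ε n = 1 := by
    rw [natCast_add_one_eq_ofReal, ← ENNReal.ofReal_mul (by positivity)]
    rw [mul_one_div_cancel (by positivity), ENNReal.ofReal_one]
  have hlim : Tendsto (fun n : ℕ => ∫⁻ ω, (((n : ℝ≥0∞) + 1) * (1 - expNeg (ε n * (η ω).1 A))) *
      expNeg (∫⁻ x, h x ∂(η ω).1) ∂P) atTop
      (𝓝 (∫⁻ ω, (η ω).1 A * expNeg (∫⁻ x, h x ∂(η ω).1) ∂P)) := by
    refine tendsto_lintegral_of_dominated_convergence (fun ω => (η ω).1 A)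
      (fun n => by fun_prop) (fun n => .of_forall fun ω => ?_) hint ?_
    · calc _ ≤ (((n : ℝ≥0∞) + 1) * (ε n * (η ω).1 A)) * 1 :=
          mul_le_mul' (mul_le_mul_right (one_sub_expNeg_le _) _) (expNeg_le_one _)
        _ = _ := by rw [mul_one, ← mul_assoc, hε1, one_mul]
    · filter_upwards [ae_lt_top hmA hint] with ω hω
      exact ENNReal.Tendsto.mul_const (tendsto_mul_one_sub_expNeg hω.ne)
        (.inr (expNeg_ne_top _))
  have hlim' : Tendsto (fun n : ℕ => (((n : ℝ≥0∞) + 1) * (1 - expNeg ((1 - expNeg (ε n)) * a))) *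
      expNeg (laplaceExponent Λ h)) atTop (𝓝 (a * expNeg (laplaceExponent Λ h))) :=
    ENNReal.Tendsto.mul_const (tendsto_mul_one_sub_expNeg_comp ha) (.inr (expNeg_ne_top _))
  refine tendsto_nhds_unique hlim (hlim'.congr fun n => ?_)
  have hind : Measurable (A.indicator fun _ : 𝕏 => ε n) := measurable_const.indicator hA
  have hhi : Measurable fun x => h x + A.indicator (fun _ => ε n) x := hh.add hind
  -- On A the exponent changes by e^{-h}(1 - e^{-ε}); off A it does not change.
  have hsum : laplaceExponent Λ (fun x => h x + A.indicator (fun _ => ε n) x) =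
      laplaceExponent Λ h + (1 - expNeg (ε n)) * a := by
    rw [laplaceExponent, laplaceExponent, ← lintegral_const_mul _ (by fun_prop),
      ← lintegral_indicator hA, ← lintegral_add_left (by fun_prop)]
    refine lintegral_congr fun x => ?_
    by_cases hx : x ∈ A
    · simp only [indicator_of_mem hx, expNeg_add]
      rw [ENNReal.sub_mul (fun _ _ => expNeg_ne_top _), one_mul, mul_comm (expNeg (ε n)),
        tsub_add_tsub_cancel (expNeg_le_one _) (mul_le_of_le_one_right' (expNeg_le_one _))]
    · simp [hx]
  have hpt (ω) : (((n : ℝ≥0∞) + 1) * (1 - expNeg (ε n * (η ω).1 A))) *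
      expNeg (∫⁻ x, h x ∂(η ω).1) = ((n : ℝ≥0∞) + 1) * (expNeg (∫⁻ x, h x ∂(η ω).1) -
        expNeg (∫⁻ x, (h x + A.indicator (fun _ => ε n) x) ∂(η ω).1)) := by
    rw [lintegral_add_left hh, lintegral_indicator_const hA, expNeg_add, mul_assoc,
      ENNReal.sub_mul (fun _ _ => expNeg_ne_top _), one_mul, mul_comm (expNeg (ε n * _))]
  have hle (ω) : expNeg (∫⁻ x, (h x + A.indicator (fun _ => ε n) x) ∂(η ω).1) ≤
      expNeg (∫⁻ x, h x ∂(η ω).1) :=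
    expNeg_strictAnti.antitone (lintegral_mono fun x => le_self_add)
  have hm2 : Measurable fun ω =>
      expNeg (∫⁻ x, (h x + A.indicator (fun _ => ε n) x) ∂(η ω).1) :=
    measurable_expNeg.comp ((PointMeasure.measurable_lintegral hhi).comp hη.measurable)
  have hf2 : ∫⁻ ω, expNeg (∫⁻ x, (h x + A.indicator (fun _ => ε n) x) ∂(η ω).1) ∂P ≠ ∞ := by
    rw [hη.lintegral_expNeg hhi]; exact expNeg_ne_top _
  simp only [hpt]
  rw [lintegral_const_mul _ (by fun_prop), lintegral_sub hm2 hf2 (.of_forall hle),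
    hη.lintegral_expNeg hhi, hη.lintegral_expNeg hh, hsum, expNeg_add, mul_assoc,
    ENNReal.sub_mul (fun _ _ => expNeg_ne_top _), one_mul, mul_comm (expNeg (_ * a))]

/-- The Mecke equation on a set of finite intensity. -/
theorem mecke [SFinite Λ] (hη : IsPoissonProcess P η Λ) {A : Set 𝕏} (hA : MeasurableSet A)
    (hΛA : Λ A ≠ ∞) :
    ((Λ.restrict A).prod (P.map η)).map (fun p => p.2.add (PointMeasure.dirac p.1)) =
      (P.map η).withDensity fun μ => μ.1 A := by
  have := hη.isProbabilityMeasure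
  have := Measure.isProbabilityMeasure_map (μ := P) hη.measurable.aemeasurable
  have : IsFiniteMeasure (Λ.restrict A) := ⟨by simpa using hΛA.lt_top⟩
  have hmA := PointMeasure.measurable_apply (𝕏 := 𝕏) hA
  have : IsFiniteMeasure ((P.map η).withDensity fun μ => μ.1 A) := by
    refine isFiniteMeasure_withDensity ?_
    rw [lintegral_map hmA hη.measurable, hη.lintegral_apply hA hΛA]; exact hΛA
  refine PointMeasure.ext_of_lintegral_expNeg fun h hh => ?_
  have hE : Measurable fun μ : PointMeasure 𝕏 => expNeg (∫⁻ x, h x ∂μ.1) :=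
    measurable_expNeg.comp (PointMeasure.measurable_lintegral hh)
  have hadd : Measurable fun p : 𝕏 × PointMeasure 𝕏 => p.2.add (PointMeasure.dirac p.1) := by
    fun_prop
  rw [lintegral_map hE hadd, lintegral_withDensity_eq_lintegral_mul _ hmA hE,
    lintegral_map (hmA.mul hE) hη.measurable]
  simp only [Pi.mul_apply]
  rw [hη.lintegral_mul_expNeg hA hΛA hh]
  simp only [PointMeasure.lintegral_add, PointMeasure.lintegral_dirac _ hh, expNeg_add,
    mul_comm (expNeg (∫⁻ x, h x ∂_))]
  rw [lintegral_prod_mul (f := fun x => expNeg (h x)) (by fun_prop) hE.aemeasurable,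
    lintegral_map hE hη.measurable, hη.lintegral_expNeg hh]

end IsPoissonProcess

/-! ### The averaged difference operator and its local L¹ bounds. -/

/-- A proper Poisson process `η` with a jointly measurable family of thinnings `ηt`. -/
structure IsThinningFamily {Ω 𝕏 : Type*} [MeasurableSpace Ω] [MeasurableSpace 𝕏]
    (P : Measure Ω) (Λ : Measure 𝕏) (η : Ω → PointMeasure 𝕏) (κ : Ω → ℕ∞) (X : ℕ → Ω → 𝕏)
    (ηt : ℝ → Ω → PointMeasure 𝕏) : Prop where
  poisson : IsPoissonProcess P η Λ
  proper : IsProperRep P η κ X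
  measurable : Measurable (Function.uncurry ηt)
  thinning : ∀ t ∈ Icc (0 : ℝ) 1, IsThinning P κ X t (ηt t)

/-- The uniform distribution on the unit interval. -/
noncomputable def unitMeasure : Measure ℝ := volume.restrict (Ioc 0 1)

instance : IsProbabilityMeasure unitMeasure := ⟨by simp [unitMeasure]⟩

lemma ae_unitMeasure_mem : ∀ᵐ t ∂unitMeasure, t ∈ Ioc (0 : ℝ) 1 :=
  ae_restrict_mem measurableSet_Ioc

/-- `∫ D_x f(η_t + μ) Π_{(1-t)Λ}(dμ)`, where the law `Π_{(1-t)Λ}` is that of `η_{1-t}`. -/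
noncomputable def condDiff {Ω 𝕏 : Type*} [MeasurableSpace Ω] [MeasurableSpace 𝕏]
    (P : Measure Ω) (ηt : ℝ → Ω → PointMeasure 𝕏) (f : PointMeasure 𝕏 → ℝ)
    (p : (Ω × 𝕏) × ℝ) : ℝ :=
  ∫ ω', PointMeasure.diff f p.1.2 ((ηt p.2 p.1.1).add (ηt (1 - p.2) ω')) ∂P

lemma Measurable.pointMeasure_diff {α 𝕏 : Type*} [MeasurableSpace α] [MeasurableSpace 𝕏]
    {f : PointMeasure 𝕏 → ℝ} (hf : Measurable f) {a : α → 𝕏} (ha : Measurable a)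
    {m : α → PointMeasure 𝕏} (hm : Measurable m) :
    Measurable fun z => PointMeasure.diff f (a z) (m z) := by
  have h1 : Measurable fun z => f ((m z).add (PointMeasure.dirac (a z))) :=
    hf.comp (hm.pointMeasure_add ha.pointMeasure_dirac)
  exact h1.sub (hf.comp hm)

lemma PointMeasure.measurable_diff {𝕏 : Type*} [MeasurableSpace 𝕏] {f : PointMeasure 𝕏 → ℝ}
    (hf : Measurable f) : Measurable fun p : 𝕏 × PointMeasure 𝕏 => diff f p.1 p.2 :=
  hf.pointMeasure_diff measurable_fst measurable_snd

namespace IsThinningFamily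

variable {Ω 𝕏 : Type*} [MeasurableSpace Ω] [MeasurableSpace 𝕏] {P : Measure Ω}
  {Λ : Measure 𝕏} {η : Ω → PointMeasure 𝕏} {κ : Ω → ℕ∞}
  {X : ℕ → Ω → 𝕏} {ηt : ℝ → Ω → PointMeasure 𝕏} {t : ℝ}

lemma measurable_apply (H : IsThinningFamily P Λ η κ X ηt) (t : ℝ) : Measurable (ηt t) :=
  H.measurable.comp measurable_prodMk_left

lemma measurable_add (H : IsThinningFamily P Λ η κ X ηt) :
    Measurable fun q : ((Ω × 𝕏) × ℝ) × Ω => (ηt q.1.2 q.1.1.1).add (ηt (1 - q.1.2) q.2) := by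
  refine Measurable.pointMeasure_add ?_ ?_
  · exact H.measurable.comp (by fun_prop : Measurable fun q : ((Ω × 𝕏) × ℝ) × Ω =>
      (q.1.2, q.1.1.1))
  · exact H.measurable.comp (by fun_prop : Measurable fun q : ((Ω × 𝕏) × ℝ) × Ω =>
      (1 - q.1.2, q.2))

lemma measurable_comp_add (H : IsThinningFamily P Λ η κ X ηt) {β : Type*} [MeasurableSpace β]
    {g : 𝕏 × PointMeasure 𝕏 → β} (hg : Measurable g) :
    Measurable fun q : ((Ω × 𝕏) × ℝ) × Ω =>
      g (q.1.1.2, (ηt q.1.2 q.1.1.1).add (ηt (1 - q.1.2) q.2)) :=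
  hg.comp ((by fun_prop : Measurable fun q : ((Ω × 𝕏) × ℝ) × Ω => q.1.1.2).prodMk H.measurable_add)

lemma measurable_diff_add_right (H : IsThinningFamily P Λ η κ X ηt) {f : PointMeasure 𝕏 → ℝ}
    (hf : Measurable f) (p : (Ω × 𝕏) × ℝ) :
    Measurable fun ω' => PointMeasure.diff f p.1.2 ((ηt p.2 p.1.1).add (ηt (1 - p.2) ω')) :=
  hf.pointMeasure_diff measurable_const
    (measurable_const.pointMeasure_add (H.measurable_apply _))

lemma condDiff_smul (c : ℝ) (f : PointMeasure 𝕏 → ℝ) :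
    condDiff P ηt (c • f) = c • condDiff P ηt f := by
  ext p
  rw [Pi.smul_apply, condDiff, condDiff, smul_eq_mul, ← integral_const_mul]
  refine integral_congr_ae (.of_forall fun ω' => ?_)
  simp only [PointMeasure.diff, Pi.smul_apply, smul_eq_mul]
  ring

variable [IsProbabilityMeasure P]

lemma isProbabilityMeasure_map (H : IsThinningFamily P Λ η κ X ηt) :
    IsProbabilityMeasure (P.map η) :=
  Measure.isProbabilityMeasure_map H.poisson.measurable.aemeasurable

lemma isPoissonProcess_apply (H : IsThinningFamily P Λ η κ X ηt) (ht : t ∈ Icc (0 : ℝ) 1) :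
    IsPoissonProcess P (ηt t) (ENNReal.ofReal t • Λ) :=
  (H.thinning t ht).isPoissonProcess_smul H.poisson H.proper ht (H.measurable_apply t)

lemma isPoissonProcess_one_sub (H : IsThinningFamily P Λ η κ X ηt) (ht : t ∈ Icc (0 : ℝ) 1) :
    IsPoissonProcess P (ηt (1 - t)) (ENNReal.ofReal (1 - t) • Λ) :=
  H.isPoissonProcess_apply ⟨by linarith [ht.2], by linarith [ht.1]⟩

lemma map_add (H : IsThinningFamily P Λ η κ X ηt) (ht : t ∈ Icc (0 : ℝ) 1) :
    (P.prod P).map (fun p => (ηt t p.1).add (ηt (1 - t) p.2)) = P.map η :=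
  (H.thinning t ht).map_add H.poisson H.proper ht (H.measurable_apply t)
    (H.isPoissonProcess_one_sub ht)

/-- For each fixed t and x the superposition has the law of η, so the average over t is over a
constant. -/
lemma lintegral_superposition (H : IsThinningFamily P Λ η κ X ηt) (ν : Measure 𝕏) [SFinite ν]
    {g : 𝕏 × PointMeasure 𝕏 → ℝ≥0∞} (hg : Measurable g) :
    ∫⁻ p, ∫⁻ ω', g (p.1.2, (ηt p.2 p.1.1).add (ηt (1 - p.2) ω')) ∂P ∂((P.prod ν).prod unitMeasure)
      = ∫⁻ x, ∫⁻ μ, g (x, μ) ∂(P.map η) ∂ν := by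
  have hm := H.measurable_comp_add hg
  rw [lintegral_prod_symm _ hm.lintegral_prod_right'.aemeasurable]
  have key : ∀ᵐ t ∂unitMeasure, ∫⁻ q : Ω × 𝕏, ∫⁻ ω', g (q.2, (ηt t q.1).add (ηt (1 - t) ω')) ∂P
      ∂(P.prod ν) = ∫⁻ x, ∫⁻ μ, g (x, μ) ∂(P.map η) ∂ν := by
    filter_upwards [ae_unitMeasure_mem] with t ht
    have ht' : t ∈ Icc (0 : ℝ) 1 := Ioc_subset_Icc_self ht
    rw [lintegral_prod_symm]
    swap
    · exact (hm.lintegral_prod_right'.comp measurable_prodMk_right).aemeasurable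
    refine lintegral_congr fun x => ?_
    have hgx : Measurable fun μ => g (x, μ) := hg.comp measurable_prodMk_left
    have hadd : Measurable fun p : Ω × Ω => (ηt t p.1).add (ηt (1 - t) p.2) :=
      ((H.measurable_apply t).comp measurable_fst).pointMeasure_add
        ((H.measurable_apply (1 - t)).comp measurable_snd)
    have hga : Measurable fun p : Ω × Ω => g (x, (ηt t p.1).add (ηt (1 - t) p.2)) :=
      hgx.comp hadd
    rw [← H.map_add ht', lintegral_map hgx hadd, lintegral_prod _ hga.aemeasurable]
  rw [lintegral_congr_ae key]
  simp

lemma lintegral_lintegral_add_dirac [SFinite Λ] (H : IsThinningFamily P Λ η κ X ηt) {A : Set 𝕏}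
    (hA : MeasurableSet A) (hΛA : Λ A ≠ ∞) {g : PointMeasure 𝕏 → ℝ≥0∞} (hg : Measurable g) :
    ∫⁻ x in A, ∫⁻ μ, g (μ.add (PointMeasure.dirac x)) ∂(P.map η) ∂Λ =
      ∫⁻ μ, μ.1 A * g μ ∂(P.map η) := by
  have := H.isProbabilityMeasure_map
  have hadd : Measurable fun p : 𝕏 × PointMeasure 𝕏 => p.2.add (PointMeasure.dirac p.1) := by
    fun_prop
  have hga : Measurable fun p : 𝕏 × PointMeasure 𝕏 => g (p.2.add (PointMeasure.dirac p.1)) :=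
    hg.comp hadd
  have h1 : ∫⁻ μ, μ.1 A * g μ ∂(P.map η) =
      ∫⁻ μ, g μ ∂((P.map η).withDensity fun μ => μ.1 A) := by
    rw [lintegral_withDensity_eq_lintegral_mul _ (PointMeasure.measurable_apply hA) hg]; rfl
  rw [h1, ← H.poisson.mecke hA hΛA, lintegral_map hg hadd, lintegral_prod _ hga.aemeasurable]

/-- By the triangle inequality, |D_x f(μ)| is at most |f(μ + δ_x)| + |f(μ)|. The Mecke equation
turns the first term into the weight μ(A), and the second contributes Λ(A). -/
lemma lintegral_enorm_diff_le [SFinite Λ] (H : IsThinningFamily P Λ η κ X ηt) {A : Set 𝕏}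
    (hA : MeasurableSet A) (hΛA : Λ A ≠ ∞) {f : PointMeasure 𝕏 → ℝ} (hf : Measurable f) :
    ∫⁻ x in A, ∫⁻ μ, ‖PointMeasure.diff f x μ‖ₑ ∂(P.map η) ∂Λ ≤
      ∫⁻ μ, ‖f μ‖ₑ * (μ.1 A + Λ A) ∂(P.map η) := by
  have := H.isProbabilityMeasure_map
  have hadd : Measurable fun p : 𝕏 × PointMeasure 𝕏 => p.2.add (PointMeasure.dirac p.1) := by
    fun_prop
  have hmA := PointMeasure.measurable_apply (𝕏 := 𝕏) hA
  have hga : Measurable fun p : 𝕏 × PointMeasure 𝕏 => ‖f (p.2.add (PointMeasure.dirac p.1))‖ₑ :=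
    (hf.comp hadd).enorm
  calc _ ≤ ∫⁻ x in A, ∫⁻ μ, (‖f (μ.add (PointMeasure.dirac x))‖ₑ + ‖f μ‖ₑ) ∂(P.map η) ∂Λ :=
        lintegral_mono fun x => lintegral_mono fun μ => enorm_sub_le
    _ = ∫⁻ x in A, ∫⁻ μ, ‖f (μ.add (PointMeasure.dirac x))‖ₑ ∂(P.map η) ∂Λ +
        ∫⁻ x in A, ∫⁻ μ, ‖f μ‖ₑ ∂(P.map η) ∂Λ := by
      rw [← lintegral_add_right _ (by fun_prop)]
      refine lintegral_congr fun x => ?_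
      rw [lintegral_add_right _ hf.enorm]
    _ = _ := by
      rw [H.lintegral_lintegral_add_dirac hA hΛA hf.enorm, lintegral_const, Measure.restrict_apply_univ]
      simp only [mul_add]
      rw [lintegral_add_right _ (hf.enorm.mul_const _), lintegral_mul_const _ hf.enorm]
      simp only [mul_comm]

/-- The Mecke equation gives E η(A)² = Λ(A)(Λ(A) + 1). This is the second factor of the
Cauchy–Schwarz bound for D f in terms of the L² norm of f. -/
lemma lintegral_sq_apply_lt_top [SFinite Λ] (H : IsThinningFamily P Λ η κ X ηt) {A : Set 𝕏}
    (hA : MeasurableSet A) (hΛA : Λ A ≠ ∞) :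
    ∫⁻ μ, (μ.1 A + Λ A) ^ (2 : ℝ) ∂(P.map η) < ∞ := by
  have := H.isProbabilityMeasure_map
  have hmA := PointMeasure.measurable_apply (𝕏 := 𝕏) hA
  have h1 : ∫⁻ μ, μ.1 A ∂(P.map η) = Λ A := H.poisson.map.lintegral_apply hA hΛA
  have h2 : ∫⁻ μ, μ.1 A * μ.1 A ∂(P.map η) = Λ A * (Λ A + 1) := by
    rw [← H.lintegral_lintegral_add_dirac hA hΛA hmA]
    have (x) (hx : x ∈ A) : ∫⁻ μ, (μ.add (PointMeasure.dirac x)).1 A ∂(P.map η) = Λ A + 1 := by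
      have (μ : PointMeasure 𝕏) : (μ.add (PointMeasure.dirac x)).1 A = μ.1 A + 1 := by
        change (μ.1 + Measure.dirac x) A = _
        rw [Measure.add_apply, Measure.dirac_apply' _ hA, indicator_of_mem hx]; rfl
      simp only [this]
      rw [lintegral_add_right _ measurable_const, h1]; simp
    rw [setLIntegral_congr_fun hA this]
    simp [mul_comm]
  have h3 (μ : PointMeasure 𝕏) : (μ.1 A + Λ A) ^ (2 : ℝ) =
      μ.1 A * μ.1 A + 2 * Λ A * μ.1 A + Λ A * Λ A := by
    rw [ENNReal.rpow_two]; ring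
  simp only [h3]
  rw [lintegral_add_right _ measurable_const, lintegral_add_right _ (hmA.const_mul _), h2,
    lintegral_const_mul _ hmA, h1]
  simp only [lintegral_const, measure_univ, mul_one]
  finiteness

/-- The constant in the local `L¹` bound for the difference operator. -/
lemma exists_lintegral_enorm_diff_le [SFinite Λ] (H : IsThinningFamily P Λ η κ X ηt) {A : Set 𝕏}
    (hA : MeasurableSet A) (hΛA : Λ A ≠ ∞) : ∃ C : ℝ≥0∞, C ≠ ∞ ∧
    ∀ f : PointMeasure 𝕏 → ℝ, Measurable f →
      ∫⁻ x in A, ∫⁻ μ, ‖PointMeasure.diff f x μ‖ₑ ∂(P.map η) ∂Λ ≤ C * eLpNorm f 2 (P.map η) := by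
  refine ⟨(∫⁻ μ, (μ.1 A + Λ A) ^ (2 : ℝ) ∂(P.map η)) ^ (1 / (2 : ℝ)),
    (ENNReal.rpow_lt_top_of_nonneg (by norm_num) (H.lintegral_sq_apply_lt_top hA hΛA).ne).ne,
    fun f hf => (H.lintegral_enorm_diff_le hA hΛA hf).trans ?_⟩
  have hmA := PointMeasure.measurable_apply (𝕏 := 𝕏) hA
  have := ENNReal.lintegral_mul_le_Lp_mul_Lq (P.map η) (p := 2) (q := 2)
    ⟨by norm_num, by norm_num, by norm_num⟩ hf.enorm.aemeasurable
    (hmA.add_const (Λ A)).aemeasurable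
  refine this.trans_eq ?_
  rw [mul_comm, eLpNorm_eq_lintegral_rpow_enorm_toReal (by simp) (by simp)]
  simp

lemma measurable_condDiff (H : IsThinningFamily P Λ η κ X ηt) {f : PointMeasure 𝕏 → ℝ}
    (hf : Measurable f) : Measurable (condDiff P ηt f) := by
  have := H.measurable_comp_add (PointMeasure.measurable_diff hf)
  exact this.stronglyMeasurable.integral_prod_right'.measurable

lemma lintegral_enorm_diff_superposition_le [SFinite Λ] (H : IsThinningFamily P Λ η κ X ηt)
    {A : Set 𝕏} {C : ℝ≥0∞}
    (hC : ∀ f : PointMeasure 𝕏 → ℝ, Measurable f →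
      ∫⁻ x in A, ∫⁻ μ, ‖PointMeasure.diff f x μ‖ₑ ∂(P.map η) ∂Λ ≤ C * eLpNorm f 2 (P.map η))
    {f : PointMeasure 𝕏 → ℝ} (hf : Measurable f) :
    ∫⁻ p, ∫⁻ ω', ‖PointMeasure.diff f p.1.2 ((ηt p.2 p.1.1).add (ηt (1 - p.2) ω'))‖ₑ ∂P
      ∂((P.prod (Λ.restrict A)).prod unitMeasure) ≤ C * eLpNorm f 2 (P.map η) :=
  (H.lintegral_superposition (Λ.restrict A)
    (PointMeasure.measurable_diff hf).enorm).trans_le (hC f hf)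

lemma lintegral_enorm_condDiff_le [SFinite Λ] (H : IsThinningFamily P Λ η κ X ηt)
    {A : Set 𝕏} {C : ℝ≥0∞}
    (hC : ∀ f : PointMeasure 𝕏 → ℝ, Measurable f →
      ∫⁻ x in A, ∫⁻ μ, ‖PointMeasure.diff f x μ‖ₑ ∂(P.map η) ∂Λ ≤ C * eLpNorm f 2 (P.map η))
    {f : PointMeasure 𝕏 → ℝ} (hf : Measurable f) :
    ∫⁻ p, ‖condDiff P ηt f p‖ₑ ∂((P.prod (Λ.restrict A)).prod unitMeasure) ≤
      C * eLpNorm f 2 (P.map η) :=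
  (lintegral_mono fun _ => enorm_integral_le_lintegral_enorm _).trans
    (H.lintegral_enorm_diff_superposition_le hC hf)

/-- A property that holds almost everywhere over all sets of finite intensity holds almost
everywhere. -/
lemma ae_of_forall_restrict [SigmaFinite Λ] {p : (Ω × 𝕏) × ℝ → Prop}
    (hp : ∀ A, MeasurableSet A → Λ A ≠ ∞ →
      ∀ᵐ q ∂((P.prod (Λ.restrict A)).prod unitMeasure), p q) :
    ∀ᵐ q ∂((P.prod Λ).prod unitMeasure), p q := by
  have h1 (n : ℕ) : (P.prod (Λ.restrict (spanningSets Λ n))).prod unitMeasure =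
      ((P.prod Λ).prod unitMeasure).restrict ((univ ×ˢ spanningSets Λ n) ×ˢ univ) := by
    rw [← Measure.prod_restrict, ← Measure.prod_restrict, Measure.restrict_univ,
      Measure.restrict_univ]
  have h2 : (⋃ n, ((univ : Set Ω) ×ˢ spanningSets Λ n) ×ˢ (univ : Set ℝ)) = univ := by
    ext q
    have : q.1.2 ∈ ⋃ n, spanningSets Λ n := by rw [iUnion_spanningSets]; trivial
    simpa only [mem_iUnion, mem_prod, mem_univ, true_and, and_true, iff_true] using this
  rw [← Measure.restrict_univ (μ := (P.prod Λ).prod unitMeasure), ← h2, ae_restrict_iUnion_iff]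
  intro n
  rw [← h1]
  exact hp _ (measurableSet_spanningSets Λ n) (measure_spanningSets_lt_top Λ n).ne

lemma ae_integrable_diff [SigmaFinite Λ] (H : IsThinningFamily P Λ η κ X ηt)
    {f : PointMeasure 𝕏 → ℝ} (hf : Measurable f) (hf2 : MemLp f 2 (P.map η)) :
    ∀ᵐ p ∂((P.prod Λ).prod unitMeasure),
      Integrable (fun ω' => PointMeasure.diff f p.1.2 ((ηt p.2 p.1.1).add (ηt (1 - p.2) ω'))) P := by
  refine ae_of_forall_restrict fun A hA hΛA => ?_
  obtain ⟨C, hC, hle⟩ := H.exists_lintegral_enorm_diff_le hA hΛA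
  have hm := H.measurable_comp_add (PointMeasure.measurable_diff hf)
  have hlt := (H.lintegral_enorm_diff_superposition_le hle hf).trans_lt
    (ENNReal.mul_lt_top hC.lt_top hf2.2)
  filter_upwards [ae_lt_top hm.enorm.lintegral_prod_right' hlt.ne] with p hp
  exact ⟨(H.measurable_diff_add_right hf p).aestronglyMeasurable, hp⟩

/-- Although D_x f looks at μ + δ_x, the operator is well defined on L² classes: the local L¹ bound
applied to f - g has right side 0. -/
lemma condDiff_congr [SigmaFinite Λ] (H : IsThinningFamily P Λ η κ X ηt)
    {f g : PointMeasure 𝕏 → ℝ} (hf : Measurable f) (hg : Measurable g) (hfg : f =ᵐ[P.map η] g) :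
    condDiff P ηt f =ᵐ[(P.prod Λ).prod unitMeasure] condDiff P ηt g := by
  refine ae_of_forall_restrict fun A hA hΛA => ?_
  obtain ⟨C, hC, hle⟩ := H.exists_lintegral_enorm_diff_le hA hΛA
  have hfgm : Measurable (f - g) := hf.sub hg
  have hm := H.measurable_comp_add (PointMeasure.measurable_diff hfgm)
  have h0 := H.lintegral_enorm_diff_superposition_le hle hfgm
  have hz : eLpNorm (f - g) 2 (P.map η) = 0 := by
    rw [eLpNorm_congr_ae (g := 0)]
    · simp
    · filter_upwards [hfg] with μ hμ; simp [hμ]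
  have hmeas : Measurable fun p : (Ω × 𝕏) × ℝ => ∫⁻ ω', ‖PointMeasure.diff (f - g) p.1.2
      ((ηt p.2 p.1.1).add (ηt (1 - p.2) ω'))‖ₑ ∂P := hm.enorm.lintegral_prod_right'
  rw [hz, mul_zero, nonpos_iff_eq_zero, lintegral_eq_zero_iff hmeas] at h0
  filter_upwards [h0] with p hp
  have hmp := H.measurable_diff_add_right hfgm p
  simp only [Pi.zero_apply] at hp
  rw [lintegral_eq_zero_iff hmp.enorm] at hp
  rw [condDiff, condDiff]
  refine integral_congr_ae ?_
  filter_upwards [hp] with ω' hω'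
  rw [Pi.zero_apply, enorm_eq_zero] at hω'
  simp only [PointMeasure.diff, Pi.sub_apply] at hω' ⊢
  linarith

/-- Additivity holds only almost everywhere, because the inner Bochner integrals are known to
converge only for almost every point. -/
lemma condDiff_add [SigmaFinite Λ] (H : IsThinningFamily P Λ η κ X ηt)
    {f g : PointMeasure 𝕏 → ℝ} (hf : Measurable f) (hf2 : MemLp f 2 (P.map η))
    (hg : Measurable g) (hg2 : MemLp g 2 (P.map η)) :
    condDiff P ηt (f + g) =ᵐ[(P.prod Λ).prod unitMeasure]
      condDiff P ηt f + condDiff P ηt g := by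
  filter_upwards [H.ae_integrable_diff hf hf2, H.ae_integrable_diff hg hg2] with p h1 h2
  rw [Pi.add_apply, condDiff, condDiff, condDiff, ← integral_add h1 h2]
  refine integral_congr_ae (.of_forall fun ω' => ?_)
  simp only [PointMeasure.diff, Pi.add_apply]
  ring

end IsThinningFamily

/-! ### Exponential functionals and their covariance identity. -/

lemma toReal_expNeg_le_one (x : ℝ≥0∞) : (expNeg x).toReal ≤ 1 :=
  ENNReal.toReal_le_of_le_ofReal zero_le_one (by simpa using expNeg_le_one x)

lemma toReal_expNeg {x : ℝ≥0∞} (hx : x ≠ ∞) : (expNeg x).toReal = Real.exp (-x.toReal) := by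
  rw [expNeg_eq_ofReal hx, ENNReal.toReal_ofReal (by positivity)]

/-- The function `1 - e^{-h}`. -/
noncomputable def expDefect {𝕏 : Type*} (h : 𝕏 → ℝ≥0∞) (x : 𝕏) : ℝ := (1 - expNeg (h x)).toReal

lemma expDefect_eq {𝕏 : Type*} (h : 𝕏 → ℝ≥0∞) (x : 𝕏) : expDefect h x = 1 - (expNeg (h x)).toReal := by
  rw [expDefect, ENNReal.toReal_sub_of_le (expNeg_le_one _) (by simp), ENNReal.toReal_one]

lemma expDefect_nonneg {𝕏 : Type*} (h : 𝕏 → ℝ≥0∞) (x : 𝕏) : 0 ≤ expDefect h x := ENNReal.toReal_nonneg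

lemma expDefect_le_one {𝕏 : Type*} (h : 𝕏 → ℝ≥0∞) (x : 𝕏) : expDefect h x ≤ 1 := by
  rw [expDefect_eq]; linarith [ENNReal.toReal_nonneg (a := expNeg (h x))]

lemma expDefect_add {𝕏 : Type*} (h k : 𝕏 → ℝ≥0∞) (x : 𝕏) :
    expDefect (h + k) x = expDefect h x + expDefect k x - expDefect h x * expDefect k x := by
  simp only [expDefect_eq, Pi.add_apply, expNeg_add, ENNReal.toReal_mul]
  ring

section ExpFunctional

variable {𝕏 : Type*} [MeasurableSpace 𝕏]

/-- The functional `μ ↦ e^{-∫ h dμ}` on the space of point measures. -/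
noncomputable def expFunctional (h : 𝕏 → ℝ≥0∞) (μ : PointMeasure 𝕏) : ℝ :=
  (expNeg (∫⁻ x, h x ∂μ.1)).toReal

lemma measurable_expDefect {h : 𝕏 → ℝ≥0∞} (hh : Measurable h) : Measurable (expDefect h) := by
  unfold expDefect; fun_prop

lemma integrable_expDefect {Λ : Measure 𝕏} {h : 𝕏 → ℝ≥0∞} (hh : Measurable h)
    (hL : laplaceExponent Λ h ≠ ∞) : Integrable (expDefect h) Λ :=
  integrable_toReal_of_lintegral_ne_top (by fun_prop) hL

lemma integral_expDefect {Λ : Measure 𝕏} {h : 𝕏 → ℝ≥0∞} (hh : Measurable h) :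
    ∫ x, expDefect h x ∂Λ = (laplaceExponent Λ h).toReal :=
  integral_toReal (by fun_prop) (.of_forall fun x => (tsub_le_self.trans_lt (by simp)))

/-- From 1 - ab ≤ (1 - a) + (1 - b) for a, b in [0, 1]. -/
lemma laplaceExponent_add_ne_top {Λ : Measure 𝕏} {h k : 𝕏 → ℝ≥0∞} (hh : Measurable h)
    (hL : laplaceExponent Λ h ≠ ∞) (hL' : laplaceExponent Λ k ≠ ∞) :
    laplaceExponent Λ (h + k) ≠ ∞ := by
  refine ((lintegral_mono fun x => ?_).trans_lt
    ((lintegral_add_left (μ := Λ) (f := fun x => 1 - expNeg (h x)) (by fun_prop)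
      fun x => 1 - expNeg (k x)).trans_lt (ENNReal.add_lt_top.2 ⟨hL.lt_top, hL'.lt_top⟩))).ne
  rw [Pi.add_apply, expNeg_add]
  calc 1 - expNeg (h x) * expNeg (k x)
      ≤ (1 - expNeg (h x)) + (expNeg (h x) - expNeg (h x) * expNeg (k x)) :=
        tsub_le_tsub_add_tsub
    _ ≤ _ := by
        refine add_le_add le_rfl ?_
        rw [tsub_le_iff_right]
        calc expNeg (h x) = expNeg (h x) * ((1 - expNeg (k x)) + expNeg (k x)) := by
              rw [tsub_add_cancel_of_le (expNeg_le_one _), mul_one]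
          _ ≤ _ := by
              rw [mul_add]
              gcongr
              exact mul_le_of_le_one_left' (expNeg_le_one _)

lemma laplaceExponent_smul (c : ℝ≥0∞) (Λ : Measure 𝕏) (h : 𝕏 → ℝ≥0∞) :
    laplaceExponent (c • Λ) h = c * laplaceExponent Λ h := by
  rw [laplaceExponent, lintegral_smul_measure, smul_eq_mul, laplaceExponent]

lemma expFunctional_nonneg (h : 𝕏 → ℝ≥0∞) (μ : PointMeasure 𝕏) : 0 ≤ expFunctional h μ :=
  ENNReal.toReal_nonneg

lemma expFunctional_le_one (h : 𝕏 → ℝ≥0∞) (μ : PointMeasure 𝕏) : expFunctional h μ ≤ 1 :=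
  toReal_expNeg_le_one _

lemma measurable_expFunctional {h : 𝕏 → ℝ≥0∞} (hh : Measurable h) :
    Measurable (expFunctional h) :=
  (measurable_expNeg.comp (PointMeasure.measurable_lintegral hh)).ennreal_toReal

lemma memLp_expFunctional {h : 𝕏 → ℝ≥0∞} (hh : Measurable h) (Q : Measure (PointMeasure 𝕏))
    [IsFiniteMeasure Q] (p : ℝ≥0∞) : MemLp (expFunctional h) p Q :=
  MemLp.of_bound (measurable_expFunctional hh).aestronglyMeasurable 1 (.of_forall fun μ => by
    rw [Real.norm_of_nonneg (expFunctional_nonneg h μ)]; exact expFunctional_le_one h μ)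

lemma expFunctional_mul {h : 𝕏 → ℝ≥0∞} (hh : Measurable h) (k : 𝕏 → ℝ≥0∞) (μ : PointMeasure 𝕏) :
    expFunctional h μ * expFunctional k μ = expFunctional (h + k) μ := by
  rw [expFunctional, expFunctional, expFunctional, ← ENNReal.toReal_mul, ← expNeg_add,
    ← lintegral_add_left hh]
  rfl

lemma expFunctional_add (h : 𝕏 → ℝ≥0∞) (μ ν : PointMeasure 𝕏) :
    expFunctional h (μ.add ν) = expFunctional h μ * expFunctional h ν := by
  rw [expFunctional, PointMeasure.lintegral_add, expNeg_add, ENNReal.toReal_mul]; rfl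

/-- Adding a point at x multiplies the functional by e^{-h(x)}, so D_x acts as a scalar. This is
what makes these functionals computable. -/
lemma diff_expFunctional {h : 𝕏 → ℝ≥0∞} (hh : Measurable h) (x : 𝕏) (μ : PointMeasure 𝕏) :
    PointMeasure.diff (expFunctional h) x μ = -expDefect h x * expFunctional h μ := by
  rw [PointMeasure.diff, expFunctional_add, expDefect_eq]
  have : expFunctional h (PointMeasure.dirac x) = (expNeg (h x)).toReal := by
    rw [expFunctional, PointMeasure.lintegral_dirac _ hh]
  rw [this]; ring

lemma IsPoissonProcess.integral_expFunctional {Ω : Type*} [MeasurableSpace Ω] {P : Measure Ω}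
    {η : Ω → PointMeasure 𝕏} {Λ : Measure 𝕏} (hη : IsPoissonProcess P η Λ) {h : 𝕏 → ℝ≥0∞}
    (hh : Measurable h) (hL : laplaceExponent Λ h ≠ ∞) :
    ∫ ω, expFunctional h (η ω) ∂P = Real.exp (-(laplaceExponent Λ h).toReal) := by
  rw [← toReal_expNeg hL, ← hη.lintegral_expNeg hh]
  refine integral_toReal ?_ (.of_forall fun ω => (expNeg_ne_top _).lt_top)
  exact (measurable_expNeg.comp ((PointMeasure.measurable_lintegral hh).comp
    hη.measurable)).aemeasurable

end ExpFunctional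

namespace IsThinningFamily

variable {Ω 𝕏 : Type*} [MeasurableSpace Ω] [MeasurableSpace 𝕏] {P : Measure Ω}
  {Λ : Measure 𝕏} {η : Ω → PointMeasure 𝕏} {κ : Ω → ℕ∞}
  {X : ℕ → Ω → 𝕏} {ηt : ℝ → Ω → PointMeasure 𝕏} {t : ℝ} [IsProbabilityMeasure P]

/-- The independent superposed process contributes only its Laplace functional, which leaves a
deterministic factor times a functional of η_t. -/
lemma condDiff_expFunctional (H : IsThinningFamily P Λ η κ X ηt) {h : 𝕏 → ℝ≥0∞}
    (hh : Measurable h) (hL : laplaceExponent Λ h ≠ ∞) (ht : t ∈ Icc (0 : ℝ) 1) (ω : Ω) (x : 𝕏) :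
    condDiff P ηt (expFunctional h) ((ω, x), t) =
      -expDefect h x * Real.exp (-((1 - t) * (laplaceExponent Λ h).toReal)) *
        expFunctional h (ηt t ω) := by
  have h1 : laplaceExponent (ENNReal.ofReal (1 - t) • Λ) h ≠ ∞ := by
    rw [laplaceExponent_smul]; exact ENNReal.mul_ne_top (by simp) hL
  simp only [condDiff, diff_expFunctional hh, expFunctional_add]
  rw [integral_const_mul, integral_const_mul,
    (H.isPoissonProcess_one_sub ht).integral_expFunctional hh h1, laplaceExponent_smul,
    ENNReal.toReal_mul, ENNReal.toReal_ofReal (by linarith [ht.2])]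
  ring

lemma abs_condDiff_expFunctional_le (H : IsThinningFamily P Λ η κ X ηt) {h : 𝕏 → ℝ≥0∞}
    (hh : Measurable h) (hL : laplaceExponent Λ h ≠ ∞) [SFinite Λ] :
    ∀ᵐ p ∂((P.prod Λ).prod unitMeasure), |condDiff P ηt (expFunctional h) p| ≤
      expDefect h p.1.2 := by
  have := Measure.quasiMeasurePreserving_snd (μ := P.prod Λ) (ν := unitMeasure)
  filter_upwards [this.ae ae_unitMeasure_mem] with p hp
  have hp' : p.2 ∈ Icc (0 : ℝ) 1 := Ioc_subset_Icc_self hp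
  rw [H.condDiff_expFunctional hh hL hp' p.1.1 p.1.2, abs_mul, abs_mul, abs_neg,
    abs_of_nonneg (expDefect_nonneg _ _), abs_of_nonneg (Real.exp_nonneg _),
    abs_of_nonneg (expFunctional_nonneg _ _), mul_assoc]
  refine mul_le_of_le_one_right (expDefect_nonneg _ _) ?_
  refine mul_le_one₀ ?_ (expFunctional_nonneg _ _) (expFunctional_le_one _ _)
  rw [Real.exp_le_one_iff, neg_nonpos]
  exact mul_nonneg (by linarith [hp.2]) ENNReal.toReal_nonneg

lemma integrable_expDefect_prod [SFinite Λ] {h : 𝕏 → ℝ≥0∞}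
    (hh : Measurable h) (hL : laplaceExponent Λ h ≠ ∞) :
    Integrable (fun p : (Ω × 𝕏) × ℝ => expDefect h p.1.2) ((P.prod Λ).prod unitMeasure) :=
  ((integrable_expDefect hh hL).comp_snd P).comp_fst unitMeasure

lemma integrable_condDiff_mul_expFunctional (H : IsThinningFamily P Λ η κ X ηt) [SFinite Λ]
    {h k : 𝕏 → ℝ≥0∞} (hh : Measurable h) (hL : laplaceExponent Λ h ≠ ∞) (hk : Measurable k)
    (hL' : laplaceExponent Λ k ≠ ∞) :
    Integrable (fun p => condDiff P ηt (expFunctional h) p * condDiff P ηt (expFunctional k) p)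
      ((P.prod Λ).prod unitMeasure) := by
  refine (integrable_expDefect_prod (P := P) hh hL).mono
    ((H.measurable_condDiff (measurable_expFunctional hh)).mul
      (H.measurable_condDiff (measurable_expFunctional hk))).aestronglyMeasurable ?_
  filter_upwards [H.abs_condDiff_expFunctional_le hh hL, H.abs_condDiff_expFunctional_le hk hL']
    with p h1 h2
  rw [norm_mul, Real.norm_eq_abs, Real.norm_eq_abs, Real.norm_of_nonneg (expDefect_nonneg _ _)]
  exact (mul_le_mul h1 (h2.trans (expDefect_le_one _ _)) (abs_nonneg _)
    (expDefect_nonneg _ _)).trans_eq (mul_one _)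

/-- The covariance identity for exponential functionals. -/
lemma integral_condDiff_mul_expFunctional (H : IsThinningFamily P Λ η κ X ηt) [SFinite Λ]
    {h k : 𝕏 → ℝ≥0∞} (hh : Measurable h) (hL : laplaceExponent Λ h ≠ ∞) (hk : Measurable k)
    (hL' : laplaceExponent Λ k ≠ ∞) :
    ∫ p, condDiff P ηt (expFunctional h) p * condDiff P ηt (expFunctional k) p
      ∂((P.prod Λ).prod unitMeasure) =
    ∫ μ, expFunctional h μ * expFunctional k μ ∂(P.map η) -
      (∫ μ, expFunctional h μ ∂(P.map η)) * ∫ μ, expFunctional k μ ∂(P.map η) := by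
  have hLs := laplaceExponent_add_ne_top hh hL hL'
  set a := (laplaceExponent Λ h).toReal with ha
  set b := (laplaceExponent Λ k).toReal with hb
  set q := ∫ x, expDefect h x * expDefect k x ∂Λ with hq
  have hint : Integrable (fun x => expDefect h x * expDefect k x) Λ := by
    refine (integrable_expDefect hh hL).mono
      ((measurable_expDefect hh).mul (measurable_expDefect hk)).aestronglyMeasurable
      (.of_forall fun x => ?_)
    rw [Real.norm_of_nonneg (mul_nonneg (expDefect_nonneg _ _) (expDefect_nonneg _ _)),
      Real.norm_of_nonneg (expDefect_nonneg _ _)]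
    exact mul_le_of_le_one_right (expDefect_nonneg _ _) (expDefect_le_one _ _)
  -- Inclusion–exclusion for 1 - e^{-h}: the overlap q alone produces the covariance, which equals
  -- e^{-(a+b)}(e^q - 1).
  have hs : (laplaceExponent Λ (h + k)).toReal = a + b - q := by
    rw [← integral_expDefect (hh.add hk), ha, hb, ← integral_expDefect hh,
      ← integral_expDefect hk, hq, ← integral_add (integrable_expDefect hh hL)
      (integrable_expDefect hk hL')]
    simp only [expDefect_add]
    exact integral_sub ((integrable_expDefect hh hL).add (integrable_expDefect hk hL')) hint
  simp only [expFunctional_mul hh]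
  rw [H.poisson.map.integral_expFunctional (hh.add hk) hLs,
    H.poisson.map.integral_expFunctional hh hL, H.poisson.map.integral_expFunctional hk hL', hs,
    integral_prod_symm _ (H.integrable_condDiff_mul_expFunctional hh hL hk hL')]
  -- At level t the factor e^{-(1-t)(a+b)} comes from the superposed process and e^{-t(a+b-q)} from
  -- η_t. Their product is e^{-(a+b)} e^{tq}, and q e^{tq} integrates to e^q - 1.
  have key : ∀ᵐ t ∂unitMeasure, ∫ z : Ω × 𝕏, condDiff P ηt (expFunctional h) (z, t) *
      condDiff P ηt (expFunctional k) (z, t) ∂(P.prod Λ) =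
      Real.exp (-(a + b)) * (q * Real.exp (t * q)) := by
    filter_upwards [ae_unitMeasure_mem] with t ht
    have ht' : t ∈ Icc (0 : ℝ) 1 := Ioc_subset_Icc_self ht
    have e1 (z : Ω × 𝕏) : condDiff P ηt (expFunctional h) (z, t) *
        condDiff P ηt (expFunctional k) (z, t) =
        (Real.exp (-((1 - t) * a)) * Real.exp (-((1 - t) * b))) *
          (expFunctional (h + k) (ηt t z.1) * (expDefect h z.2 * expDefect k z.2)) := by
      rw [H.condDiff_expFunctional hh hL ht' z.1 z.2, H.condDiff_expFunctional hk hL' ht' z.1 z.2,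
        ← expFunctional_mul hh]
      ring
    have hLt : laplaceExponent (ENNReal.ofReal t • Λ) (h + k) ≠ ∞ := by
      rw [laplaceExponent_smul]; exact ENNReal.mul_ne_top (by simp) hLs
    simp only [e1]
    rw [integral_const_mul, integral_prod_mul (fun ω => expFunctional (h + k) (ηt t ω))
      (fun x => expDefect h x * expDefect k x),
      (H.isPoissonProcess_apply ht').integral_expFunctional (hh.add hk) hLt, laplaceExponent_smul,
      ENNReal.toReal_mul, ENNReal.toReal_ofReal ht'.1, hs, ← Real.exp_add, ← mul_assoc,
      ← Real.exp_add, mul_comm q, ← mul_assoc, ← Real.exp_add]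
    congr 2
    ring
  rw [integral_congr_ae key, integral_const_mul, unitMeasure,
    ← intervalIntegral.integral_of_le zero_le_one]
  have hd (t : ℝ) : HasDerivAt (fun t => Real.exp (t * q)) (q * Real.exp (t * q)) t := by
    simpa [mul_comm] using ((hasDerivAt_id t).mul_const q).exp
  rw [intervalIntegral.integral_eq_sub_of_hasDerivAt (fun t _ => hd t)
    (by apply Continuous.intervalIntegrable; fun_prop), one_mul, zero_mul, Real.exp_zero,
    mul_sub, ← Real.exp_add, mul_one, ← Real.exp_add]
  congr 2 <;> ring

end IsThinningFamily

/-! ### Density of the exponential functionals in L². -/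

lemma L2_inner_toLp {α : Type*} [MeasurableSpace α] {μ : Measure α} {f g : α → ℝ}
    (hf : MemLp f 2 μ) (hg : MemLp g 2 μ) :
    inner ℝ (hf.toLp f) (hg.toLp g) = ∫ a, f a * g a ∂μ := by
  rw [L2.inner_def]
  refine integral_congr_ae ?_
  filter_upwards [hf.coeFn_toLp, hg.coeFn_toLp] with a h1 h2
  rw [h1, h2]
  simp [mul_comm]

lemma L2_inner_eq {α : Type*} [MeasurableSpace α] {μ : Measure α} (F G : Lp ℝ 2 μ) :
    inner ℝ F G = ∫ a, F a * G a ∂μ := by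
  rw [L2.inner_def]
  simp [mul_comm]

section Dense

variable {𝕏 : Type*} [MeasurableSpace 𝕏] {Λ : Measure 𝕏}

/-- The exponential functional as an element of `L²`. -/
noncomputable def expLp (Q : Measure (PointMeasure 𝕏)) [IsFiniteMeasure Q] {h : 𝕏 → ℝ≥0∞}
    (hh : Measurable h) : Lp ℝ 2 Q := (memLp_expFunctional hh Q 2).toLp _

lemma coeFn_expLp (Q : Measure (PointMeasure 𝕏)) [IsFiniteMeasure Q] {h : 𝕏 → ℝ≥0∞}
    (hh : Measurable h) : expLp Q hh =ᵐ[Q] expFunctional h :=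
  (memLp_expFunctional hh Q 2).coeFn_toLp

/-- The exponential functionals with finite Laplace exponent, as elements of `L²`. -/
def expLpSet (Λ : Measure 𝕏) (Q : Measure (PointMeasure 𝕏)) [IsFiniteMeasure Q] :
    Set (Lp ℝ 2 Q) :=
  {F | ∃ (h : 𝕏 → ℝ≥0∞) (hh : Measurable h), laplaceExponent Λ h ≠ ∞ ∧ F = expLp Q hh}

/-- Since 1 - e^{-h} ≤ 1, restricting h to a set of finite intensity always makes the exponent
finite, even where h = ∞. -/
lemma laplaceExponent_indicator_ne_top (h : 𝕏 → ℝ≥0∞) {A : Set 𝕏} (hA : MeasurableSet A)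
    (hΛA : Λ A ≠ ∞) : laplaceExponent Λ (A.indicator h) ≠ ∞ := by
  refine ((lintegral_mono (g := A.indicator fun _ => 1) fun x => ?_).trans_lt
    (by rw [lintegral_indicator_const hA]; simpa using hΛA.lt_top)).ne
  by_cases hx : x ∈ A <;> simp [hx]

/-- The exponential functionals span a dense subspace of `L²`. -/
theorem topologicalClosure_span_expLpSet [SigmaFinite Λ] (Q : Measure (PointMeasure 𝕏))
    [IsFiniteMeasure Q] :
    (Submodule.span ℝ (expLpSet Λ Q)).topologicalClosure = ⊤ := by
  rw [Submodule.topologicalClosure_eq_top_iff, Submodule.eq_bot_iff]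
  intro G hG
  have hGint : Integrable G Q := (Lp.memLp G).integrable (by norm_num)
  have hGm : Measurable G := (Lp.stronglyMeasurable G).measurable
  have horth (h : 𝕏 → ℝ≥0∞) (hh : Measurable h) (hL : laplaceExponent Λ h ≠ ∞) :
      ∫ μ, expFunctional h μ * G μ ∂Q = 0 := by
    have := (Submodule.mem_orthogonal _ _).1 hG _ (Submodule.subset_span ⟨h, hh, hL, rfl⟩)
    rw [L2_inner_eq] at this
    rw [← this]
    refine integral_congr_ae ?_
    filter_upwards [coeFn_expLp Q hh] with μ hμ
    rw [hμ]
  -- Orthogonality extends from finite exponents to every h by cutting off along sets of finite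
  -- intensity exhausting 𝕏.
  have hall (h : 𝕏 → ℝ≥0∞) (hh : Measurable h) : ∫ μ, expFunctional h μ * G μ ∂Q = 0 := by
    let A := spanningSets Λ
    have hA (n) : MeasurableSet (A n) := measurableSet_spanningSets Λ n
    have hmono : Monotone fun n => (A n).indicator h := fun i j hij =>
      indicator_le_indicator_of_subset (monotone_spanningSets Λ hij) fun _ => zero_le
    have hsup (x) : ⨆ n, (A n).indicator h x = h x := by
      refine le_antisymm (iSup_le fun n => indicator_le_self _ _ x) ?_
      have hx : x ∈ ⋃ n, A n := by simp only [A, iUnion_spanningSets]; trivial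
      obtain ⟨n, hn⟩ := mem_iUnion.1 hx
      exact le_iSup_of_le n (by rw [indicator_of_mem hn])
    have hlim : Tendsto (fun n => ∫ μ, expFunctional ((A n).indicator h) μ * G μ ∂Q) atTop
        (𝓝 (∫ μ, expFunctional h μ * G μ ∂Q)) := by
      refine tendsto_integral_of_dominated_convergence (fun μ => ‖G μ‖) (fun n => ?_) hGint.norm
        (fun n => .of_forall fun μ => ?_) (.of_forall fun μ => ?_)
      · exact ((measurable_expFunctional (hh.indicator (hA n))).mul hGm).aestronglyMeasurable
      · rw [norm_mul, Real.norm_of_nonneg (expFunctional_nonneg _ _)]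
        exact mul_le_of_le_one_left (norm_nonneg _) (expFunctional_le_one _ _)
      · refine Tendsto.mul_const _ ?_
        exact (ENNReal.tendsto_toReal (expNeg_ne_top _)).comp
          (Measurable.lintegral_expNeg_tendsto_of_monotone (fun μ : PointMeasure 𝕏 => μ.1)
            (fun n => hh.indicator (hA n)) hmono hsup μ)
    refine tendsto_nhds_unique hlim ?_
    simp only [horth _ (hh.indicator (hA _)) (laplaceExponent_indicator_ne_top h (hA _)
      (measure_spanningSets_lt_top Λ _).ne)]
    exact tendsto_const_nhds
  have hp : Measurable fun μ => ENNReal.ofReal (G μ) := hGm.ennreal_ofReal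
  have hn : Measurable fun μ => ENNReal.ofReal (-G μ) := hGm.neg.ennreal_ofReal
  have hpf : ∫⁻ μ, ENNReal.ofReal (G μ) ∂Q ≠ ∞ := hGint.lintegral_lt_top.ne
  have hnf : ∫⁻ μ, ENNReal.ofReal (-G μ) ∂Q ≠ ∞ := hGint.neg.lintegral_lt_top.ne
  have := isFiniteMeasure_withDensity hpf
  have := isFiniteMeasure_withDensity hnf
  -- Orthogonality says that the measures with densities G⁺ and G⁻ have equal Laplace functionals.
  -- They then coincide, which forces G = 0.
  have heq : (Q.withDensity fun μ => ENNReal.ofReal (G μ)) =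
      Q.withDensity fun μ => ENNReal.ofReal (-G μ) := by
    refine PointMeasure.ext_of_lintegral_expNeg fun h hh => ?_
    have hE : Measurable fun μ : PointMeasure 𝕏 => expNeg (∫⁻ x, h x ∂μ.1) :=
      measurable_expNeg.comp (PointMeasure.measurable_lintegral hh)
    rw [lintegral_withDensity_eq_lintegral_mul _ hp hE,
      lintegral_withDensity_eq_lintegral_mul _ hn hE]
    have h0 := hall h hh
    have hint : Integrable (fun μ => expFunctional h μ * G μ) Q :=
      hGint.bdd_mul (c := 1) (measurable_expFunctional hh).aestronglyMeasurable
        (.of_forall fun μ => by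
          rw [Real.norm_of_nonneg (expFunctional_nonneg h μ)]; exact expFunctional_le_one h μ)
    have hneg : ∫⁻ μ, ENNReal.ofReal (-(expFunctional h μ * G μ)) ∂Q ≠ ∞ :=
      hint.neg.lintegral_lt_top.ne
    rw [integral_eq_lintegral_pos_part_sub_lintegral_neg_part hint, sub_eq_zero,
      ENNReal.toReal_eq_toReal_iff' hint.lintegral_lt_top.ne hneg] at h0
    have hof (μ) : ENNReal.ofReal (expFunctional h μ) = expNeg (∫⁻ x, h x ∂μ.1) :=
      ENNReal.ofReal_toReal (expNeg_ne_top _)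
    simp only [← mul_neg, ENNReal.ofReal_mul (expFunctional_nonneg h _), hof] at h0
    simpa only [Pi.mul_apply, mul_comm] using h0
  rw [withDensity_eq_iff hp.aemeasurable hn.aemeasurable hpf] at heq
  rw [Lp.eq_zero_iff_ae_eq_zero]
  filter_upwards [heq] with μ hμ
  rw [Pi.zero_apply]
  rcases le_total 0 (G μ) with h | h
  · rw [ENNReal.ofReal_of_nonpos (show -G μ ≤ 0 by linarith), ENNReal.ofReal_eq_zero] at hμ
    exact le_antisymm hμ h
  · rw [ENNReal.ofReal_of_nonpos h, eq_comm, ENNReal.ofReal_eq_zero] at hμ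
    exact le_antisymm h (by linarith)

end Dense

lemma expFunctional_zero {𝕏 : Type*} [MeasurableSpace 𝕏] :
    expFunctional (0 : 𝕏 → ℝ≥0∞) = fun _ => 1 := by
  ext μ; simp [expFunctional]

/-- The constant function `1` as an element of `L²`. -/
noncomputable def oneLp {𝕏 : Type*} [MeasurableSpace 𝕏] (Q : Measure (PointMeasure 𝕏))
    [IsFiniteMeasure Q] : Lp ℝ 2 Q :=
  expLp Q (measurable_zero : Measurable (0 : 𝕏 → ℝ≥0∞))

lemma inner_oneLp {𝕏 : Type*} [MeasurableSpace 𝕏] (Q : Measure (PointMeasure 𝕏))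
    [IsFiniteMeasure Q] (F : Lp ℝ 2 Q) : inner ℝ (oneLp Q) F = ∫ μ, F μ ∂Q := by
  rw [L2_inner_eq]
  refine integral_congr_ae ?_
  filter_upwards [coeFn_expLp Q (measurable_zero : Measurable (0 : 𝕏 → ℝ≥0∞))] with μ hμ
  rw [oneLp, hμ, expFunctional_zero, one_mul]

lemma inner_oneLp_toLp {𝕏 : Type*} [MeasurableSpace 𝕏] (Q : Measure (PointMeasure 𝕏))
    [IsFiniteMeasure Q] {g : PointMeasure 𝕏 → ℝ} (hg : MemLp g 2 Q) :
    inner ℝ (oneLp Q) (hg.toLp g) = ∫ μ, g μ ∂Q := by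
  rw [inner_oneLp]
  exact integral_congr_ae hg.coeFn_toLp

/-! ### Extension of the averaged difference operator to L². -/

namespace IsThinningFamily

variable {Ω 𝕏 : Type*} [MeasurableSpace Ω] [MeasurableSpace 𝕏] {P : Measure Ω}
  {Λ : Measure 𝕏} {η : Ω → PointMeasure 𝕏} {κ : Ω → ℕ∞}
  {X : ℕ → Ω → 𝕏} {ηt : ℝ → Ω → PointMeasure 𝕏} [IsProbabilityMeasure P]

/-- The covariance identity for the elements `F` and `G` of `L²`. -/
def CovIdentity (P : Measure Ω) [IsProbabilityMeasure P] (Λ : Measure 𝕏)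
    (η : Ω → PointMeasure 𝕏) (ηt : ℝ → Ω → PointMeasure 𝕏) (F G : Lp ℝ 2 (P.map η)) : Prop :=
  Integrable (fun p => condDiff P ηt F p * condDiff P ηt G p) ((P.prod Λ).prod unitMeasure) ∧
  ∫ p, condDiff P ηt F p * condDiff P ηt G p ∂((P.prod Λ).prod unitMeasure) =
    inner ℝ F G - inner ℝ (oneLp (P.map η)) F * inner ℝ (oneLp (P.map η)) G

lemma CovIdentity.symm {F G : Lp ℝ 2 (P.map η)} (h : CovIdentity P Λ η ηt F G) :
    CovIdentity P Λ η ηt G F := by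
  simp only [CovIdentity, mul_comm (condDiff P ηt G _), real_inner_comm F G,
    mul_comm (inner ℝ (oneLp (P.map η)) G)]
  exact h

variable [SigmaFinite Λ]

lemma condDiff_coeFn_add (H : IsThinningFamily P Λ η κ X ηt) (F G : Lp ℝ 2 (P.map η)) :
    condDiff P ηt ⇑(F + G) =ᵐ[(P.prod Λ).prod unitMeasure]
      condDiff P ηt F + condDiff P ηt G := by
  have hF := (Lp.stronglyMeasurable F).measurable
  have hG := (Lp.stronglyMeasurable G).measurable
  exact (H.condDiff_congr (Lp.stronglyMeasurable _).measurable (hF.add hG)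
    (Lp.coeFn_add F G)).trans (H.condDiff_add hF (Lp.memLp F) hG (Lp.memLp G))

lemma condDiff_coeFn_smul (H : IsThinningFamily P Λ η κ X ηt) (c : ℝ) (F : Lp ℝ 2 (P.map η)) :
    condDiff P ηt ⇑(c • F) =ᵐ[(P.prod Λ).prod unitMeasure] c • condDiff P ηt F := by
  have hF := (Lp.stronglyMeasurable F).measurable
  rw [← condDiff_smul]
  exact H.condDiff_congr (Lp.stronglyMeasurable _).measurable (hF.const_smul c)
    (Lp.coeFn_smul c F)

lemma condDiff_coeFn_sub (H : IsThinningFamily P Λ η κ X ηt) (F G : Lp ℝ 2 (P.map η)) :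
    condDiff P ηt ⇑(F - G) =ᵐ[(P.prod Λ).prod unitMeasure]
      condDiff P ηt F - condDiff P ηt G := by
  filter_upwards [H.condDiff_coeFn_add (F - G) G] with p hp
  rw [sub_add_cancel] at hp
  simp only [Pi.add_apply, Pi.sub_apply] at hp ⊢
  linarith

lemma condDiff_coeFn_zero (H : IsThinningFamily P Λ η κ X ηt) :
    condDiff P ηt ⇑(0 : Lp ℝ 2 (P.map η)) =ᵐ[(P.prod Λ).prod unitMeasure] 0 := by
  simpa using H.condDiff_coeFn_smul 0 0

/-- Both sides are linear in G. Integrability is carried along with the identity so that integrals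
of sums can be split. -/
lemma covIdentity_of_mem_span (H : IsThinningFamily P Λ η κ X ηt) {S : Set (Lp ℝ 2 (P.map η))}
    {F G : Lp ℝ 2 (P.map η)} (hS : ∀ G ∈ S, CovIdentity P Λ η ηt F G)
    (hG : G ∈ Submodule.span ℝ S) : CovIdentity P Λ η ηt F G := by
  induction hG using Submodule.span_induction with
  | mem G hG => exact hS G hG
  | zero =>
    have h0 : (fun p => condDiff P ηt F p * condDiff P ηt ⇑(0 : Lp ℝ 2 (P.map η)) p)
        =ᵐ[(P.prod Λ).prod unitMeasure] 0 := by
      filter_upwards [H.condDiff_coeFn_zero] with p hp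
      rw [hp]; simp
    refine ⟨(integrable_zero _ _ _).congr h0.symm, ?_⟩
    rw [integral_congr_ae h0]
    simp
  | add G₁ G₂ _ _ h₁ h₂ =>
    have h0 : (fun p => condDiff P ηt F p * condDiff P ηt ⇑(G₁ + G₂) p)
        =ᵐ[(P.prod Λ).prod unitMeasure] fun p => condDiff P ηt F p * condDiff P ηt G₁ p +
          condDiff P ηt F p * condDiff P ηt G₂ p := by
      filter_upwards [H.condDiff_coeFn_add G₁ G₂] with p hp
      rw [hp, Pi.add_apply, mul_add]
    refine ⟨(h₁.1.add h₂.1).congr h0.symm, ?_⟩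
    rw [integral_congr_ae h0, integral_add h₁.1 h₂.1, h₁.2, h₂.2, inner_add_right, inner_add_right]
    ring
  | smul c G _ h =>
    have h0 : (fun p => condDiff P ηt F p * condDiff P ηt ⇑(c • G) p)
        =ᵐ[(P.prod Λ).prod unitMeasure] fun p => c * (condDiff P ηt F p * condDiff P ηt G p) := by
      filter_upwards [H.condDiff_coeFn_smul c G] with p hp
      rw [hp, Pi.smul_apply, smul_eq_mul]; ring
    refine ⟨(h.1.const_mul c).congr h0.symm, ?_⟩
    rw [integral_congr_ae h0, integral_const_mul, h.2, real_inner_smul_right,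
      real_inner_smul_right]
    ring

lemma condDiff_expLp (H : IsThinningFamily P Λ η κ X ηt) {h : 𝕏 → ℝ≥0∞} (hh : Measurable h) :
    condDiff P ηt (expLp (P.map η) hh) =ᵐ[(P.prod Λ).prod unitMeasure]
      condDiff P ηt (expFunctional h) :=
  H.condDiff_congr (Lp.stronglyMeasurable _).measurable (measurable_expFunctional hh)
    (coeFn_expLp _ hh)

lemma covIdentity_span (H : IsThinningFamily P Λ η κ X ηt) {F G : Lp ℝ 2 (P.map η)}
    (hF : F ∈ Submodule.span ℝ (expLpSet Λ (P.map η)))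
    (hG : G ∈ Submodule.span ℝ (expLpSet Λ (P.map η))) : CovIdentity P Λ η ηt F G := by
  refine H.covIdentity_of_mem_span (fun G hG => ?_) hG
  refine (H.covIdentity_of_mem_span (fun F hF => ?_) hF).symm
  obtain ⟨h, hh, hL, rfl⟩ := hG
  obtain ⟨k, hk, hL', rfl⟩ := hF
  have h0 : (fun p => condDiff P ηt (expLp (P.map η) hh) p * condDiff P ηt (expLp (P.map η) hk) p)
      =ᵐ[(P.prod Λ).prod unitMeasure] fun p => condDiff P ηt (expFunctional h) p *
        condDiff P ηt (expFunctional k) p := by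
    filter_upwards [H.condDiff_expLp hh, H.condDiff_expLp hk] with p h1 h2
    rw [h1, h2]
  refine ⟨(H.integrable_condDiff_mul_expFunctional hh hL hk hL').congr h0.symm, ?_⟩
  rw [integral_congr_ae h0, H.integral_condDiff_mul_expFunctional hh hL hk hL', expLp, expLp,
    L2_inner_toLp, inner_oneLp_toLp, inner_oneLp_toLp]

lemma memLp_condDiff_of_mem_span (H : IsThinningFamily P Λ η κ X ηt) {F : Lp ℝ 2 (P.map η)}
    (hF : F ∈ Submodule.span ℝ (expLpSet Λ (P.map η))) :
    MemLp (condDiff P ηt F) 2 ((P.prod Λ).prod unitMeasure) := by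
  rw [memLp_two_iff_integrable_sq
    (H.measurable_condDiff (Lp.stronglyMeasurable F).measurable).aestronglyMeasurable]
  simpa only [sq] using (H.covIdentity_span hF hF).1

/-- The operator `f ↦ condDiff f` on the span of the exponential functionals. -/
noncomputable def condDiffSpan (H : IsThinningFamily P Λ η κ X ηt) :
    Submodule.span ℝ (expLpSet Λ (P.map η)) →ₗ[ℝ] Lp ℝ 2 ((P.prod Λ).prod unitMeasure) where
  toFun F := (H.memLp_condDiff_of_mem_span F.2).toLp _
  map_add' F G := by
    rw [← MemLp.toLp_add, MemLp.toLp_eq_toLp_iff]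
    exact H.condDiff_coeFn_add F.1 G.1
  map_smul' c F := by
    rw [RingHom.id_apply, ← MemLp.toLp_const_smul, MemLp.toLp_eq_toLp_iff]
    exact H.condDiff_coeFn_smul c F.1

/-- On the diagonal the covariance identity reads ‖T F‖² = ‖F‖² - (E F)², so T is a contraction. -/
lemma norm_condDiffSpan_le (H : IsThinningFamily P Λ η κ X ηt)
    (F : Submodule.span ℝ (expLpSet Λ (P.map η))) :
    ‖H.condDiffSpan F‖ ≤ 1 * ‖(Submodule.span ℝ (expLpSet Λ (P.map η))).subtype F‖ := by
  rw [one_mul]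
  refine le_of_sq_le_sq ?_ (norm_nonneg _)
  rw [← real_inner_self_eq_norm_sq, ← real_inner_self_eq_norm_sq]
  have hF := H.memLp_condDiff_of_mem_span F.2
  change inner ℝ (hF.toLp _) (hF.toLp _) ≤ inner ℝ F.1 F.1
  rw [L2_inner_toLp, (H.covIdentity_span F.2 F.2).2]
  linarith [mul_self_nonneg (inner ℝ (oneLp (P.map η)) F.1)]

lemma denseRange_subtype_span (η : Ω → PointMeasure 𝕏) (Λ : Measure 𝕏) [SigmaFinite Λ] :
    DenseRange (Submodule.span ℝ (expLpSet Λ (P.map η))).subtype := by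
  rw [DenseRange, Submodule.coe_subtype, Subtype.range_coe]
  exact Submodule.dense_iff_topologicalClosure_eq_top.2 (topologicalClosure_span_expLpSet _)

/-- The operator `f ↦ condDiff f` from `L²(Q)`, where `Q` is the law of the Poisson process, to
`L²` of the product space. -/
noncomputable def condDiffCLM (H : IsThinningFamily P Λ η κ X ηt) :
    Lp ℝ 2 (P.map η) →L[ℝ] Lp ℝ 2 ((P.prod Λ).prod unitMeasure) :=
  H.condDiffSpan.extendOfNorm (Submodule.span ℝ (expLpSet Λ (P.map η))).subtype

lemma condDiffCLM_coe (H : IsThinningFamily P Λ η κ X ηt)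
    (F : Submodule.span ℝ (expLpSet Λ (P.map η))) : H.condDiffCLM F.1 = H.condDiffSpan F :=
  LinearMap.extendOfNorm_eq (denseRange_subtype_span η Λ) ⟨1, H.norm_condDiffSpan_le⟩ F

/-- The extension by density is abstract; this identifies it with the pointwise formula. Along a
sequence from the span, both candidates are limits in measure of the same functions on every set of
finite intensity, so they agree. -/
lemma coeFn_condDiffCLM (H : IsThinningFamily P Λ η κ X ηt) (F : Lp ℝ 2 (P.map η)) :
    H.condDiffCLM F =ᵐ[(P.prod Λ).prod unitMeasure] condDiff P ηt F := by
  have hF : F ∈ closure (range (Submodule.span ℝ (expLpSet Λ (P.map η))).subtype) :=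
    denseRange_subtype_span η Λ F
  obtain ⟨u, hu, hlim⟩ := mem_closure_iff_seq_limit.1 hF
  choose v hv using hu
  have hv' (n) : (v n).1 = u n := hv n
  have hcoe (n) : H.condDiffCLM (u n) =ᵐ[(P.prod Λ).prod unitMeasure] condDiff P ηt (u n) := by
    rw [← hv', H.condDiffCLM_coe]
    exact (H.memLp_condDiff_of_mem_span (v n).2).coeFn_toLp
  have hmeas (G : Lp ℝ 2 (P.map η)) : Measurable (condDiff P ηt G) :=
    H.measurable_condDiff (Lp.stronglyMeasurable G).measurable
  have hT := (Lp.tendsto_Lp_iff_tendsto_eLpNorm' _ _).1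
    ((H.condDiffCLM.continuous.tendsto F).comp hlim)
  have hu0 := (Lp.tendsto_Lp_iff_tendsto_eLpNorm' _ _).1 hlim
  refine ae_of_forall_restrict fun A hA hΛA => ?_
  obtain ⟨C, hC, hle⟩ := H.exists_lintegral_enorm_diff_le hA hΛA
  have hmono : (P.prod (Λ.restrict A)).prod unitMeasure ≤ (P.prod Λ).prod unitMeasure := by
    have : (P.prod (Λ.restrict A)).prod unitMeasure =
        ((P.prod Λ).prod unitMeasure).restrict ((univ ×ˢ A) ×ˢ univ) := by
      rw [← Measure.prod_restrict, ← Measure.prod_restrict, Measure.restrict_univ,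
        Measure.restrict_univ]
    rw [this]; exact Measure.restrict_le_self
  have hac := Measure.absolutelyContinuous_of_le hmono
  -- First limit: continuity of the extension in L².
  have h1 : TendstoInMeasure ((P.prod (Λ.restrict A)).prod unitMeasure)
      (fun n => condDiff P ηt (u n)) atTop (H.condDiffCLM F) := by
    refine TendstoInMeasure.congr_left (f := fun n => H.condDiffCLM (u n))
      (fun n => hac.ae_le (hcoe n)) ?_
    refine tendstoInMeasure_of_tendsto_eLpNorm (p := 2) (by simp)
      (fun n => (Lp.stronglyMeasurable _).aestronglyMeasurable)
      (Lp.stronglyMeasurable _).aestronglyMeasurable ?_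
    exact tendsto_of_tendsto_of_tendsto_of_le_of_le tendsto_const_nhds hT (fun _ => zero_le)
      (fun n => eLpNorm_mono_measure _ hmono)
  -- Second limit: the local L¹ bound, applied to the differences u n - F.
  have h2 : TendstoInMeasure ((P.prod (Λ.restrict A)).prod unitMeasure)
      (fun n => condDiff P ηt (u n)) atTop (condDiff P ηt F) := by
    refine tendstoInMeasure_of_tendsto_eLpNorm (p := 1) (by simp)
      (fun n => (hmeas _).aestronglyMeasurable) (hmeas _).aestronglyMeasurable ?_
    have hb (n) : eLpNorm (condDiff P ηt (u n) - condDiff P ηt F) 1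
        ((P.prod (Λ.restrict A)).prod unitMeasure) ≤ C * eLpNorm (⇑(u n) - ⇑F) 2 (P.map η) := by
      rw [← eLpNorm_congr_ae (hac.ae_le (H.condDiff_coeFn_sub (u n) F)),
        ← eLpNorm_congr_ae (Lp.coeFn_sub (u n) F), eLpNorm_one_eq_lintegral_enorm]
      exact H.lintegral_enorm_condDiff_le hle (Lp.stronglyMeasurable _).measurable
    refine tendsto_of_tendsto_of_tendsto_of_le_of_le tendsto_const_nhds ?_ (fun _ => zero_le) hb
    simpa using ENNReal.Tendsto.const_mul (a := C) hu0 (Or.inr hC)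
  exact tendstoInMeasure_ae_unique h1 h2

lemma memLp_condDiff (H : IsThinningFamily P Λ η κ X ηt) {f : PointMeasure 𝕏 → ℝ}
    (hf : Measurable f) (hf2 : MemLp f 2 (P.map η)) :
    MemLp (condDiff P ηt f) 2 ((P.prod Λ).prod unitMeasure) :=
  (Lp.memLp (H.condDiffCLM (hf2.toLp f))).ae_eq ((H.coeFn_condDiffCLM _).trans
    (H.condDiff_congr (Lp.stronglyMeasurable _).measurable hf hf2.coeFn_toLp))

lemma condDiffCLM_toLp (H : IsThinningFamily P Λ η κ X ηt) {f : PointMeasure 𝕏 → ℝ}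
    (hf : Measurable f) (hf2 : MemLp f 2 (P.map η)) :
    H.condDiffCLM (hf2.toLp f) = (H.memLp_condDiff hf hf2).toLp _ := by
  refine Lp.ext ?_
  refine ((H.coeFn_condDiffCLM _).trans ?_).trans (MemLp.coeFn_toLp _).symm
  exact H.condDiff_congr (Lp.stronglyMeasurable _).measurable hf hf2.coeFn_toLp

/-- The covariance identity of the thinning operator. -/
theorem inner_condDiffCLM (H : IsThinningFamily P Λ η κ X ηt) (F G : Lp ℝ 2 (P.map η)) :
    inner ℝ (H.condDiffCLM F) (H.condDiffCLM G) =
      inner ℝ F G - inner ℝ (oneLp (P.map η)) F * inner ℝ (oneLp (P.map η)) G := by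
  have hd := denseRange_subtype_span (P := P) η Λ
  -- Both sides are continuous in each argument, so the identity passes from the dense span to all
  -- of L².
  refine hd.induction_on F ?_ fun F' => ?_
  · exact isClosed_eq (by fun_prop) (by fun_prop)
  refine hd.induction_on G ?_ fun G' => ?_
  · exact isClosed_eq (by fun_prop) (by fun_prop)
  rw [Submodule.subtype_apply, Submodule.subtype_apply, condDiffCLM_coe, condDiffCLM_coe,
    ← (H.covIdentity_span F'.2 G'.2).2]
  exact L2_inner_toLp (H.memLp_condDiff_of_mem_span F'.2) (H.memLp_condDiff_of_mem_span G'.2)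

end IsThinningFamily

/-! ### The covariance representation with a plain difference in one factor. -/

namespace IsThinningFamily

variable {Ω 𝕏 : Type*} [MeasurableSpace Ω] [MeasurableSpace 𝕏] {P : Measure Ω}
  {Λ : Measure 𝕏} {η : Ω → PointMeasure 𝕏} {κ : Ω → ℕ∞}
  {X : ℕ → Ω → 𝕏} {ηt : ℝ → Ω → PointMeasure 𝕏} [IsProbabilityMeasure P] {t : ℝ}

/-- Conditionally on its thinning, the process is a superposition. -/
lemma integral_expFunctional_mul (H : IsThinningFamily P Λ η κ X ηt) (ht : t ∈ Icc (0 : ℝ) 1)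
    {h : 𝕏 → ℝ≥0∞} (hh : Measurable h) {k : PointMeasure 𝕏 → ℝ} (hk : Measurable k)
    (hkint : Integrable k (P.map η)) :
    ∫ ω, expFunctional h (ηt t ω) * k (η ω) ∂P =
      ∫ ω, expFunctional h (ηt t ω) * ∫ ω', k ((ηt t ω).add (ηt (1 - t) ω')) ∂P ∂P := by
  set w : Ω → ℝ≥0∞ := fun ω => expNeg (∫⁻ x, h x ∂(ηt t ω).1) with hw
  have hwm : Measurable w :=
    measurable_expNeg.comp ((PointMeasure.measurable_lintegral hh).comp (H.measurable_apply t))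
  have hwt : ∀ᵐ ω ∂P, w ω < ∞ := .of_forall fun ω => (expNeg_ne_top _).lt_top
  have hmap := (H.thinning t ht).map_withDensity_expNeg H.poisson H.proper ht
    (H.measurable_apply t) (H.isPoissonProcess_one_sub ht) hh
  rw [← hw] at hmap
  have hR : P.withDensity w ≤ P := by
    have := withDensity_mono (μ := P) (f := w) (g := 1) (.of_forall fun ω => expNeg_le_one _)
    rwa [withDensity_one] at this
  have : IsFiniteMeasure (P.withDensity w) := isFiniteMeasure_of_le P hR
  have hadd : Measurable fun p : Ω × Ω => (ηt t p.1).add (ηt (1 - t) p.2) :=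
    ((H.measurable_apply t).comp measurable_fst).pointMeasure_add
      ((H.measurable_apply (1 - t)).comp measurable_snd)
  have hint : Integrable k ((P.withDensity w).map η) :=
    hkint.mono_measure (Measure.map_mono hR H.poisson.measurable)
  have e1 : ∫ ω, expFunctional h (ηt t ω) * k (η ω) ∂P = ∫ μ, k μ ∂((P.withDensity w).map η) := by
    rw [integral_map H.poisson.measurable.aemeasurable hk.aestronglyMeasurable,
      integral_withDensity_eq_integral_toReal_smul hwm hwt]
    rfl
  rw [hmap] at e1 hint
  rw [e1, integral_map hadd.aemeasurable hk.aestronglyMeasurable, integral_prod,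
    integral_withDensity_eq_integral_toReal_smul hwm hwt]
  · rfl
  · exact (integrable_map_measure hk.aestronglyMeasurable hadd.aemeasurable).1 hint

variable [SigmaFinite Λ]

/-- For an exponential functional T is a deterministic factor times a functional of η_t. For fixed t
and x one may therefore condition on η_t, which replaces D_x g(η) by its conditional mean T g. -/
lemma integral_diff_mul_condDiff_expFunctional (H : IsThinningFamily P Λ η κ X ηt)
    {h : 𝕏 → ℝ≥0∞} (hh : Measurable h) (hL : laplaceExponent Λ h ≠ ∞)
    {g : PointMeasure 𝕏 → ℝ} (hg : Measurable g) (hg2 : MemLp g 2 (P.map η))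
    (hDg : MemLp (fun p : Ω × 𝕏 => PointMeasure.diff g p.2 (η p.1)) 2 (P.prod Λ)) :
    ∫ p, condDiff P ηt (expFunctional h) p * PointMeasure.diff g p.1.2 (η p.1.1)
        ∂((P.prod Λ).prod unitMeasure) =
      ∫ p, condDiff P ηt (expFunctional h) p * condDiff P ηt g p
        ∂((P.prod Λ).prod unitMeasure) := by
  have hφ := H.memLp_condDiff (measurable_expFunctional hh) (memLp_expFunctional hh _ 2)
  have hi1 : Integrable (fun p => condDiff P ηt (expFunctional h) p *
      PointMeasure.diff g p.1.2 (η p.1.1)) ((P.prod Λ).prod unitMeasure) :=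
    hφ.integrable_mul (hDg.comp_fst unitMeasure)
  have hi2 : Integrable (fun p => condDiff P ηt (expFunctional h) p * condDiff P ηt g p)
      ((P.prod Λ).prod unitMeasure) :=
    hφ.integrable_mul (H.memLp_condDiff hg hg2)
  -- Conditioning needs D_x g to be integrable for fixed x; the L² assumption gives this for almost
  -- every x.
  have hDx : ∀ᵐ x ∂Λ, Integrable (PointMeasure.diff g x) (P.map η) := by
    have hgx (x) : Measurable (PointMeasure.diff g x) :=
      hg.pointMeasure_diff measurable_const measurable_id
    filter_upwards [hDg.integrable_sq.prod_left_ae] with x hx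
    rw [integrable_map_measure (hgx x).aestronglyMeasurable H.poisson.measurable.aemeasurable]
    exact ((memLp_two_iff_integrable_sq
      ((hgx x).comp H.poisson.measurable).aestronglyMeasurable).2 hx).integrable (by norm_num)
  rw [integral_prod_symm _ hi1, integral_prod_symm _ hi2]
  refine integral_congr_ae ?_
  filter_upwards [hi1.prod_left_ae, hi2.prod_left_ae, ae_unitMeasure_mem] with t h1 h2 ht
  have ht' : t ∈ Icc (0 : ℝ) 1 := Ioc_subset_Icc_self ht
  rw [integral_prod_symm _ h1, integral_prod_symm _ h2]
  refine integral_congr_ae ?_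
  filter_upwards [hDx] with x hx
  have hgx : Measurable (PointMeasure.diff g x) :=
    hg.pointMeasure_diff measurable_const measurable_id
  simp only [H.condDiff_expFunctional hh hL ht', mul_assoc]
  rw [integral_const_mul, integral_const_mul, integral_const_mul, integral_const_mul,
    H.integral_expFunctional_mul ht' hh hgx hx]
  rfl

/-- The covariance representation through thinnings. -/
theorem integral_condDiff_mul_diff (H : IsThinningFamily P Λ η κ X ηt)
    {f : PointMeasure 𝕏 → ℝ} (hf : Measurable f) (hf2 : MemLp f 2 (P.map η))
    {g : PointMeasure 𝕏 → ℝ} (hg : Measurable g) (hg2 : MemLp g 2 (P.map η))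
    (hDg : MemLp (fun p : Ω × 𝕏 => PointMeasure.diff g p.2 (η p.1)) 2 (P.prod Λ)) :
    ∫ p, condDiff P ηt f p * PointMeasure.diff g p.1.2 (η p.1.1)
        ∂((P.prod Λ).prod unitMeasure) =
      ∫ μ, f μ * g μ ∂(P.map η) - (∫ μ, f μ ∂(P.map η)) * ∫ μ, g μ ∂(P.map η) := by
  have hD3 : MemLp (fun p : (Ω × 𝕏) × ℝ => PointMeasure.diff g p.1.2 (η p.1.1)) 2
      ((P.prod Λ).prod unitMeasure) := hDg.comp_fst unitMeasure
  -- With g fixed, both sides of the representation are continuous linear functionals of f, so it is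
  -- enough to compare them on exponential functionals.
  have key : (innerSL ℝ (hD3.toLp _)).comp H.condDiffCLM =
      innerSL ℝ (hg2.toLp g) - inner ℝ (oneLp (P.map η)) (hg2.toLp g) •
        innerSL ℝ (oneLp (P.map η)) := by
    refine ContinuousLinearMap.ext_on
      (Submodule.dense_iff_topologicalClosure_eq_top.2
        (topologicalClosure_span_expLpSet (Λ := Λ) (P.map η))) ?_
    rintro _ ⟨h, hh, hL, rfl⟩
    have e1 := H.inner_condDiffCLM (expLp (P.map η) hh) (hg2.toLp g)
    have e2 := H.integral_diff_mul_condDiff_expFunctional hh hL hg hg2 hDg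
    rw [expLp, H.condDiffCLM_toLp (measurable_expFunctional hh), H.condDiffCLM_toLp hg hg2,
      L2_inner_toLp, ← e2] at e1
    simp only [ContinuousLinearMap.comp_apply, innerSL_apply_apply, sub_apply,
      smul_apply, smul_eq_mul]
    rw [expLp, H.condDiffCLM_toLp (measurable_expFunctional hh), real_inner_comm, L2_inner_toLp,
      e1, real_inner_comm]
    ring
  have := DFunLike.congr_fun key (hf2.toLp f)
  simp only [ContinuousLinearMap.comp_apply, innerSL_apply_apply, sub_apply,
    smul_apply, smul_eq_mul] at this
  rw [H.condDiffCLM_toLp hf, real_inner_comm, L2_inner_toLp, real_inner_comm, L2_inner_toLp,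
    inner_oneLp_toLp, inner_oneLp_toLp] at this
  rw [this]
  ring

end IsThinningFamily

/-! ### The functional V_F(u) as a covariance. -/

lemma diffExp_eq {Ω 𝕏 : Type*} [MeasurableSpace 𝕏] (η : Ω → PointMeasure 𝕏)
    (f : PointMeasure 𝕏 → ℝ) (u : ℝ) (p : Ω × 𝕏) :
    diffExp η f u p = Real.exp (u * f (η p.1)) *
      (Real.exp (u * PointMeasure.diff f p.2 (η p.1)) - 1) := by
  rw [diffExp, PointMeasure.diff, PointMeasure.diff, mul_sub_one, ← Real.exp_add]
  ring_nf

namespace IsThinningFamily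

variable {Ω 𝕏 : Type*} [MeasurableSpace Ω] [MeasurableSpace 𝕏] {P : Measure Ω}
  {Λ : Measure 𝕏} {η : Ω → PointMeasure 𝕏} {κ : Ω → ℕ∞}
  {X : ℕ → Ω → 𝕏} {ηt : ℝ → Ω → PointMeasure 𝕏} [IsProbabilityMeasure P]

lemma varV_eq (H : IsThinningFamily P Λ η κ X ηt) {f : PointMeasure 𝕏 → ℝ} (hf : Measurable f)
    (u : ℝ) (ω : Ω) : varV Λ η ηt f u ω =
      ∫ x, (Real.exp (u * PointMeasure.diff f x (η ω)) - 1) *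
        ∫ t, condDiff P ηt f ((ω, x), t) ∂unitMeasure ∂Λ := by
  rw [varV]
  congr 1 with x
  rw [intervalIntegral.integral_of_le zero_le_one]
  congr 1
  refine setIntegral_congr_fun measurableSet_Ioc fun t ht => ?_
  have hm : Measurable fun μ : PointMeasure 𝕏 => PointMeasure.diff f x ((ηt t ω).add μ) :=
    hf.pointMeasure_diff measurable_const (measurable_const.pointMeasure_add measurable_id)
  rw [poissonProcessLaw_eq_map (H.isPoissonProcess_one_sub (Ioc_subset_Icc_self ht)),
    integral_map (H.measurable_apply _).aemeasurable hm.aestronglyMeasurable]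
  rfl

lemma measurable_varV [SFinite Λ] (H : IsThinningFamily P Λ η κ X ηt) {f : PointMeasure 𝕏 → ℝ}
    (hf : Measurable f) : Measurable fun q : ℝ × Ω => varV Λ η ηt f q.1 q.2 := by
  simp only [H.varV_eq hf]
  have h1 : Measurable fun q : (ℝ × Ω) × 𝕏 => PointMeasure.diff f q.2 (η q.1.2) :=
    hf.pointMeasure_diff measurable_snd
      (H.poisson.measurable.comp (measurable_snd.comp measurable_fst))
  have h2 : Measurable fun z : Ω × 𝕏 => ∫ t, condDiff P ηt f (z, t) ∂unitMeasure :=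
    (H.measurable_condDiff hf).stronglyMeasurable.integral_prod_right'.measurable
  have h3 : Measurable fun q : (ℝ × Ω) × 𝕏 =>
      ∫ t, condDiff P ηt f ((q.1.2, q.2), t) ∂unitMeasure :=
    h2.comp ((measurable_snd.comp measurable_fst).prodMk measurable_snd)
  have h4 : Measurable fun q : (ℝ × Ω) × 𝕏 => Real.exp (q.1.1 * PointMeasure.diff f q.2 (η q.1.2)) - 1 :=
    (((measurable_fst.comp measurable_fst).mul h1).exp).sub_const 1
  exact (h4.mul h3).stronglyMeasurable.integral_prod_right'.measurable

/-- The covariance of `F` and `e^{uF}` is the expectation of `e^{uF} V_F(u)`. -/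
theorem integrable_and_integral_exp_mul_varV [SigmaFinite Λ] (H : IsThinningFamily P Λ η κ X ηt)
    {f : PointMeasure 𝕏 → ℝ} (hf : Measurable f) (hf2 : MemLp (fun ω => f (η ω)) 2 P) {u : ℝ}
    (hu : MemLp (fun ω => Real.exp (u * f (η ω))) 2 P)
    (hD : MemLp (diffExp η f u) 2 (P.prod Λ)) :
    Integrable (fun ω => Real.exp (u * f (η ω)) * varV Λ η ηt f u ω) P ∧
    ∫ ω, Real.exp (u * f (η ω)) * varV Λ η ηt f u ω ∂P =
      ∫ ω, f (η ω) * Real.exp (u * f (η ω)) ∂P -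
        (∫ ω, f (η ω) ∂P) * ∫ ω, Real.exp (u * f (η ω)) ∂P := by
  have hηm := H.poisson.measurable.aemeasurable (μ := P)
  have hg : Measurable fun μ => Real.exp (u * f μ) := (hf.const_mul u).exp
  have hfg : Measurable fun μ => f μ * Real.exp (u * f μ) := hf.mul hg
  have hf2' : MemLp f 2 (P.map η) := (memLp_map_measure_iff hf.aestronglyMeasurable hηm).2 hf2
  have hg2 : MemLp (fun μ => Real.exp (u * f μ)) 2 (P.map η) :=
    (memLp_map_measure_iff hg.aestronglyMeasurable hηm).2 hu
  have key := H.integral_condDiff_mul_diff hf hf2' hg hg2 hD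
  have hint : Integrable (fun p => condDiff P ηt f p *
      PointMeasure.diff (fun μ => Real.exp (u * f μ)) p.1.2 (η p.1.1))
      ((P.prod Λ).prod unitMeasure) :=
    (H.memLp_condDiff hf hf2').integrable_mul (hD.comp_fst unitMeasure)
  -- Multiplying by e^{uF} turns e^{uD_xF} - 1 into D_x e^{uF}, and the product becomes the
  -- integrand of the covariance representation.
  have e (ω) : Real.exp (u * f (η ω)) * varV Λ η ηt f u ω = ∫ x, ∫ t, condDiff P ηt f ((ω, x), t) *
      PointMeasure.diff (fun μ => Real.exp (u * f μ)) x (η ω) ∂unitMeasure ∂Λ := by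
    rw [H.varV_eq hf, ← integral_const_mul]
    congr 1 with x
    rw [integral_mul_const, ← mul_assoc, ← diffExp_eq η f u (ω, x), mul_comm]
    rfl
  simp only [e]
  refine ⟨hint.integral_prod_left.integral_prod_left, ?_⟩
  rw [← integral_prod _ hint.integral_prod_left, ← integral_prod _ hint, key,
    integral_map hηm hfg.aestronglyMeasurable, integral_map hηm hf.aestronglyMeasurable,
    integral_map hηm hg.aestronglyMeasurable]

end IsThinningFamily

/-! ### Cumulant generating functions and the entropy inequality. -/

section Cumulant

variable {Ω : Type*} [MeasurableSpace Ω] {P : Measure Ω} [IsProbabilityMeasure P] {Y : Ω → ℝ}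
  {r s u : ℝ}

/-- Domination by 1 + e^{rY}: split according to the sign of Y. -/
lemma MemLp.exp_mul_of_le (hY : AEStronglyMeasurable Y P)
    (hr : MemLp (fun ω => Real.exp (r * Y ω)) 2 P) (h0 : 0 ≤ u) (hur : u ≤ r) :
    MemLp (fun ω => Real.exp (u * Y ω)) 2 P := by
  refine ((memLp_const (1 : ℝ)).add hr).of_le
    (Real.continuous_exp.comp_aestronglyMeasurable (hY.const_mul u)) (.of_forall fun ω => ?_)
  rw [Real.norm_of_nonneg (Real.exp_nonneg _), Pi.add_apply, Real.norm_of_nonneg (by positivity)]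
  rcases le_total 0 (Y ω) with h | h
  · have : Real.exp (u * Y ω) ≤ Real.exp (r * Y ω) :=
      Real.exp_le_exp.2 (mul_le_mul_of_nonneg_right hur h)
    linarith
  · have : Real.exp (u * Y ω) ≤ 1 := Real.exp_le_one_iff.2 (mul_nonpos_of_nonneg_of_nonpos h0 h)
    linarith [Real.exp_pos (r * Y ω)]

/-- Y and e^{uY} are positively correlated: integrate (Y - m)(e^{uY} - e^{um}) ≥ 0. Equivalently,
the derivative of the cumulant generating function is at least m. -/
lemma integral_mul_mgf_le (hY : MemLp Y 2 P) (hu : MemLp (fun ω => Real.exp (u * Y ω)) 2 P)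
    (h0 : 0 ≤ u) :
    (∫ ω, Y ω ∂P) * mgf Y P u ≤ ∫ ω, Y ω * Real.exp (u * Y ω) ∂P := by
  set m := ∫ ω, Y ω ∂P with hm
  have hYi : Integrable Y P := hY.integrable (by norm_num)
  have hui : Integrable (fun ω => Real.exp (u * Y ω)) P := hu.integrable (by norm_num)
  have hYu : Integrable (fun ω => Y ω * Real.exp (u * Y ω)) P := hY.integrable_mul hu
  have hYm : Integrable (fun ω => Y ω - m) P := hYi.sub (integrable_const m)
  have hd : Integrable (fun ω => Y ω * Real.exp (u * Y ω) - m * Real.exp (u * Y ω)) P :=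
    hYu.sub (hui.const_mul m)
  have hpos : 0 ≤ ∫ ω, (Y ω * Real.exp (u * Y ω) - m * Real.exp (u * Y ω) -
      (Y ω - m) * Real.exp (u * m)) ∂P := by
    refine integral_nonneg fun ω => ?_
    have : Y ω * Real.exp (u * Y ω) - m * Real.exp (u * Y ω) - (Y ω - m) * Real.exp (u * m) =
        (Y ω - m) * (Real.exp (u * Y ω) - Real.exp (u * m)) := by ring
    rw [Pi.zero_apply, this]
    rcases le_total m (Y ω) with h | h
    · exact mul_nonneg (by linarith) (sub_nonneg.2 (Real.exp_le_exp.2 (by gcongr)))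
    · exact mul_nonneg_of_nonpos_of_nonpos (by linarith)
        (sub_nonpos.2 (Real.exp_le_exp.2 (by gcongr)))
  rw [integral_sub hd (hYm.mul_const _),
    integral_sub hYu (hui.const_mul m), integral_const_mul, integral_mul_const,
    integral_sub hYi (integrable_const m), ← hm] at hpos
  simp only [integral_const, probReal_univ, one_smul, sub_self, zero_mul, sub_zero] at hpos
  rw [mgf]
  linarith

/-- Jensen's inequality, obtained from the tangent line of the exponential at um. -/
lemma mul_integral_le_cgf (hY : MemLp Y 2 P) (hu : MemLp (fun ω => Real.exp (u * Y ω)) 2 P) :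
    u * ∫ ω, Y ω ∂P ≤ cgf Y P u := by
  set m := ∫ ω, Y ω ∂P with hm
  have hYi : Integrable Y P := hY.integrable (by norm_num)
  have hui : Integrable (fun ω => Real.exp (u * Y ω)) P := hu.integrable (by norm_num)
  rw [cgf, Real.le_log_iff_exp_le (mgf_pos hui), mgf]
  have hYm : Integrable (fun ω => Y ω - m) P := hYi.sub (integrable_const m)
  have hint : Integrable (fun ω => Real.exp (u * m) * (u * (Y ω - m) + 1)) P :=
    ((hYm.const_mul u).add (integrable_const 1)).const_mul _
  calc Real.exp (u * m) = ∫ ω, Real.exp (u * m) * (u * (Y ω - m) + 1) ∂P := by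
        rw [integral_const_mul, integral_add (hYm.const_mul u) (integrable_const 1), integral_const_mul, integral_sub hYi (integrable_const m)]
        simp [hm]
    _ ≤ _ := by
        refine integral_mono hint hui fun ω => ?_
        have : Real.exp (u * Y ω) = Real.exp (u * m) * Real.exp (u * (Y ω - m)) := by
          rw [← Real.exp_add]; ring_nf
        simp only [this]
        gcongr
        exact Real.add_one_le_exp _

/-- The fundamental theorem of calculus is used up to the endpoints 0 and s. Differentiability is
only used in the interior, so continuity on the closed interval is supplied here. -/
lemma continuousOn_cgf_Icc (hY : AEStronglyMeasurable Y P)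
    (hs : MemLp (fun ω => Real.exp (s * Y ω)) 2 P) : ContinuousOn (cgf Y P) (Icc 0 s) := by
  have hi (u) (hu : u ∈ Icc 0 s) : Integrable (fun ω => Real.exp (u * Y ω)) P :=
    (MemLp.exp_mul_of_le hY hs hu.1 hu.2).integrable (by norm_num)
  refine ContinuousOn.log ?_ fun u hu => (mgf_pos (hi u hu)).ne'
  refine continuousOn_of_dominated (bound := fun ω => 1 + Real.exp (s * Y ω))
    (fun u hu => (hi u hu).aestronglyMeasurable) (fun u hu => .of_forall fun ω => ?_)
    ((integrable_const 1).add (hs.integrable (by norm_num))) (.of_forall fun ω => by fun_prop)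
  rw [Real.norm_of_nonneg (Real.exp_nonneg _)]
  rcases le_total 0 (Y ω) with h | h
  · have : Real.exp (u * Y ω) ≤ Real.exp (s * Y ω) :=
      Real.exp_le_exp.2 (mul_le_mul_of_nonneg_right hu.2 h)
    linarith
  · have : Real.exp (u * Y ω) ≤ 1 :=
      Real.exp_le_one_iff.2 (mul_nonpos_of_nonneg_of_nonpos hu.1 h)
    linarith [Real.exp_pos (s * Y ω)]

lemma hasDerivAt_cgf (hY : AEStronglyMeasurable Y P)
    (hr : MemLp (fun ω => Real.exp (r * Y ω)) 2 P) (hu : u ∈ Ioo 0 r) :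
    HasDerivAt (cgf Y P) ((∫ ω, Y ω * Real.exp (u * Y ω) ∂P) / mgf Y P u) u := by
  have hi (v) (hv : v ∈ Ioo 0 r) : Integrable (fun ω => Real.exp (v * Y ω)) P :=
    (MemLp.exp_mul_of_le hY hr hv.1.le hv.2.le).integrable (by norm_num)
  have hmem : u ∈ interior (integrableExpSet Y P) :=
    interior_maximal (fun v hv => hi v hv) isOpen_Ioo hu
  exact (hasDerivAt_mgf hmem).log (mgf_pos (hi u hu)).ne'

/-- The elementary inequality behind the entropy bound. -/
lemma mul_mul_le_entropy {a w l : ℝ} (ha : 0 < a) (hl0 : 0 ≤ l) (hl1 : l ≤ 1) :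
    a * (l * w) ≤ a * Real.log a - a + (l * Real.exp w + (1 - l)) := by
  have h1 : Real.exp (l * w) ≤ l * Real.exp w + (1 - l) := by
    have := convexOn_exp.2 (mem_univ w) (mem_univ 0) hl0 (sub_nonneg.2 hl1) (by ring)
    simpa using this
  -- Young's inequality for the dual pair a log a - a and e^b, at b = lw; h1 then linearises e^{lw}
  -- in l.
  have h2 : a * (l * w - Real.log a + 1) ≤ Real.exp (l * w) := by
    have h3 := Real.add_one_le_exp (l * w - Real.log a)
    calc a * (l * w - Real.log a + 1) ≤ a * Real.exp (l * w - Real.log a) := by gcongr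
      _ = Real.exp (l * w) := by
        rw [Real.exp_sub, Real.exp_log ha]; field_simp
  linarith [mul_add a (l * w - Real.log a) 1, mul_sub a (l * w) (Real.log a)]

lemma logMGF_eq_coe_cgf {Z : Ω → ℝ} {c : ℝ} (h : Integrable (fun ω => Real.exp (c * Z ω)) P) :
    logMGF P Z c = ((cgf Z P c : ℝ) : EReal) := by
  rw [logMGF, ← ofReal_integral_eq_lintegral_ofReal h (.of_forall fun ω => Real.exp_nonneg _),
    ← mgf, ENNReal.log_ofReal_of_pos (mgf_pos h), cgf]

/-- The entropy bound for the derivative of the cumulant generating function. -/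
lemma entropy_le (hY : MemLp Y 2 P) (hu : MemLp (fun ω => Real.exp (u * Y ω)) 2 P)
    {W : Ω → ℝ} (hW : Integrable (fun ω => Real.exp (u * Y ω) * W ω) P)
    {c l : ℝ} (hc : Integrable (fun ω => Real.exp (c * W ω)) P) (hl0 : 0 ≤ l) (hl1 : l ≤ 1) :
    l * (c * ((∫ ω, Real.exp (u * Y ω) * W ω ∂P) / mgf Y P u) - cgf W P c) ≤
      u * ((∫ ω, Y ω * Real.exp (u * Y ω) ∂P) / mgf Y P u) - cgf Y P u := by
  have hui : Integrable (fun ω => Real.exp (u * Y ω)) P := hu.integrable (by norm_num)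
  have hYu : Integrable (fun ω => Y ω * Real.exp (u * Y ω)) P := hY.integrable_mul hu
  set M := mgf Y P u with hM
  have hMpos : 0 < M := mgf_pos hui
  have hKpos : 0 < mgf W P c := mgf_pos hc
  have hlog : Real.exp (cgf W P c) = mgf W P c := exp_cgf hc
  set k := cgf W P c with hk
  set h := cgf Y P u with hh
  have hlogM : Real.log M = h := rfl
  -- Applied with a the tilted density e^{uY}/M and w = cW - log E e^{cW}. Then E a = E e^w = 1, so
  -- the terms -a and l e^w + (1 - l) cancel after integration.
  have hpt (ω) : l * c / M * (Real.exp (u * Y ω) * W ω) - l * k / M * Real.exp (u * Y ω) ≤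
      u / M * (Y ω * Real.exp (u * Y ω)) - (h + 1) / M * Real.exp (u * Y ω) +
        (l / Real.exp k * Real.exp (c * W ω) + (1 - l)) := by
    have := mul_mul_le_entropy (a := Real.exp (u * Y ω) / M) (w := c * W ω - k) (by positivity)
      hl0 hl1
    rw [Real.log_div (by positivity) hMpos.ne', Real.log_exp, hlogM, Real.exp_sub] at this
    calc _ = Real.exp (u * Y ω) / M * (l * (c * W ω - k)) := by ring
      _ ≤ _ := this
      _ = _ := by ring
  have hi1 : Integrable (fun ω => u / M * (Y ω * Real.exp (u * Y ω)) -
      (h + 1) / M * Real.exp (u * Y ω)) P := (hYu.const_mul _).sub (hui.const_mul _)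
  have hi2 : Integrable (fun ω => l / Real.exp k * Real.exp (c * W ω) + (1 - l)) P :=
    (hc.const_mul _).add (integrable_const _)
  have hi3 : Integrable (fun ω => l * c / M * (Real.exp (u * Y ω) * W ω) -
      l * k / M * Real.exp (u * Y ω)) P := (hW.const_mul _).sub (hui.const_mul _)
  have hi4 : Integrable (fun ω => u / M * (Y ω * Real.exp (u * Y ω)) -
      (h + 1) / M * Real.exp (u * Y ω) + (l / Real.exp k * Real.exp (c * W ω) + (1 - l))) P :=
    hi1.add hi2
  have key := integral_mono hi3 hi4 hpt
  have e1 : ∫ ω, Real.exp (u * Y ω) ∂P = M := rfl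
  have e2 : ∫ ω, Real.exp (c * W ω) ∂P = mgf W P c := rfl
  rw [integral_sub (hW.const_mul _) (hui.const_mul _),
    integral_add hi1 hi2,
    integral_sub (hYu.const_mul _) (hui.const_mul _),
    integral_add (hc.const_mul _) (integrable_const _)] at key
  simp only [integral_const_mul, e1, e2, integral_const, probReal_univ, one_smul] at key
  rw [div_mul_cancel₀ _ hMpos.ne', div_mul_cancel₀ _ hMpos.ne', hlog,
    div_mul_cancel₀ _ hKpos.ne'] at key
  calc _ = l * c / M * (∫ ω, Real.exp (u * Y ω) * W ω ∂P) - l * k := by ring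
    _ ≤ _ := key
    _ = _ := by ring

end Cumulant

/-! ### Extended real integrals. -/

section ExtIntegral

variable {s : ℝ} {g g' : ℝ → EReal}

/-- The endpoint s is a null set, so the open interval suffices. -/
lemma extIntegral_mono (h : ∀ u ∈ Ioo 0 s, g u ≤ g' u) : extIntegral s g ≤ extIntegral s g' := by
  have hae : ∀ᵐ u ∂(volume.restrict (Ioc 0 s)), g u ≤ g' u := by
    rw [← restrict_Ioo_eq_restrict_Ioc]
    filter_upwards [ae_restrict_mem measurableSet_Ioo] with u hu using h u hu
  refine EReal.sub_le_sub (EReal.coe_ennreal_le_coe_ennreal_iff.2 (lintegral_mono_ae ?_))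
    (EReal.coe_ennreal_le_coe_ennreal_iff.2 (lintegral_mono_ae ?_))
  · filter_upwards [hae] with u hu using EReal.toENNReal_le_toENNReal hu
  · filter_upwards [hae] with u hu using EReal.toENNReal_le_toENNReal (EReal.neg_le_neg_iff.2 hu)

lemma extIntegral_coe {k : ℝ → ℝ} (hk : IntegrableOn k (Ioc 0 s)) :
    extIntegral s (fun u => (k u : EReal)) = ((∫ u in Ioc 0 s, k u : ℝ) : EReal) := by
  have hp : ∫⁻ u in Ioc 0 s, ENNReal.ofReal (k u) ≠ ∞ := hk.lintegral_lt_top.ne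
  have hn : ∫⁻ u in Ioc 0 s, ENNReal.ofReal (-k u) ≠ ∞ := hk.neg.lintegral_lt_top.ne
  rw [extIntegral, integral_eq_lintegral_pos_part_sub_lintegral_neg_part hk, EReal.coe_sub,
    EReal.coe_ennreal_toReal hp, EReal.coe_ennreal_toReal hn]
  rfl

end ExtIntegral

lemma extIntegral_congr_ae {s : ℝ} {g g' : ℝ → EReal}
    (h : ∀ᵐ u ∂(volume.restrict (Ioc 0 s)), g u = g' u) : extIntegral s g = extIntegral s g' := by
  have h1 : ∀ᵐ u ∂(volume.restrict (Ioc 0 s)), (g u).toENNReal = (g' u).toENNReal := by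
    filter_upwards [h] with u hu; rw [hu]
  have h2 : ∀ᵐ u ∂(volume.restrict (Ioc 0 s)), (-g u).toENNReal = (-g' u).toENNReal := by
    filter_upwards [h] with u hu; rw [hu]
  rw [extIntegral, extIntegral, lintegral_congr_ae h1, lintegral_congr_ae h2]

lemma logMGF_congr_ae {Ω : Type*} [MeasurableSpace Ω] {P : Measure Ω} {Z Z' : Ω → ℝ}
    (h : Z =ᵐ[P] Z') (c : ℝ) : logMGF P Z c = logMGF P Z' c := by
  rw [logMGF, logMGF, lintegral_congr_ae]
  filter_upwards [h] with ω hω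
  rw [hω]

lemma logMGF_of_not_integrable {Ω : Type*} [MeasurableSpace Ω] {P : Measure Ω} {Z : Ω → ℝ}
    (hZ : Measurable Z) {c : ℝ} (h : ¬ Integrable (fun ω => Real.exp (c * Z ω)) P) :
    logMGF P Z c = ⊤ := by
  rw [logMGF, ENNReal.log_eq_top_iff]
  by_contra hne
  refine h ⟨(hZ.const_mul c).exp.aestronglyMeasurable, ?_⟩
  rw [hasFiniteIntegral_iff_ofReal (.of_forall fun ω => Real.exp_nonneg _)]
  exact lt_top_iff_ne_top.2 hne

/-! ### The differential inequality and its integration. -/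

section Concentration

variable {Ω : Type*} [MeasurableSpace Ω] {P : Measure Ω} [IsProbabilityMeasure P] {Y : Ω → ℝ}
  {V : ℝ → Ω → ℝ} {r s θ u : ℝ}

lemma logMGF_sub_integral (hs : MemLp (fun ω => Real.exp (s * Y ω)) 2 P) (m : ℝ) :
    logMGF P (fun ω => Y ω - m) s = ((cgf Y P s - s * m : ℝ) : EReal) := by
  have hi : Integrable (fun ω => Real.exp (s * Y ω)) P := hs.integrable (by norm_num)
  have e (ω) : Real.exp (s * (Y ω - m)) = Real.exp (-(s * m)) * Real.exp (s * Y ω) := by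
    rw [← Real.exp_add]; ring_nf
  have hi' : Integrable (fun ω => Real.exp (s * (Y ω - m))) P := by
    simp only [e]; exact hi.const_mul _
  rw [logMGF_eq_coe_cgf hi', cgf, mgf]
  simp only [e]
  rw [integral_const_mul, ← mgf, Real.log_mul (Real.exp_ne_zero _) (mgf_pos hi).ne', Real.log_exp,
    cgf]
  congr 1
  ring

/-- The differential inequality for the cumulant generating function. -/
lemma slope_le (hY : MemLp Y 2 P) (hu : MemLp (fun ω => Real.exp (u * Y ω)) 2 P)
    (hus : u ∈ Ioo 0 s) (hθ : θ ∈ Ioo (0 : ℝ) 1) {W : Ω → ℝ} (hWm : Measurable W)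
    (hW : Integrable (fun ω => Real.exp (u * Y ω) * W ω) P)
    (hcov : ∫ ω, Real.exp (u * Y ω) * W ω ∂P =
      ∫ ω, Y ω * Real.exp (u * Y ω) ∂P - (∫ ω, Y ω ∂P) * ∫ ω, Real.exp (u * Y ω) ∂P) :
    ((((1 - θ) * ((∫ ω, Y ω * Real.exp (u * Y ω) ∂P) / mgf Y P u) - ∫ ω, Y ω ∂P) / θ : ℝ) : EReal) ≤
      ((1 / s : ℝ) : EReal) * logMGF P W (s / θ) - ((1 / u : ℝ) : EReal) * logMGF P Y u := by
  have hui : Integrable (fun ω => Real.exp (u * Y ω)) P := hu.integrable (by norm_num)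
  have hs : 0 < s := hus.1.trans hus.2
  rw [logMGF_eq_coe_cgf hui, ← EReal.coe_mul]
  by_cases hc : Integrable (fun ω => Real.exp (s / θ * W ω)) P
  swap
  -- Without exponential integrability the right side is ∞ minus a real number.
  · rw [logMGF_of_not_integrable hWm hc, EReal.coe_mul_top_of_pos (by positivity),
      EReal.top_sub_coe]
    exact le_top
  rw [logMGF_eq_coe_cgf hc, ← EReal.coe_mul, ← EReal.coe_sub, EReal.coe_le_coe_iff]
  -- The weight l = u/s keeps the exponent s/θ independent of u: after division by u, the covariance
  -- carries the factor 1/θ and the logarithm the factor 1/s.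
  have key := entropy_le hY hu hW hc (l := u / s) (div_nonneg hus.1.le hs.le)
    ((div_le_one hs).2 hus.2.le)
  have hM : mgf Y P u ≠ 0 := (mgf_pos hui).ne'
  change _ = _ - _ * mgf Y P u at hcov
  rw [hcov, sub_div, mul_div_cancel_right₀ _ hM] at key
  set d := (∫ ω, Y ω * Real.exp (u * Y ω) ∂P) / mgf Y P u
  set m := ∫ ω, Y ω ∂P
  have h2 := mul_le_mul_of_nonneg_left key (one_div_nonneg.2 hus.1.le)
  have hθ0 := hθ.1.ne'
  have hu0 := hus.1.ne'
  have e1 : 1 / u * (u / s * (s / θ * (d - m) - cgf W P (s / θ))) =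
      (d - m) / θ - 1 / s * cgf W P (s / θ) := by field_simp
  have e2 : 1 / u * (u * d - cgf Y P u) = d - 1 / u * cgf Y P u := by field_simp
  have e3 : ((1 - θ) * d - m) / θ = (d - m) / θ - d := by field_simp; ring
  rw [e1, e2] at h2
  rw [e3]
  linarith

/-- Integration of the differential inequality. -/
lemma coe_le_extIntegral (hY : MemLp Y 2 P) (hs : 0 < s) (hsr : s < r)
    (hr : MemLp (fun ω => Real.exp (r * Y ω)) 2 P) (hθ : θ ∈ Ioo (0 : ℝ) 1)
    {g : ℝ → EReal}
    (hg : ∀ u ∈ Ioo 0 s, ((((1 - θ) * ((∫ ω, Y ω * Real.exp (u * Y ω) ∂P) / mgf Y P u) -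
      ∫ ω, Y ω ∂P) / θ : ℝ) : EReal) ≤ g u) :
    ((((1 - θ) * cgf Y P s - s * ∫ ω, Y ω ∂P) / θ : ℝ) : EReal) ≤ extIntegral s g := by
  set m := ∫ ω, Y ω ∂P with hm
  set d : ℝ → ℝ := fun u => (∫ ω, Y ω * Real.exp (u * Y ω) ∂P) / mgf Y P u with hd
  have hu2 (u) (hu : u ∈ Icc 0 s) : MemLp (fun ω => Real.exp (u * Y ω)) 2 P :=
    MemLp.exp_mul_of_le hY.1 hr hu.1 (hu.2.trans hsr.le)
  have hcont : ContinuousOn (fun u => cgf Y P u - u * m) (Icc 0 s) :=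
    (continuousOn_cgf_Icc hY.1 (hu2 s ⟨hs.le, le_rfl⟩)).sub (by fun_prop)
  have hderiv (u) (hu : u ∈ Ioo 0 s) : HasDerivAt (fun u => cgf Y P u - u * m) (d u - m) u := by
    have h1 : HasDerivAt (fun u => u * m) m u := by
      simpa using (hasDerivAt_id u).mul_const m
    exact (hasDerivAt_cgf hY.1 hr ⟨hu.1, hu.2.trans hsr⟩).sub h1
  have hnonneg (u) (hu : u ∈ Ioo 0 s) : 0 ≤ d u - m := by
    have h2 := hu2 u (Ioo_subset_Icc_self hu)
    rw [sub_nonneg, hd, le_div_iff₀ (mgf_pos (h2.integrable (by norm_num)))]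
    exact integral_mul_mgf_le hY h2 hu.1.le
  -- No bound on the derivative near the endpoints is available. Its integrability follows from its
  -- sign, which is why the mean is subtracted first.
  have hint := intervalIntegral.integrableOn_deriv_of_nonneg hcont hderiv hnonneg
  have hFTC := intervalIntegral.integral_eq_sub_of_hasDerivAt_of_le hs.le hcont hderiv
    ((intervalIntegrable_iff_integrableOn_Ioc_of_le hs.le).2 hint)
  rw [intervalIntegral.integral_of_le hs.le, cgf_zero] at hFTC
  have hθ0 := hθ.1.ne'
  have e (u) : ((1 - θ) * d u - m) / θ = (1 - θ) / θ * (d u - m) + (-m) := by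
    field_simp; ring
  have hi2 : IntegrableOn (fun _ : ℝ => -m) (Ioc 0 s) := integrableOn_const (by simp)
  have hk : IntegrableOn (fun u => (1 - θ) / θ * (d u - m) + (-m)) (Ioc 0 s) :=
    (hint.const_mul _).add hi2
  refine le_trans (le_of_eq ?_) (extIntegral_mono
    (g := fun u => (((1 - θ) / θ * (d u - m) + (-m) : ℝ) : EReal)) fun u hu => by
      rw [← e]; exact hg u hu)
  rw [extIntegral_coe hk, EReal.coe_eq_coe_iff, integral_add (hint.const_mul _) hi2,
    integral_const_mul, hFTC, integral_const]
  rw [measureReal_restrict_apply_univ, Real.volume_real_Ioc_of_le hs.le, smul_eq_mul]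
  field_simp
  ring

lemma logMGF_le_of_slope_le (hY : MemLp Y 2 P) (hs : 0 < s) (hsr : s < r)
    (hr : MemLp (fun ω => Real.exp (r * Y ω)) 2 P) (hθ : θ ∈ Ioo (0 : ℝ) 1)
    {g : ℝ → EReal}
    (hg : ∀ u ∈ Ioo 0 s, ((((1 - θ) * ((∫ ω, Y ω * Real.exp (u * Y ω) ∂P) / mgf Y P u) -
      ∫ ω, Y ω ∂P) / θ : ℝ) : EReal) ≤ g u) :
    logMGF P (fun ω => Y ω - ∫ ω', Y ω' ∂P) s ≤
      ((θ / (1 - θ) : ℝ) : EReal) * (extIntegral s g + ((s * ∫ ω, Y ω ∂P : ℝ) : EReal)) := by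
  have h1 : 0 < 1 - θ := sub_pos.2 hθ.2
  have hθ0 := hθ.1
  rw [logMGF_sub_integral (MemLp.exp_mul_of_le hY.1 hr hs.le hsr.le)]
  set m := ∫ ω, Y ω ∂P with hm
  refine le_trans (le_of_eq ?_) (mul_le_mul_of_nonneg_left
    (add_le_add_left (coe_le_extIntegral hY hs hsr hr hθ hg) _)
    (EReal.coe_nonneg.2 (by positivity)))
  rw [← EReal.coe_add, ← EReal.coe_mul, EReal.coe_eq_coe_iff]
  field_simp
  ring

/-- Removing the cumulant generating function from the bound. -/
lemma extIntegral_add_le (hY : MemLp Y 2 P) (hs : 0 < s)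
    (hr : MemLp (fun ω => Real.exp (s * Y ω)) 2 P) (hθ : θ ∈ Ioo (0 : ℝ) 1)
    {L : ℝ → EReal} (hLm : Measurable L)
    (hg : ∀ u ∈ Ioo 0 s, ((((1 - θ) * ((∫ ω, Y ω * Real.exp (u * Y ω) ∂P) / mgf Y P u) -
      ∫ ω, Y ω ∂P) / θ : ℝ) : EReal) ≤
        ((1 / s : ℝ) : EReal) * L u - ((1 / u : ℝ) : EReal) * logMGF P Y u) :
    extIntegral s (fun u => ((1 / s : ℝ) : EReal) * L u -
        ((1 / u : ℝ) : EReal) * logMGF P Y u) + ((s * ∫ ω, Y ω ∂P : ℝ) : EReal) ≤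
      ((1 / s : ℝ) : EReal) * extIntegral s L := by
  set m := ∫ ω, Y ω ∂P with hm
  have hu2 (u) (hu : u ∈ Ioo 0 s) : MemLp (fun ω => Real.exp (u * Y ω)) 2 P :=
    MemLp.exp_mul_of_le hY.1 hr hu.1.le hu.2.le
  have hlog (u) (hu : u ∈ Ioo 0 s) : logMGF P Y u = ((cgf Y P u : ℝ) : EReal) :=
    logMGF_eq_coe_cgf ((hu2 u hu).integrable (by norm_num))
  have hmean (u) (hu : u ∈ Ioo 0 s) : m ≤ 1 / u * cgf Y P u := by
    have := mul_integral_le_cgf hY (hu2 u hu)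
    rw [one_div, inv_mul_eq_div, le_div_iff₀ hu.1, mul_comm]
    exact this
  -- The slope bound with h'(u) ≥ m gives (1/s) L(u) - h(u)/u ≥ -m, and h(u)/u ≥ m then forces L(u)
  -- ≥ 0. Hence `extIntegral s L` has no negative part and ∞ - ∞ cannot occur.
  have hL0 (u) (hu : u ∈ Ioo 0 s) : 0 ≤ L u := by
    have h1 := hg u hu
    have h2 := hmean u hu
    have h3 : m ≤ (∫ ω, Y ω * Real.exp (u * Y ω) ∂P) / mgf Y P u := by
      rw [le_div_iff₀ (mgf_pos ((hu2 u hu).integrable (by norm_num)))]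
      exact integral_mul_mgf_le hY (hu2 u hu) hu.1.le
    rw [hlog u hu, ← EReal.coe_mul] at h1
    generalize L u = l at h1
    induction l using EReal.rec with
    | bot =>
      rw [EReal.coe_mul_bot_of_pos (by positivity), EReal.bot_sub] at h1
      exact absurd h1 (by simp)
    | top => exact le_top
    | coe l =>
      rw [← EReal.coe_mul, ← EReal.coe_sub, EReal.coe_le_coe_iff] at h1
      set d := (∫ ω, Y ω * Real.exp (u * Y ω) ∂P) / mgf Y P u
      have h4 : -m ≤ ((1 - θ) * d - m) / θ := by
        rw [le_div_iff₀ hθ.1]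
        nlinarith [mul_le_mul_of_nonneg_left h3 (sub_pos.2 hθ.2).le]
      have h5 : 0 ≤ 1 / s * l := by linarith
      exact EReal.coe_nonneg.2 (nonneg_of_mul_nonneg_right h5 (by positivity))
  have hae : ∀ᵐ u ∂(volume.restrict (Ioc 0 s)), 0 ≤ L u := by
    rw [← restrict_Ioo_eq_restrict_Ioc]
    filter_upwards [ae_restrict_mem measurableSet_Ioo] with u hu using hL0 u hu
  have hpm : Measurable fun u => (L u).toENNReal := hLm.ereal_toENNReal
  have hneg : ∫⁻ u in Ioc 0 s, (-L u).toENNReal = 0 := by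
    rw [lintegral_congr_ae (g := 0)]
    · simp
    · filter_upwards [hae] with u hu
      exact EReal.toENNReal_of_nonpos (EReal.neg_le_zero.2 hu)
  by_cases htop : ∫⁻ u in Ioc 0 s, (L u).toENNReal = ∞
  · have : extIntegral s L = ⊤ := by rw [extIntegral, htop, hneg]; simp
    rw [this, EReal.coe_mul_top_of_pos (by positivity)]
    exact le_top
  set l : ℝ → ℝ := fun u => (L u).toENNReal.toReal with hl
  have hli : IntegrableOn l (Ioc 0 s) :=
    integrable_toReal_of_lintegral_ne_top hpm.aemeasurable htop
  have hLl : ∀ᵐ u ∂(volume.restrict (Ioc 0 s)), L u = (l u : EReal) := by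
    filter_upwards [hae, ae_lt_top hpm htop] with u h1 h2
    rw [hl, EReal.coe_ennreal_toReal h2.ne, EReal.coe_toENNReal h1]
  have hi2 : IntegrableOn (fun _ : ℝ => m) (Ioc 0 s) := integrableOn_const (by simp)
  have hk : IntegrableOn (fun u => 1 / s * l u - m) (Ioc 0 s) := (hli.const_mul _).sub hi2
  -- By Jensen -h(u)/u ≤ -m, and the integral of the constant -m over (0, s] cancels the added sm.
  calc _ ≤ extIntegral s (fun u => ((1 / s : ℝ) : EReal) * L u - (m : EReal)) +
        ((s * m : ℝ) : EReal) := by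
        refine add_le_add_left (extIntegral_mono fun u hu => EReal.sub_le_sub le_rfl ?_) _
        rw [hlog u hu, ← EReal.coe_mul]
        exact EReal.coe_le_coe_iff.2 (hmean u hu)
    _ = extIntegral s (fun u => ((1 / s * l u - m : ℝ) : EReal)) + ((s * m : ℝ) : EReal) := by
        congr 1
        refine extIntegral_congr_ae ?_
        filter_upwards [hLl] with u hu
        rw [hu, ← EReal.coe_mul, ← EReal.coe_sub]
    _ = ((1 / s : ℝ) : EReal) * extIntegral s L := by
        rw [extIntegral_congr_ae hLl, extIntegral_coe hli, extIntegral_coe hk, ← EReal.coe_mul,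
          ← EReal.coe_add, EReal.coe_eq_coe_iff, integral_sub (hli.const_mul _) hi2,
          integral_const_mul, integral_const, measureReal_restrict_apply_univ,
          Real.volume_real_Ioc_of_le hs.le, smul_eq_mul]
        ring

end Concentration

/-! ### Assembly of the two bounds. -/

theorem mainTheorem2 {Ω 𝕏 : Type*} [MeasurableSpace Ω] [MeasurableSpace 𝕏]
    (P : Measure Ω) [IsProbabilityMeasure P] (Λ : Measure 𝕏) [SigmaFinite Λ]
    -- a proper Poisson process with intensity measure `Λ`
    (η : Ω → PointMeasure 𝕏) (hη : IsPoissonProcess P η Λ)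
    (κ : Ω → ℕ∞) (X : ℕ → Ω → 𝕏) (hproper : IsProperRep P η κ X)
    -- its `t`-thinnings, `0 ≤ t ≤ 1`, with any jointly measurable coupling over `t`
    (ηt : ℝ → Ω → PointMeasure 𝕏) (hηt_meas : Measurable (Function.uncurry ηt))
    (hηt : ∀ t ∈ Icc (0 : ℝ) 1, IsThinning P κ X t (ηt t))
    -- a square integrable Poisson functional `F = f(η)`
    (f : PointMeasure 𝕏 → ℝ) (hf : Measurable f)
    (F : Ω → ℝ) (hFf : F =ᵐ[P] fun ω => f (η ω)) (hF : MemLp F 2 P)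
    -- `s ∈ (0, s_F)`, with `D e^{uF} ∈ L²(P ⊗ Λ)` below `s`
    (s : ℝ) (hs : 0 < s) (hsF : (s : EReal) < criticalExponent P Λ η f F)
    (hD : ∀ u ∈ Ioo 0 s, MemLp (diffExp η f u) 2 (P.prod Λ)) :
    logMGF P (fun ω => F ω - ∫ ω', F ω' ∂P) s ≤
        ⨅ θ : Ioo (0 : ℝ) 1, ((θ / (1 - θ) : ℝ) : EReal) *
          (extIntegral s (fun u =>
              ((1 / s : ℝ) : EReal) * logMGF P (varV Λ η ηt f u) (s / θ) -
                ((1 / u : ℝ) : EReal) * logMGF P F u) +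
            ((s * ∫ ω, F ω ∂P : ℝ) : EReal)) ∧
      (⨅ θ : Ioo (0 : ℝ) 1, ((θ / (1 - θ) : ℝ) : EReal) *
          (extIntegral s (fun u =>
              ((1 / s : ℝ) : EReal) * logMGF P (varV Λ η ηt f u) (s / θ) -
                ((1 / u : ℝ) : EReal) * logMGF P F u) +
            ((s * ∫ ω, F ω ∂P : ℝ) : EReal))) ≤
        ⨅ θ : Ioo (0 : ℝ) 1, ((θ / (s * (1 - θ)) : ℝ) : EReal) *
          extIntegral s (fun u => logMGF P (varV Λ η ηt f u) (s / θ)) := by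
  have H : IsThinningFamily P Λ η κ X ηt := ⟨hη, hproper, hηt_meas, hηt⟩
  set Y : Ω → ℝ := fun ω => f (η ω) with hYdef
  have hY : MemLp Y 2 P := (memLp_congr_ae hFf).1 hF
  have hexp (c : ℝ) : (fun ω => Real.exp (c * F ω)) =ᵐ[P] fun ω => Real.exp (c * Y ω) := by
    filter_upwards [hFf] with ω hω
    rw [hω]
  -- Since s < s_F, some r > s has e^{rF} ∈ L², and domination covers all exponents in [0, r].
  -- Square integrability of D e^{uF} does not pass down in this way and is taken from `hD`.
  obtain ⟨_, ⟨r, ⟨-, hr, -⟩, rfl⟩, hsr⟩ := lt_sSup_iff.1 hsF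
  rw [EReal.coe_lt_coe_iff] at hsr
  rw [memLp_congr_ae (hexp r)] at hr
  have hm : ∫ ω, F ω ∂P = ∫ ω, Y ω ∂P := integral_congr_ae hFf
  have hlogF (u : ℝ) : logMGF P F u = logMGF P Y u := logMGF_congr_ae hFf u
  have hlogF' : logMGF P (fun ω => F ω - ∫ ω', F ω' ∂P) s =
      logMGF P (fun ω => Y ω - ∫ ω', Y ω' ∂P) s := by
    refine logMGF_congr_ae ?_ s
    filter_upwards [hFf] with ω hω
    rw [hm, hω]
  rw [hlogF']
  simp only [hm, hlogF]
  have hVm := H.measurable_varV hf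
  have hs2 : MemLp (fun ω => Real.exp (s * Y ω)) 2 P := MemLp.exp_mul_of_le hY.1 hr hs.le hsr.le
  have hslope (θ : Ioo (0 : ℝ) 1) (u) (hu : u ∈ Ioo 0 s) := by
    have hu2 : MemLp (fun ω => Real.exp (u * Y ω)) 2 P :=
      MemLp.exp_mul_of_le hY.1 hs2 hu.1.le hu.2.le
    have hV := H.integrable_and_integral_exp_mul_varV hf hY hu2 (hD u hu)
    exact slope_le hY hu2 hu θ.2 (hVm.comp measurable_prodMk_left) hV.1 hV.2
  refine ⟨le_iInf fun θ => logMGF_le_of_slope_le hY hs hsr hr θ.2 (hslope θ),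
    iInf_mono fun θ => ?_⟩
  have h1 : 0 < 1 - (θ : ℝ) := sub_pos.2 θ.2.2
  have hθ0 : 0 < (θ : ℝ) := θ.2.1
  have hLm : Measurable fun u => logMGF P (varV Λ η ηt f u) (s / θ) :=
    Measurable.ennreal_log (Measurable.lintegral_prod_right'
      (f := fun q : ℝ × Ω => ENNReal.ofReal (Real.exp (s / θ * varV Λ η ηt f q.1 q.2)))
      (hVm.const_mul _).exp.ennreal_ofReal)
  have e : (((θ : ℝ) / (s * (1 - θ)) : ℝ) : EReal) =
      ((θ / (1 - θ) : ℝ) : EReal) * ((1 / s : ℝ) : EReal) := by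
    rw [← EReal.coe_mul, EReal.coe_eq_coe_iff]
    field_simp
  rw [e, mul_assoc]
  exact mul_le_mul_of_nonneg_left (extIntegral_add_le hY hs hs2 θ.2 hLm (hslope θ))
    (EReal.coe_nonneg.2 (by positivity))
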